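/- Let $M\ge 1$, $m\ge 0$, let $\nu_1,\dots,\nu_M\ge 0$ be integers and $\nu_0=0$. Put $$f(x)=G^{1,0}_{0,M+1}\left(x\,\middle|\,-\nu_0,-\nu_1,\dots,-\nu_M\right),\qquad g(y)=G^{M,0}_{0,M+1}\left(y\,\middle|\,\nu_1,\dots,\nu_M,\nu_0\right)\qquad(x,y>0),$$ where for $p=n=0$ the Meijer function is $G^{k,0}_{0,q}(z|b_1,\dots,b_q)=\frac1{2\pi i}\int_C\frac{\prod_{j\le k}\Gamma(b_j-s)}{\prod_{j>k}\Gamma(1-b_j+s)}z^s\,ds$, with $C$ a loop that starts and ends at $+\infty$ and encircles the poles of $\Gamma(b_j-s)$, $j\le k$, once clockwise. Define $\alpha_i$ by $\prod_{i=1}^M(X-\nu_i)=\sum_{i=0}^M\alpha_iX^i$ and, for $0\le j\le M$, $$\phi_j=(-1)^{M-j+1}\Big(x\tfrac{d}{dx}\Big)^jf,\qquad \psi_j=\sum_{i=0}^{M-j}\alpha_{i+j}\Big(y\tfrac{d}{dy}\Big)^ig,\qquad K_M(x,y)=\frac{\sum_{j=0}^M\phi_j(x)\psi_j(y)}{x-y},$$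 where the value at $x=y$ is given by L'Hospital's rule. For $0<a_1<\dots<a_{2m}$ let $J=\bigcup_{j=1}^m(a_{2j-1},a_{2j})$, let $K_M$ and $K_M'$ also denote the integral operators on functions on $(0,\infty)$ with kernels $K_M(x,y)\chi_J(y)$ and $K_M(y,x)\chi_J(y)$, and let $\det(1-K_M)$ be the Fredholm determinant, given by the Fredholm series. Here $(1-K_M)^{-1}$ and $(1-K_M')^{-1}$ are taken on the continuous functions on $(0,\infty)$. Put $c_l=1$ for odd $l$, $c_l=\sqrt{-1}$ for even $l$, and, for $1\le l\le 2m$, $0\le j\le M$, $$x_j^{(l)}=c_l\,\big((1-K_M)^{-1}\phi_j\big)(a_l),\qquad y_j^{(l)}=c_l\,\big((1-K_M')^{-1}\psi_j\big)(a_l),$$ $$\xi_j=(-1)^M\int_J\phi_0\,(1-K_M')^{-1}\psi_j\,dx+(-1)^{M+1-j}e_{M+1-j}(\nu_0,\dots,\nu_M),\qquad \eta_j=(-1)^M\int_J\phi_j\,(1-K_M')^{-1}\psi_M\,dx,$$ with $e_k$ the elementary symmetric polynomials. For functions $F,G$ of the variables $(x_j^{(k)},y_j^{(k)},\xi_j,\eta_j)$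 let $$\{F,G\}=\sum_{k=1}^{2m}\frac1{a_k}\sum_{j=0}^M\left(\frac{\partial F}{\partial x_j^{(k)}}\frac{\partial G}{\partial y_j^{(k)}}-\frac{\partial F}{\partial y_j^{(k)}}\frac{\partial G}{\partial x_j^{(k)}}\right)+(-1)^M\sum_{j=0}^M\left(\frac{\partial F}{\partial \xi_j}\frac{\partial G}{\partial \eta_j}-\frac{\partial F}{\partial \eta_j}\frac{\partial G}{\partial \xi_j}\right),$$ that is, $\{x_j^{(l)},y_i^{(k)}\}=\delta_{lk}\delta_{ij}/a_l$, $\{\xi_j,\eta_i\}=(-1)^M\delta_{ij}$, the other brackets of coordinates being $0$. Define the polynomials $$H_l=-\Big(\sum_{j=0}^M\eta_jy_j^{(l)}\Big)x_0^{(l)}+(-1)^{M+1}a_lx_0^{(l)}y_M^{(l)}-\sum_{j=0}^{M-1}x_{j+1}^{(l)}y_j^{(l)}+y_M^{(l)}\sum_{k=0}^M\xi_kx_k^{(l)}+\sum_{k\ne l}\frac{a_k}{a_l-a_k}\sum_{i,j=0}^Mx_i^{(k)}x_j^{(l)}y_i^{(l)}y_j^{(k)}.$$ The dynamical equations, for functions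 $x_j^{(l)},y_j^{(l)},\xi_j,\eta_j$ of $a_1,\dots,a_{2m}$ that have first partial derivatives, are $$\frac{\partial x_j^{(l)}}{\partial a_k}=-\frac{x_j^{(k)}}{a_l-a_k}\sum_{i=0}^Mx_i^{(l)}y_i^{(k)},\qquad \frac{\partial y_j^{(l)}}{\partial a_k}=-\frac{y_j^{(k)}}{a_k-a_l}\sum_{i=0}^Mx_i^{(k)}y_i^{(l)}\qquad(k\ne l,\ 0\le j\le M),$$ $$a_l\frac{\partial x_j^{(l)}}{\partial a_l}=-\eta_jx_0^{(l)}-x_{j+1}^{(l)}+\sum_{k\ne l}x_j^{(k)}\frac{a_k}{a_l-a_k}\sum_{i=0}^Mx_i^{(l)}y_i^{(k)}\qquad(0\le j\le M-1),$$ $$a_l\frac{\partial x_M^{(l)}}{\partial a_l}=-\eta_Mx_0^{(l)}+(-1)^{M+1}a_lx_0^{(l)}+\sum_{i=0}^M\xi_ix_i^{(l)}+\sum_{k\ne l}x_M^{(k)}\frac{a_k}{a_l-a_k}\sum_{i=0}^Mx_i^{(l)}y_i^{(k)},$$ $$a_l\frac{\partial y_j^{(l)}}{\partial a_l}=-\xi_jy_M^{(l)}+y_{j-1}^{(l)}+\sum_{k\ne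 l}y_j^{(k)}\frac{a_k}{a_k-a_l}\sum_{i=0}^Mx_i^{(k)}y_i^{(l)}\qquad(1\le j\le M),$$ $$a_l\frac{\partial y_0^{(l)}}{\partial a_l}=-\xi_0y_M^{(l)}+(-1)^Ma_ly_M^{(l)}+\sum_{i=0}^M\eta_iy_i^{(l)}+\sum_{k\ne l}y_0^{(k)}\frac{a_k}{a_k-a_l}\sum_{i=0}^Mx_i^{(k)}y_i^{(l)},$$ $$\frac{\partial\xi_j}{\partial a_l}=(-1)^{M+1}x_0^{(l)}y_j^{(l)},\qquad\frac{\partial\eta_j}{\partial a_l}=(-1)^{M+1}x_j^{(l)}y_M^{(l)}\qquad(0\le j\le M).$$ Proposition. (1) For arbitrary functions $x_j^{(l)},y_j^{(l)},\xi_j,\eta_j$ of the end points and at every $0<a_1<\dots<a_{2m}$, the dynamical equations are equivalent to the Hamiltonian equations $$\frac{\partial x_j^{(k)}}{\partial a_l}=\{x_j^{(k)},H_l\},\quad\frac{\partial y_j^{(k)}}{\partial a_l}=\{y_j^{(k)},H_l\},\quad\frac{\partial\xi_j}{\partial a_l}=\{\xi_j,H_l\},\quad\frac{\partial\eta_j}{\partial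 a_l}=\{\eta_j,H_l\}\qquad(1\le k,l\le 2m,\ 0\le j\le M).$$ (2) The Fredholm series of $\det(1-K_M)$ converges at every $0<a_1<\dots<a_{2m}$ with $\det(1-K_M)\ne0$; there $1-K_M$ and $1-K_M'$ are invertible on the continuous functions on $(0,\infty)$, $\det(1-K_M)$ has partial derivatives in all $a_l$, the functions $x_j^{(l)},y_j^{(l)},\xi_j,\eta_j$ defined above from $K_M$ satisfy the Hamiltonian equations, and along them the Hamiltonians are $$H_l=a_l\frac{\partial}{\partial a_l}\log\det(1-K_M),\qquad 1\le l\le 2m.$$ -/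

import Mathlib

namespace GenBessel

noncomputable section

/-! ### Meijer G-functions and the generalized Bessel kernel -/

/-- The integrand `∏_{j ≤ m} Γ(b_j - s) / ∏_{j > m} Γ(1 - b_j + s) * z ^ s` of the Meijer function
`G^{m,0}_{0,q}(z | b_1, ..., b_q)`. The parameters are indexed from `0`. Lean's `x / 0 = 0` and
`Γ(pole) = 0` give the correct value `0` of `1 / Γ` at the poles of `Γ`. -/
def meijerIntegrand (m : ℕ) {q : ℕ} (b : Fin q → ℂ) (z s : ℂ) : ℂ :=
  (∏ j with j.val < m, Complex.Gamma (b j - s)) /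
    (∏ j with m ≤ j.val, Complex.Gamma (1 - b j + s)) * z ^ s

/-- The Meijer function `G^{m,0}_{0,q}(z | b_1, ..., b_q)` for `q ≥ 1`, through its loop contour:
the contour comes from `+∞ - i` to `c - i`, goes up to `c + i` and returns to `+∞ + i`. It has the
poles of `Γ(b_j - s)`, `j ≤ m`, to its right when `c < Re b_j` and `|Im b_j| < 1` for these `j`.
(For `p = n = 0 < q` the integral over the loop converges for all `z ≠ 0`; an integral over a
vertical line gives the same value where it converges.) -/
def meijerG (c : ℝ) (m : ℕ) {q : ℕ} (b : Fin q → ℂ) (z : ℂ) : ℂ :=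
  (2 * Real.pi * Complex.I)⁻¹ *
    (-(∫ u in Set.Ioi c, meijerIntegrand m b z ((u : ℂ) - Complex.I))
      + Complex.I * (∫ v in (-1 : ℝ)..1, meijerIntegrand m b z ((c : ℂ) + v * Complex.I))
      + ∫ u in Set.Ioi c, meijerIntegrand m b z ((u : ℂ) + Complex.I))

variable {M : ℕ}

/-- `(ν_0, ν_1, ..., ν_M)` with `ν_0 = 0`; the argument `ν` lists `ν_1, ..., ν_M`. -/
def nuFull (ν : Fin M → ℕ) : Fin (M + 1) → ℂ :=
  Fin.cons (α := fun _ => ℂ) 0 (fun i => (ν i : ℂ))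

/-- `f(x) = G^{1,0}_{0,M+1}(x | -ν_0, -ν_1, ..., -ν_M)`. -/
def fFun (ν : Fin M → ℕ) (x : ℝ) : ℂ :=
  meijerG (-1 / 2) 1 (fun j : Fin (M + 1) => -nuFull ν j) (x : ℂ)

/-- `g(y) = G^{M,0}_{0,M+1}(y | ν_1, ..., ν_M, ν_0)`. -/
def gFun (ν : Fin M → ℕ) (y : ℝ) : ℂ :=
  meijerG (-1 / 2) M (Fin.snoc (α := fun _ => ℂ) (fun i : Fin M => (ν i : ℂ)) 0) (y : ℂ)

/-- The Euler operator `x d/dx`. -/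
def euler (h : ℝ → ℂ) : ℝ → ℂ := fun x => (x : ℂ) * deriv h x

/-- The coefficients in `∏_{i=1}^M (X - ν_i) = ∑_{i=0}^M α_i X^i`. -/
def alphaCoeff (ν : Fin M → ℕ) (i : ℕ) : ℂ :=
  (∏ l : Fin M, (Polynomial.X - Polynomial.C (ν l : ℂ))).coeff i

/-- `φ_j(x) = (-1)^{M-j+1} (x d/dx)^j f(x)`, `0 ≤ j ≤ M`. -/
def phi (ν : Fin M → ℕ) (j : Fin (M + 1)) (x : ℝ) : ℂ :=
  (-1) ^ (M - j.val + 1) * euler^[j.val] (fFun ν) x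

/-- `ψ_j(y) = ∑_{i=0}^{M-j} α_{i+j} (y d/dy)^i g(y)`, `0 ≤ j ≤ M`. -/
def psi (ν : Fin M → ℕ) (j : Fin (M + 1)) (y : ℝ) : ℂ :=
  ∑ i ∈ Finset.range (M - j.val + 1), alphaCoeff ν (i + j.val) * euler^[i] (gFun ν) y

/-- The generalized Bessel kernel `K_M(x,y) = (∑_j φ_j(x) ψ_j(y)) / (x - y)`, with the value on
the diagonal given by the rule of L'Hospital (differentiation in `x`). -/
def besselKernel (ν : Fin M → ℕ) (x y : ℝ) : ℂ :=
  if x = y then ∑ j, deriv (phi ν j) x * psi ν j x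
  else (∑ j, phi ν j x * psi ν j y) / ((x : ℂ) - (y : ℂ))

/-! ### Operators with a kernel on the half line -/

/-- The term of order `n` of the Fredholm series of `det (1 - K)`, where `K` is the integral
operator with kernel `k` over the measure `μ`. -/
def fredholmTerm (μ : MeasureTheory.Measure ℝ) (k : ℝ → ℝ → ℂ) (n : ℕ) : ℂ :=
  (-1) ^ n / (n.factorial : ℂ) *
    ∫ z : Fin n → ℝ, (Matrix.of fun i j => k (z i) (z j)).det
      ∂(MeasureTheory.Measure.pi fun _ => μ)

/-- The Fredholm determinant `det (1 - K)`. -/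
def fredholmDet (μ : MeasureTheory.Measure ℝ) (k : ℝ → ℝ → ℂ) : ℂ :=
  ∑' n, fredholmTerm μ k n

/-- `u` is a continuous solution on `(0, ∞)` of `(1 - K) u = h`, where `K` is the integral operator
with kernel `k` over `(0, ∞)`. -/
def IsResolventSolution (k : ℝ → ℝ → ℂ) (h u : ℝ → ℂ) : Prop :=
  ContinuousOn u (Set.Ioi 0) ∧ ∀ x ∈ Set.Ioi (0 : ℝ),
    MeasureTheory.IntegrableOn (fun y => k x y * u y) (Set.Ioi 0) ∧
      u x - ∫ y in Set.Ioi (0 : ℝ), k x y * u y = h x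

/-- `1 - K` is invertible on the continuous functions on `(0, ∞)`. -/
def IsInvertibleOneSub (k : ℝ → ℝ → ℂ) : Prop :=
  ∀ h : ℝ → ℂ, ContinuousOn h (Set.Ioi 0) →
    (∃ u, IsResolventSolution k h u) ∧
    ∀ u v, IsResolventSolution k h u → IsResolventSolution k h v → Set.EqOn u v (Set.Ioi 0)

/-- `(1 - K)⁻¹ h`: the solution `u` of `(1 - K) u = h` (an arbitrary function if there is none). -/
def oneSubInv (k : ℝ → ℝ → ℂ) (h : ℝ → ℂ) : ℝ → ℂ :=
  Classical.epsilon (IsResolventSolution k h)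

variable {m : ℕ}

/-- `J = ⋃_{j=1}^m (a_{2j-1}, a_{2j})`. The end points `a_1, ..., a_{2m}` are indexed from `0`. -/
def intervals (a : Fin (2 * m) → ℝ) : Set ℝ :=
  ⋃ j : Fin m, Set.Ioo (a ⟨2 * j.val, by omega⟩) (a ⟨2 * j.val + 1, by omega⟩)

/-- The kernel `K_M(x,y) χ_J(y)` of the operator `K_M`. -/
def kernelK (ν : Fin M → ℕ) (a : Fin (2 * m) → ℝ) (x y : ℝ) : ℂ :=
  besselKernel ν x y * (intervals a).indicator 1 y

/-- The kernel `K_M(y,x) χ_J(y)` of the operator `K_M'`. -/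
def kernelK' (ν : Fin M → ℕ) (a : Fin (2 * m) → ℝ) (x y : ℝ) : ℂ :=
  besselKernel ν y x * (intervals a).indicator 1 y

/-- `det (1 - K_M)` as a function of the end points; `K_M` acts on functions on `(0, ∞)`. -/
def detK (ν : Fin M → ℕ) (a : Fin (2 * m) → ℝ) : ℂ :=
  fredholmDet (MeasureTheory.volume.restrict (Set.Ioi 0)) (kernelK ν a)

/-! ### Phase space and Poisson bracket -/

/-- The phase space with coordinates `x_j^{(k)}, y_j^{(k)}, ξ_j, η_j`, where `1 ≤ k ≤ 2m` is
indexed from `0`, and `0 ≤ j ≤ M`. -/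
@[ext] structure Phase (m M : ℕ) where
  x : Fin (2 * m) → Fin (M + 1) → ℂ
  y : Fin (2 * m) → Fin (M + 1) → ℂ
  ξ : Fin (M + 1) → ℂ
  η : Fin (M + 1) → ℂ

/-- `∂F/∂x_j^{(k)}` at `p`. -/
def partialX (F : Phase m M → ℂ) (p : Phase m M) (k : Fin (2 * m)) (j : Fin (M + 1)) : ℂ :=
  deriv (fun t => F { p with x := Function.update p.x k (Function.update (p.x k) j t) }) (p.x k j)

/-- `∂F/∂y_j^{(k)}` at `p`. -/
def partialY (F : Phase m M → ℂ) (p : Phase m M) (k : Fin (2 * m)) (j : Fin (M + 1)) : ℂ :=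
  deriv (fun t => F { p with y := Function.update p.y k (Function.update (p.y k) j t) }) (p.y k j)

/-- `∂F/∂ξ_j` at `p`. -/
def partialXi (F : Phase m M → ℂ) (p : Phase m M) (j : Fin (M + 1)) : ℂ :=
  deriv (fun t => F { p with ξ := Function.update p.ξ j t }) (p.ξ j)

/-- `∂F/∂η_j` at `p`. -/
def partialEta (F : Phase m M → ℂ) (p : Phase m M) (j : Fin (M + 1)) : ℂ :=
  deriv (fun t => F { p with η := Function.update p.η j t }) (p.η j)

/-- The Poisson bracket `{F, G}` at the point `p`, with `{x_j^{(l)}, y_i^{(k)}} = δ_{lk} δ_{ij} / a_l`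
and `{ξ_j, η_i} = (-1)^M δ_{ij}`. -/
def poissonBracket (a : Fin (2 * m) → ℝ) (F G : Phase m M → ℂ) (p : Phase m M) : ℂ :=
  (∑ k, (1 / (a k : ℂ)) * ∑ j, (partialX F p k j * partialY G p k j
      - partialY F p k j * partialX G p k j))
    + (-1) ^ M * ∑ j, (partialXi F p j * partialEta G p j - partialEta F p j * partialXi G p j)

/-- The explicit polynomial form of the Hamiltonian `H_l`. -/
def hamiltonian (a : Fin (2 * m) → ℝ) (l : Fin (2 * m)) (p : Phase m M) : ℂ :=
  -(∑ j, p.η j * p.y l j) * p.x l 0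
    + (-1) ^ (M + 1) * (a l : ℂ) * p.x l 0 * p.y l (Fin.last M)
    - ∑ j : Fin M, p.x l j.succ * p.y l j.castSucc
    + p.y l (Fin.last M) * ∑ k, p.ξ k * p.x l k
    + ∑ k ∈ Finset.univ.erase l, ((a k : ℂ) / ((a l : ℂ) - (a k : ℂ))) *
        ∑ i, ∑ j, p.x k i * p.x l j * p.y l i * p.y k j

/-! ### Differential equations in the end points -/

/-- `u` has a partial derivative with respect to `a_l` at `a`. -/
def HasPartial (u : (Fin (2 * m) → ℝ) → ℂ) (l : Fin (2 * m)) (a : Fin (2 * m) → ℝ) : Prop :=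
  DifferentiableAt ℝ (fun t => u (Function.update a l t)) (a l)

/-- `∂u/∂a_l` at `a`. -/
def partialA (u : (Fin (2 * m) → ℝ) → ℂ) (l : Fin (2 * m)) (a : Fin (2 * m) → ℝ) : ℂ :=
  deriv (fun t => u (Function.update a l t)) (a l)

/-- All coordinates of `P` have partial derivatives with respect to all `a_l` at `a`. -/
structure HasPartials (P : (Fin (2 * m) → ℝ) → Phase m M) (a : Fin (2 * m) → ℝ) : Prop where
  x : ∀ l k j, HasPartial (fun b => (P b).x k j) l a
  y : ∀ l k j, HasPartial (fun b => (P b).y k j) l a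
  ξ : ∀ l j, HasPartial (fun b => (P b).ξ j) l a
  η : ∀ l j, HasPartial (fun b => (P b).η j) l a

/-- The system of dynamical equations (partial differential equations in the end points)
associated with the generalized Bessel kernel, at the point `a`. -/
structure DynamicalEquations (P : (Fin (2 * m) → ℝ) → Phase m M) (a : Fin (2 * m) → ℝ) :
    Prop where
  hasPartials : HasPartials P a
  x_off : ∀ k l, k ≠ l → ∀ j, partialA (fun b => (P b).x l j) k a =
    -((P a).x k j / ((a l : ℂ) - (a k : ℂ))) * ∑ i, (P a).x l i * (P a).y k i
  y_off : ∀ k l, k ≠ l → ∀ j, partialA (fun b => (P b).y l j) k a =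
    -((P a).y k j / ((a k : ℂ) - (a l : ℂ))) * ∑ i, (P a).x k i * (P a).y l i
  x_diag : ∀ l (j : Fin M), (a l : ℂ) * partialA (fun b => (P b).x l j.castSucc) l a =
    -(P a).η j.castSucc * (P a).x l 0 - (P a).x l j.succ
      + ∑ k ∈ Finset.univ.erase l, (P a).x k j.castSucc * ((a k : ℂ) / ((a l : ℂ) - (a k : ℂ))) *
          ∑ i, (P a).x l i * (P a).y k i
  x_diag_last : ∀ l, (a l : ℂ) * partialA (fun b => (P b).x l (Fin.last M)) l a =
    -(P a).η (Fin.last M) * (P a).x l 0 + (-1) ^ (M + 1) * (a l : ℂ) * (P a).x l 0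
      + ∑ i, (P a).ξ i * (P a).x l i
      + ∑ k ∈ Finset.univ.erase l, (P a).x k (Fin.last M) *
          ((a k : ℂ) / ((a l : ℂ) - (a k : ℂ))) * ∑ i, (P a).x l i * (P a).y k i
  y_diag : ∀ l (j : Fin M), (a l : ℂ) * partialA (fun b => (P b).y l j.succ) l a =
    -(P a).ξ j.succ * (P a).y l (Fin.last M) + (P a).y l j.castSucc
      + ∑ k ∈ Finset.univ.erase l, (P a).y k j.succ * ((a k : ℂ) / ((a k : ℂ) - (a l : ℂ))) *
          ∑ i, (P a).x k i * (P a).y l i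
  y_diag_zero : ∀ l, (a l : ℂ) * partialA (fun b => (P b).y l 0) l a =
    -(P a).ξ 0 * (P a).y l (Fin.last M) + (-1) ^ M * (a l : ℂ) * (P a).y l (Fin.last M)
      + ∑ i, (P a).η i * (P a).y l i
      + ∑ k ∈ Finset.univ.erase l, (P a).y k 0 * ((a k : ℂ) / ((a k : ℂ) - (a l : ℂ))) *
          ∑ i, (P a).x k i * (P a).y l i
  xi_eq : ∀ l j, partialA (fun b => (P b).ξ j) l a = (-1) ^ (M + 1) * (P a).x l 0 * (P a).y l j
  eta_eq : ∀ l j, partialA (fun b => (P b).η j) l a =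
    (-1) ^ (M + 1) * (P a).x l j * (P a).y l (Fin.last M)

/-- The Hamiltonian system `∂/∂a_l = {·, H_l}` at the point `a`, for Hamiltonians `H_l` that depend
on the dynamical variables and, explicitly, on the end points. -/
structure HamiltonEquations (H : (Fin (2 * m) → ℝ) → Fin (2 * m) → Phase m M → ℂ)
    (P : (Fin (2 * m) → ℝ) → Phase m M) (a : Fin (2 * m) → ℝ) : Prop where
  hasPartials : HasPartials P a
  x_eq : ∀ l k j, partialA (fun b => (P b).x k j) l a =
    poissonBracket a (fun p => p.x k j) (H a l) (P a)
  y_eq : ∀ l k j, partialA (fun b => (P b).y k j) l a =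
    poissonBracket a (fun p => p.y k j) (H a l) (P a)
  xi_eq : ∀ l j, partialA (fun b => (P b).ξ j) l a =
    poissonBracket a (fun p => p.ξ j) (H a l) (P a)
  eta_eq : ∀ l j, partialA (fun b => (P b).η j) l a =
    poissonBracket a (fun p => p.η j) (H a l) (P a)

/-! ### The dynamical variables of the kernel -/

/-- `√-1` for the end points `a_2, a_4, ...` and `1` for `a_1, a_3, ...` (indices from `0`). -/
def prefactor (l : Fin (2 * m)) : ℂ := if Even l.val then 1 else Complex.I

/-- The functions `x_j^{(l)}, y_j^{(l)}, ξ_j, η_j` of the end points that belong to `K_M`. Since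
`(1 - K_M)⁻¹ φ_j` and `(1 - K_M')⁻¹ ψ_j` are continuous on `(0, ∞)`, their values at `a_l` are the
limits from inside `J`. -/
def besselPhase (ν : Fin M → ℕ) (a : Fin (2 * m) → ℝ) : Phase m M where
  x := fun l j => prefactor l * oneSubInv (kernelK ν a) (phi ν j) (a l)
  y := fun l j => prefactor l * oneSubInv (kernelK' ν a) (psi ν j) (a l)
  ξ := fun j => (-1) ^ M * (∫ x in intervals a, phi ν 0 x * oneSubInv (kernelK' ν a) (psi ν j) x)
    + (-1) ^ (M + 1 - j.val) * (Finset.univ.val.map (nuFull ν)).esymm (M + 1 - j.val)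
  η := fun j => (-1) ^ M *
    ∫ x in intervals a, phi ν j x * oneSubInv (kernelK' ν a) (psi ν (Fin.last M)) x

/-- `H_l = a_l ∂/∂a_l log det (1 - K_M)`; the logarithmic derivative needs no branch of `log`. -/
def logDetHamiltonian (ν : Fin M → ℕ) (a : Fin (2 * m) → ℝ) (l : Fin (2 * m)) : ℂ :=
  (a l : ℂ) * logDeriv (fun t : ℝ => detK ν (Function.update a l t)) (a l)

end

end GenBessel

namespace GenBessel

/-! ### The Hamiltonian form of the dynamical equations -/

section Hamiltonian

variable {M m : ℕ}

/-! The brackets of the coordinates are canonical up to the factors `1 / a_k` and `(-1)^M`, so the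
first claim is a computation of the partial derivatives of the polynomials `H_l`. The substance lies
in the second claim: the quantities built from the kernel solve the dynamical equations, and `H_l`
is the logarithmic derivative of the determinant along them.

The kernel. On loop integrals the Euler operator multiplies the symbol by `s`, and a shift of `s` by
one multiplies the integral by `x`. The functional equation of `Γ` therefore gives a first order
linear system for the `φ_j` and one for the `ψ_j`, and moving the loop to the right gives bounds at
the origin. The two systems are adjoint up to a term `(-1)^(M+1) (x - y) φ_0(x) ψ_M(y)`, which is
the Euler derivative of `∑ φ_j(x) ψ_j(y)`. Integration along the ray `t ↦ (tx, ty)` yields `K_M(x,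
y) = (-1)^(M+1) ∫_0^1 φ_0(tx) ψ_M(ty) dt` (`sum_phi_mul_psi`, `besselKernel_eq`). Hence the kernel
is continuously differentiable, also across the diagonal, and has two structural properties
(`integrableKernel_besselKernel`): its product with `x - y` has finite rank, and its image under
`x∂_x + y∂_y + 1` has rank one.

Fredholm theory. `J` lies in a compact interval of `(0, ∞)`, on which the kernel is bounded.
Hadamard's inequality makes the Fredholm series converge, Fredholm's identities for the first minor
invert `1 - K` when the determinant is not zero (`isUnit_one_sub_kernelOp`), and a second order
estimate in the weight (`norm_fredholmSum_sub_le`) shows that `∂/∂a_l log det (1 - K)` is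
`-ρ_l(a_l)` at right and `ρ_l(a_l)` at left end points, where `ρ_l` is the resolvent kernel at
`a_l`.

Dynamics. Let `Q_j`, `P_j` be the solutions for `φ_j` and, with the transposed kernel, for `ψ_j`. A
motion of `a_l` changes a solution `u` at the rate `± u(a_l) ρ_l`. Commuting the resolvent with
multiplication by `x` gives `(x - a_l) ρ_l(x) = ∑ P_j(a_l) Q_j(x)`; commuting it with the Euler
operator, where integration by parts produces end point terms, gives the derivatives of `Q_j` and
`P_j`. In the total derivative of `Q_j(a_l)` the term of the own end point cancels, and duality
identifies the remaining coefficients with `ξ_j` and `η_j`. Finally `ρ_l(a_l) = ∑ P_j(a_l)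
Q_j'(a_l)`; inserting the derivatives produces `H_l`, the prefactors `c_l` absorbing the signs of
the end points. -/

theorem hasDerivAt_hamiltonian (a : Fin (2 * m) → ℝ) (l : Fin (2 * m)) {p : ℂ → Phase m M}
    {p' : Phase m M} {t : ℂ}
    (hx : ∀ k j, HasDerivAt (fun s => (p s).x k j) (p'.x k j) t)
    (hy : ∀ k j, HasDerivAt (fun s => (p s).y k j) (p'.y k j) t)
    (hξ : ∀ j, HasDerivAt (fun s => (p s).ξ j) (p'.ξ j) t)
    (hη : ∀ j, HasDerivAt (fun s => (p s).η j) (p'.η j) t) :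
    HasDerivAt (fun s => hamiltonian a l (p s))
      (-((∑ j, (p'.η j * (p t).y l j + (p t).η j * p'.y l j)) * (p t).x l 0
          + (∑ j, (p t).η j * (p t).y l j) * p'.x l 0)
        + (-1) ^ (M + 1) * (a l : ℂ) * (p'.x l 0 * (p t).y l (Fin.last M)
          + (p t).x l 0 * p'.y l (Fin.last M))
        - ∑ j : Fin M, (p'.x l j.succ * (p t).y l j.castSucc
          + (p t).x l j.succ * p'.y l j.castSucc)
        + (p'.y l (Fin.last M) * ∑ k, (p t).ξ k * (p t).x l k
          + (p t).y l (Fin.last M) * ∑ k, (p'.ξ k * (p t).x l k + (p t).ξ k * p'.x l k))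
        + ∑ k ∈ Finset.univ.erase l, ((a k : ℂ) / ((a l : ℂ) - (a k : ℂ))) *
            ((∑ i, (p'.x k i * (p t).y l i + (p t).x k i * p'.y l i)) *
                (∑ j, (p t).x l j * (p t).y k j)
              + (∑ i, (p t).x k i * (p t).y l i) *
                (∑ j, (p'.x l j * (p t).y k j + (p t).x l j * p'.y k j)))) t := by
  -- The quartic double sum factors into two bilinear sums, so that the product rule applies to it
  -- directly.
  have hH : (fun s => hamiltonian a l (p s)) = fun s =>
      -((∑ j, (p s).η j * (p s).y l j) * (p s).x l 0)
        + (-1) ^ (M + 1) * (a l : ℂ) * ((p s).x l 0 * (p s).y l (Fin.last M))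
        - ∑ j : Fin M, (p s).x l j.succ * (p s).y l j.castSucc
        + (p s).y l (Fin.last M) * ∑ k, (p s).ξ k * (p s).x l k
        + ∑ k ∈ Finset.univ.erase l, ((a k : ℂ) / ((a l : ℂ) - (a k : ℂ))) *
            ((∑ i, (p s).x k i * (p s).y l i) * (∑ j, (p s).x l j * (p s).y k j)) := by
    funext s
    unfold hamiltonian
    congr 1
    · ring
    · refine Finset.sum_congr rfl fun k _ => ?_
      congr 1
      rw [Finset.sum_mul_sum]
      refine Finset.sum_congr rfl fun i _ => Finset.sum_congr rfl fun j _ => ?_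
      ring
  rw [hH]
  refine ((((?_ : HasDerivAt _ _ t).neg.add ?_).sub ?_).add ?_).add ?_
  · exact (HasDerivAt.fun_sum fun j _ => (hη j).mul (hy l j)).mul (hx l 0)
  · exact ((hx l 0).mul (hy l _)).const_mul _
  · exact HasDerivAt.fun_sum fun j _ => (hx l _).mul (hy l _)
  · exact (hy l _).mul (HasDerivAt.fun_sum fun k _ => (hξ k).mul (hx l k))
  · refine HasDerivAt.fun_sum fun k _ => HasDerivAt.const_mul _ ?_
    exact (HasDerivAt.fun_sum fun i _ => (hx k i).mul (hy l i)).mul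
      (HasDerivAt.fun_sum fun j _ => (hx l j).mul (hy k j))

theorem hasDerivAt_update_apply {ι : Type*} [DecidableEq ι] (v : ι → ℂ) (i i' : ι) (t : ℂ) :
    HasDerivAt (fun s => Function.update v i s i') (if i' = i then 1 else 0) t := by
  by_cases h : i' = i
  · subst h; simpa using hasDerivAt_id' t
  · simpa [h] using hasDerivAt_const t (v i')

theorem hasDerivAt_update_update_apply {ι κ : Type*} [DecidableEq ι] [DecidableEq κ]
    (v : κ → ι → ℂ) (k k' : κ) (i i' : ι) (t : ℂ) :
    HasDerivAt (fun s => Function.update v k (Function.update (v k) i s) k' i')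
      (if k' = k ∧ i' = i then 1 else 0) t := by
  by_cases h : k' = k
  · subst h; simpa using hasDerivAt_update_apply (v k') i i' t
  · simpa [h] using hasDerivAt_const t (v k' i')

variable (a : Fin (2 * m) → ℝ) (l k : Fin (2 * m)) (p : Phase m M)

/-- For `k = l` the variable occurs in every term of `H_l`; for `k ≠ l` it occurs only in the
summand of index `k` of the quartic sum. In the second case the factor `a_k` is what later cancels
the `1 / a_k` of the bracket. -/
theorem partialY_hamiltonian (j : Fin (M + 1)) :
    partialY (hamiltonian a l) p k j =
      (if k = l then -p.η j * p.x l 0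
        + (if j = Fin.last M then (-1) ^ (M + 1) * (a l : ℂ) * p.x l 0 + ∑ i, p.ξ i * p.x l i
            else 0)
        - (∑ i : Fin M, if i.castSucc = j then p.x l i.succ else 0)
        + ∑ k ∈ Finset.univ.erase l, p.x k j * ((a k : ℂ) / ((a l : ℂ) - (a k : ℂ))) *
          ∑ i, p.x l i * p.y k i
      else ((a k : ℂ) / ((a l : ℂ) - (a k : ℂ))) * p.x l j * ∑ i, p.x k i * p.y l i) := by
  have h := hasDerivAt_hamiltonian a l
    (p := fun t => { p with y := Function.update p.y k (Function.update (p.y k) j t) })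
    (p' := ⟨0, fun k' i' => if k' = k ∧ i' = j then 1 else 0, 0, 0⟩) (t := p.y k j)
    (fun _ _ => by simpa using hasDerivAt_const _ _)
    (fun k' j' => hasDerivAt_update_update_apply p.y k k' j j' _)
    (fun _ => by simpa using hasDerivAt_const _ _)
    (fun _ => by simpa using hasDerivAt_const _ _)
  rw [partialY, h.deriv]
  by_cases hk : k = l
  · subst hk
    have h1 : ∀ k' ∈ Finset.univ.erase k, ((a k' : ℂ) / ((a k : ℂ) - (a k' : ℂ))) *
        (p.x k' j * ∑ i, p.x k i * p.y k' i
          + (∑ i, p.x k' i * p.y k i) * ∑ j', p.x k j' * (if k' = k ∧ j' = j then 1 else 0))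
        = p.x k' j * ((a k' : ℂ) / ((a k : ℂ) - (a k' : ℂ))) * ∑ i, p.x k i * p.y k' i := by
      intro k' hk'
      have : k' ≠ k := Finset.ne_of_mem_erase hk'
      simp [this]; ring
    simp only [Function.update_eq_self, Pi.zero_apply, zero_mul, zero_add, mul_zero, add_zero,
      true_and, mul_ite, mul_one, Finset.sum_ite_eq', Finset.mem_univ, if_true,
      Finset.sum_const_zero] at h1 ⊢
    rw [Finset.sum_congr rfl h1]
    by_cases hj : j = Fin.last M
    · subst hj; simp; ring
    · simp [hj, Ne.symm hj]
  · have hk' : l ≠ k := Ne.symm hk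
    simp only [Function.update_eq_self, Pi.zero_apply, zero_mul, zero_add, mul_zero, add_zero,
      hk', hk, false_and, if_false, mul_ite, mul_one, Finset.sum_const_zero, neg_zero, sub_zero]
    rw [Finset.sum_eq_single_of_mem k (by simp [hk])]
    · simp; ring
    · intro b _ hb
      simp [hb]

theorem partialX_hamiltonian (j : Fin (M + 1)) :
    partialX (hamiltonian a l) p k j =
      (if k = l then p.ξ j * p.y l (Fin.last M)
        + (if j = 0 then (-1) ^ (M + 1) * (a l : ℂ) * p.y l (Fin.last M) - ∑ i, p.η i * p.y l i
            else 0)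
        - (∑ i : Fin M, if i.succ = j then p.y l i.castSucc else 0)
        + ∑ k ∈ Finset.univ.erase l, p.y k j * ((a k : ℂ) / ((a l : ℂ) - (a k : ℂ))) *
          ∑ i, p.x k i * p.y l i
      else ((a k : ℂ) / ((a l : ℂ) - (a k : ℂ))) * p.y l j * ∑ i, p.x l i * p.y k i) := by
  have h := hasDerivAt_hamiltonian a l
    (p := fun t => { p with x := Function.update p.x k (Function.update (p.x k) j t) })
    (p' := ⟨fun k' i' => if k' = k ∧ i' = j then 1 else 0, 0, 0, 0⟩) (t := p.x k j)
    (fun k' j' => hasDerivAt_update_update_apply p.x k k' j j' _)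
    (fun _ _ => by simpa using hasDerivAt_const _ _)
    (fun _ => by simpa using hasDerivAt_const _ _)
    (fun _ => by simpa using hasDerivAt_const _ _)
  rw [partialX, h.deriv]
  by_cases hk : k = l
  · subst hk
    have h1 : ∀ k' ∈ Finset.univ.erase k, ((a k' : ℂ) / ((a k : ℂ) - (a k' : ℂ))) *
        ((∑ i, (if k' = k ∧ i = j then 1 else 0) * p.y k i) * (∑ i, p.x k i * p.y k' i)
          + (∑ i, p.x k' i * p.y k i) * p.y k' j)
        = p.y k' j * ((a k' : ℂ) / ((a k : ℂ) - (a k' : ℂ))) * ∑ i, p.x k' i * p.y k i := by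
      intro k' hk'
      have : k' ≠ k := Finset.ne_of_mem_erase hk'
      simp [this]; ring
    simp only [Function.update_eq_self, Pi.zero_apply, zero_mul, zero_add, mul_zero, add_zero,
      true_and, mul_ite, ite_mul, one_mul, mul_one, Finset.sum_ite_eq', Finset.mem_univ, if_true,
      Finset.sum_const_zero] at h1 ⊢
    rw [Finset.sum_congr rfl h1]
    by_cases hj : j = 0
    · subst hj; simp [Fin.succ_ne_zero]; ring
    · simp [hj, Ne.symm hj]; ring
  · have hk' : l ≠ k := Ne.symm hk
    simp only [Function.update_eq_self, Pi.zero_apply, zero_mul, zero_add, mul_zero, add_zero,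
      hk', hk, false_and, if_false, ite_mul, one_mul, Finset.sum_const_zero, neg_zero,
      sub_zero]
    rw [Finset.sum_eq_single_of_mem k (by simp [hk])]
    · simp; ring
    · intro b _ hb
      simp [hb]

theorem partialEta_hamiltonian (j : Fin (M + 1)) :
    partialEta (hamiltonian a l) p j = -(p.y l j * p.x l 0) := by
  have h := hasDerivAt_hamiltonian a l
    (p := fun t => { p with η := Function.update p.η j t })
    (p' := ⟨0, 0, 0, fun i' => if i' = j then 1 else 0⟩) (t := p.η j)
    (fun _ _ => by simpa using hasDerivAt_const _ _)
    (fun _ _ => by simpa using hasDerivAt_const _ _)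
    (fun _ => by simpa using hasDerivAt_const _ _)
    (fun j' => hasDerivAt_update_apply p.η j j' _)
  rw [partialEta, h.deriv]
  simp

theorem partialXi_hamiltonian (j : Fin (M + 1)) :
    partialXi (hamiltonian a l) p j = p.y l (Fin.last M) * p.x l j := by
  have h := hasDerivAt_hamiltonian a l
    (p := fun t => { p with ξ := Function.update p.ξ j t })
    (p' := ⟨0, 0, fun i' => if i' = j then 1 else 0, 0⟩) (t := p.ξ j)
    (fun _ _ => by simpa using hasDerivAt_const _ _)
    (fun _ _ => by simpa using hasDerivAt_const _ _)
    (fun j' => hasDerivAt_update_apply p.ξ j j' _)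
    (fun _ => by simpa using hasDerivAt_const _ _)
  rw [partialXi, h.deriv]
  simp

/-- A coordinate is paired with its conjugate only, so its bracket with `G` is a single partial
derivative. The three analogues below differ in sign and normalization. -/
theorem poissonBracket_x (G : Phase m M → ℂ) (j : Fin (M + 1)) :
    poissonBracket a (fun q => q.x k j) G p = 1 / (a k : ℂ) * partialY G p k j := by
  have h : ∀ k' j', partialX (fun q : Phase m M => q.x k j) p k' j'
      = if k = k' ∧ j = j' then 1 else 0 := fun k' j' =>
    (hasDerivAt_update_update_apply p.x k' k j' j _).deriv
  simp only [poissonBracket, h]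
  simp [partialY, partialXi, partialEta, ite_and]

theorem poissonBracket_y (G : Phase m M → ℂ) (j : Fin (M + 1)) :
    poissonBracket a (fun q => q.y k j) G p = -(1 / (a k : ℂ)) * partialX G p k j := by
  have h : ∀ k' j', partialY (fun q : Phase m M => q.y k j) p k' j'
      = if k = k' ∧ j = j' then 1 else 0 := fun k' j' =>
    (hasDerivAt_update_update_apply p.y k' k j' j _).deriv
  simp only [poissonBracket, h]
  simp [partialX, partialXi, partialEta, ite_and]

theorem poissonBracket_xi (G : Phase m M → ℂ) (j : Fin (M + 1)) :
    poissonBracket a (fun q => q.ξ j) G p = (-1) ^ M * partialEta G p j := by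
  have h : ∀ j', partialXi (fun q : Phase m M => q.ξ j) p j'
      = if j = j' then 1 else 0 := fun j' => (hasDerivAt_update_apply p.ξ j' j _).deriv
  simp only [poissonBracket, h]
  simp [partialX, partialY, partialEta]

theorem poissonBracket_eta (G : Phase m M → ℂ) (j : Fin (M + 1)) :
    poissonBracket a (fun q => q.η j) G p = -(-1) ^ M * partialXi G p j := by
  have h : ∀ j', partialEta (fun q : Phase m M => q.η j) p j'
      = if j = j' then 1 else 0 := fun j' => (hasDerivAt_update_apply p.η j' j _).deriv
  simp only [poissonBracket, h]
  simp [partialX, partialY, partialXi]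

theorem dynamicalEquations_iff_hamiltonEquations (P : (Fin (2 * m) → ℝ) → Phase m M)
    (ha : ∀ l, 0 < a l) (hmono : StrictMono a) :
    DynamicalEquations P a ↔ HamiltonEquations hamiltonian P a := by
  have ha0 : ∀ l, (a l : ℂ) ≠ 0 := fun l => by exact_mod_cast (ha l).ne'
  have hsub : ∀ k l, k ≠ l → (a k : ℂ) - a l ≠ 0 := fun k l h =>
    sub_ne_zero.2 (by exact_mod_cast hmono.injective.ne h)
  have key : ∀ (l : Fin (2 * m)) (z w : ℂ), z = 1 / (a l : ℂ) * w ↔ (a l : ℂ) * z = w := by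
    intro l z w
    rw [eq_comm, one_div, inv_mul_eq_iff_eq_mul₀ (ha0 l), eq_comm]
  -- The equations for `y` carry the denominators `a_k - a_l`, while `H_l` is written with `a_l -
  -- a_k`.
  have hsw : ∀ (l : Fin (2 * m)) (f g : Fin (2 * m) → ℂ),
      ∑ k ∈ Finset.univ.erase l, f k * ((a k : ℂ) / ((a k : ℂ) - (a l : ℂ))) * g k
      = -∑ k ∈ Finset.univ.erase l, f k * ((a k : ℂ) / ((a l : ℂ) - (a k : ℂ))) * g k := by
    intro l f g
    rw [← Finset.sum_neg_distrib]
    refine Finset.sum_congr rfl fun k _ => ?_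
    rw [← neg_sub (a l : ℂ) (a k : ℂ), div_neg]; ring
  constructor
  · intro h
    refine ⟨h.hasPartials, fun l k j => ?_, fun l k j => ?_, fun l j => ?_, fun l j => ?_⟩
    · rw [poissonBracket_x, partialY_hamiltonian]
      by_cases hk : k = l
      · subst hk
        rw [key, if_pos rfl]
        induction j using Fin.lastCases with
        | last => rw [h.x_diag_last]; simp; ring
        | cast j => rw [h.x_diag]; simp [(Fin.castSucc_lt_last j).ne]
      · rw [if_neg hk, h.x_off l k (Ne.symm hk)]
        have h1 := hsub k l hk
        have h2 := hsub l k (Ne.symm hk)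
        have h3 := ha0 k
        rw [← neg_sub (a l : ℂ) (a k : ℂ), div_neg, neg_neg]
        field_simp
    · rw [poissonBracket_y, partialX_hamiltonian, neg_mul, ← mul_neg]
      by_cases hk : k = l
      · subst hk
        rw [key, if_pos rfl]
        induction j using Fin.cases with
        | zero => rw [h.y_diag_zero, hsw]; simp [Fin.succ_ne_zero]; ring
        | succ j => rw [h.y_diag, hsw]; simp [Fin.succ_ne_zero]; ring
      · rw [if_neg hk, h.y_off l k (Ne.symm hk)]
        have h2 := hsub l k (Ne.symm hk)
        have h3 := ha0 k
        field_simp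
    · rw [poissonBracket_xi, partialEta_hamiltonian, h.xi_eq]; ring
    · rw [poissonBracket_eta, partialXi_hamiltonian, h.eta_eq]; ring
  · intro h
    refine ⟨h.hasPartials, fun k l hkl j => ?_, fun k l hkl j => ?_, fun l j => ?_, fun l => ?_,
      fun l j => ?_, fun l => ?_, fun l j => ?_, fun l j => ?_⟩
    · rw [h.x_eq, poissonBracket_x, partialY_hamiltonian, if_neg (Ne.symm hkl)]
      have h2 := hsub k l hkl
      have h3 := ha0 l
      rw [← neg_sub (a k : ℂ) (a l : ℂ), div_neg, neg_neg]
      field_simp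
    · rw [h.y_eq, poissonBracket_y, partialX_hamiltonian, if_neg (Ne.symm hkl)]
      have h2 := hsub k l hkl
      have h3 := ha0 l
      field_simp
    · rw [← key, h.x_eq, poissonBracket_x, partialY_hamiltonian, if_pos rfl]
      simp [(Fin.castSucc_lt_last j).ne]
    · rw [← key, h.x_eq, poissonBracket_x, partialY_hamiltonian, if_pos rfl]
      simp; left; ring
    · rw [← key, h.y_eq, poissonBracket_y, partialX_hamiltonian, if_pos rfl, neg_mul, ← mul_neg,
        hsw]
      simp [Fin.succ_ne_zero]; left; ring
    · rw [← key, h.y_eq, poissonBracket_y, partialX_hamiltonian, if_pos rfl, neg_mul, ← mul_neg,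
        hsw]
      simp [Fin.succ_ne_zero]; left; ring
    · rw [h.xi_eq, poissonBracket_xi, partialEta_hamiltonian]; ring
    · rw [h.eta_eq, poissonBracket_eta, partialXi_hamiltonian]; ring

end Hamiltonian

end GenBessel

namespace GenBessel

open MeasureTheory Set Filter Asymptotics Topology

/-! ### Integrals of powers over a loop -/

section CpowIntegral

variable {α : Type*} [MeasurableSpace α] {μ : Measure α} {γ k : α → ℂ}

theorem norm_ofReal_cpow_le_exp {x r : ℝ} (hx : 0 < x) (hr : |Real.log x| ≤ r) (s : ℂ) :
    ‖(x : ℂ) ^ s‖ ≤ Real.exp (r * ‖s‖) := by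
  rw [Complex.norm_cpow_eq_rpow_re_of_pos hx, Real.rpow_def_of_pos hx]
  refine Real.exp_le_exp.2 ((le_abs_self _).trans ?_)
  rw [abs_mul]
  exact mul_le_mul hr (Complex.abs_re_le_norm s) (abs_nonneg _) ((abs_nonneg _).trans hr)

theorem aestronglyMeasurable_mul_cpow (hk : AEStronglyMeasurable k μ)
    (hγ : AEStronglyMeasurable γ μ) (x : ℝ) :
    AEStronglyMeasurable (fun τ => k τ * (x : ℂ) ^ γ τ) μ :=
  hk.mul (by
    have : AEMeasurable (fun τ => (x : ℂ) ^ γ τ) μ := aemeasurable_const.pow hγ.aemeasurable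
    exact this.aestronglyMeasurable)

theorem integrable_mul_cpow (hk : AEStronglyMeasurable k μ) (hγ : AEStronglyMeasurable γ μ)
    (hint : ∀ r : ℝ, Integrable (fun τ => Real.exp (r * ‖γ τ‖) * ‖k τ‖) μ) {x : ℝ} (hx : 0 < x) :
    Integrable (fun τ => k τ * (x : ℂ) ^ γ τ) μ := by
  refine (hint |Real.log x|).mono' (aestronglyMeasurable_mul_cpow hk hγ x) (ae_of_all _ fun τ => ?_)
  rw [norm_mul, mul_comm]
  exact mul_le_mul_of_nonneg_right (norm_ofReal_cpow_le_exp hx le_rfl _) (norm_nonneg _)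

/-- For `y` between `x / 2` and `2 x` the quantity `|log y|` is at most `r`, so `|y ^ γ|` is
dominated by `exp (r ‖γ‖)`. Differentiation brings down `γ / y`; since `‖γ‖ ≤ exp ‖γ‖`, the
integrability hypothesis at `r + 1` supplies the majorant. -/
theorem hasDerivAt_integral_cpow (hk : AEStronglyMeasurable k μ) (hγ : AEStronglyMeasurable γ μ)
    (hint : ∀ r : ℝ, Integrable (fun τ => Real.exp (r * ‖γ τ‖) * ‖k τ‖) μ) {x : ℝ} (hx : 0 < x) :
    HasDerivAt (fun y : ℝ => ∫ τ, k τ * (y : ℂ) ^ γ τ ∂μ)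
      ((∫ τ, γ τ * k τ * (x : ℂ) ^ γ τ ∂μ) / x) x := by
  have hx2 : 0 < x / 2 := by positivity
  set r := max |Real.log (x / 2)| |Real.log (2 * x)| with hr
  have hlog : ∀ y ∈ Ioo (x / 2) (2 * x), |Real.log y| ≤ r := by
    intro y hy
    have hy0 : 0 < y := hx2.trans hy.1
    refine abs_le_max_abs_abs ?_ ?_
    · exact Real.log_le_log hx2 hy.1.le
    · exact Real.log_le_log hy0 hy.2.le
  have h := hasDerivAt_integral_of_dominated_loc_of_deriv_le (μ := μ) (𝕜 := ℝ)
    (F := fun (y : ℝ) τ => k τ * (y : ℂ) ^ γ τ) (x₀ := x) (s := Ioo (x / 2) (2 * x))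
    (F' := fun (y : ℝ) τ => γ τ * k τ * (y : ℂ) ^ γ τ / y)
    (bound := fun τ => 2 / x * (Real.exp ((r + 1) * ‖γ τ‖) * ‖k τ‖))
    (Ioo_mem_nhds (by linarith) (by linarith))
    (Eventually.of_forall fun y => aestronglyMeasurable_mul_cpow hk hγ y)
    (integrable_mul_cpow hk hγ hint hx)
    (by
      simp_rw [div_eq_mul_inv]
      exact (aestronglyMeasurable_mul_cpow (hγ.mul hk) hγ x).mul_const _)
    (ae_of_all _ fun τ y hy => by
      have hy0 : 0 < y := hx2.trans hy.1
      rw [norm_div, norm_mul, norm_mul, Complex.norm_real, Real.norm_of_nonneg hy0.le,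
        add_mul, Real.exp_add, one_mul]
      have h1 : ‖γ τ‖ ≤ Real.exp ‖γ τ‖ := (by linarith : ‖γ τ‖ ≤ ‖γ τ‖ + 1).trans
        (Real.add_one_le_exp _)
      have h2 := norm_ofReal_cpow_le_exp hy0 (hlog y hy) (γ τ)
      have h3 : 1 / y ≤ 2 / x := by
        rw [div_le_div_iff₀ hy0 hx]; linarith [hy.1]
      calc ‖γ τ‖ * ‖k τ‖ * ‖(y : ℂ) ^ γ τ‖ / y
          = 1 / y * (‖γ τ‖ * ‖k τ‖ * ‖(y : ℂ) ^ γ τ‖) := by ring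
        _ ≤ 2 / x * (Real.exp ‖γ τ‖ * ‖k τ‖ * Real.exp (r * ‖γ τ‖)) := by gcongr
        _ = _ := by ring)
    ((hint (r + 1)).const_mul _)
    (ae_of_all _ fun τ y hy => by
      have hy0 : 0 < y := hx2.trans hy.1
      have hyc : (y : ℂ) ≠ 0 := by exact_mod_cast hy0.ne'
      have h1 : HasDerivAt (fun z : ℝ => (z : ℂ) ^ γ τ) (γ τ * (y : ℂ) ^ (γ τ - 1)) y := by
        have := ((hasDerivAt_id (y : ℂ)).cpow_const (c := γ τ)
          (Complex.ofReal_mem_slitPlane.2 hy0)).comp_ofReal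
        simpa using this
      have h2 := h1.const_mul (k τ)
      rw [Complex.cpow_sub _ _ hyc, Complex.cpow_one] at h2
      exact h2.congr_deriv (by ring))
  have h' := h.2
  rwa [integral_div] at h'

/-- For `x ≤ 1` the modulus `x ^ Re γ` decreases in `Re γ`. This is how a contour further to the
right gives a better bound at the origin. -/
theorem norm_integral_cpow_le (hint : Integrable k μ) {c x : ℝ} (hx : 0 < x) (hx1 : x ≤ 1)
    (hγ : ∀ᵐ τ ∂μ, c ≤ (γ τ).re) :
    ‖∫ τ, k τ * (x : ℂ) ^ γ τ ∂μ‖ ≤ (∫ τ, ‖k τ‖ ∂μ) * x ^ c := by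
  rw [← integral_mul_const]
  refine norm_integral_le_of_norm_le (hint.norm.mul_const _) ?_
  filter_upwards [hγ] with τ hτ
  rw [norm_mul, Complex.norm_cpow_eq_rpow_re_of_pos hx]
  exact mul_le_mul_of_nonneg_left (Real.rpow_le_rpow_of_exponent_ge hx hx1 hτ) (norm_nonneg _)

end CpowIntegral

/-! ### The loop integral and the class of symbols it acts on -/

section Loop

/-- The complement of the ray `[c, ∞)`. -/
def raySlit (c : ℝ) : Set ℂ := {s | s.re < c ∨ s.im ≠ 0}

theorem raySlit_mono {c c' : ℝ} (h : c ≤ c') : raySlit c ⊆ raySlit c' := fun _ hs =>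
  hs.imp (fun h' => h'.trans_le h) id

/-- Functions that are holomorphic off the ray `[c, ∞)` and decay faster than every exponential
along the horizontal lines through `±i`. -/
structure LoopClass (c : ℝ) (h : ℂ → ℂ) : Prop where
  diff : DifferentiableOn ℂ h (raySlit c)
  decay_add : ∀ R : ℝ, (fun u : ℝ => h (u + Complex.I)) =O[atTop] fun u => Real.exp (-R * u)
  decay_sub : ∀ R : ℝ, (fun u : ℝ => h (u - Complex.I)) =O[atTop] fun u => Real.exp (-R * u)

namespace LoopClass

variable {c c' : ℝ} {h h' : ℂ → ℂ}

theorem mono (hh : LoopClass c h) (hc : c' ≤ c) : LoopClass c' h :=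
  ⟨hh.diff.mono (raySlit_mono hc), hh.decay_add, hh.decay_sub⟩

theorem add (hh : LoopClass c h) (hh' : LoopClass c h') : LoopClass c (fun s => h s + h' s) :=
  ⟨hh.diff.add hh'.diff, fun R => (hh.decay_add R).add (hh'.decay_add R),
    fun R => (hh.decay_sub R).add (hh'.decay_sub R)⟩

theorem const_mul (hh : LoopClass c h) (a : ℂ) : LoopClass c (fun s => a * h s) :=
  ⟨hh.diff.const_mul a, fun R => (hh.decay_add R).const_mul_left a,
    fun R => (hh.decay_sub R).const_mul_left a⟩

theorem zero : LoopClass c (fun _ => 0) :=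
  ⟨differentiableOn_const _, fun _ => isBigO_zero _ _, fun _ => isBigO_zero _ _⟩

theorem sum {ι : Type*} {H : ι → ℂ → ℂ} (S : Finset ι) (hH : ∀ i ∈ S, LoopClass c (H i)) :
    LoopClass c (fun s => ∑ i ∈ S, H i s) := by
  classical
  induction S using Finset.induction_on with
  | empty => simpa using zero
  | insert i S hi ih =>
    simp only [Finset.sum_insert hi]
    exact (hH i (by simp)).add (ih fun j hj => hH j (by simp [hj]))

theorem mul (hh : LoopClass c h) (hh' : LoopClass c h') : LoopClass c (fun s => h s * h' s) :=
  ⟨hh.diff.mul hh'.diff,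
    fun R => by simpa using (hh.decay_add R).mul (hh'.decay_add 0),
    fun R => by simpa using (hh.decay_sub R).mul (hh'.decay_sub 0)⟩

theorem mul_prod {ι : Type*} {H : ι → ℂ → ℂ} (S : Finset ι) (hh : LoopClass c h)
    (hH : ∀ i ∈ S, LoopClass c (H i)) : LoopClass c (fun s => h s * ∏ i ∈ S, H i s) := by
  classical
  induction S using Finset.induction_on with
  | empty => simpa using hh
  | insert i S hi ih =>
    simp only [Finset.prod_insert hi]
    have := (hH i (by simp)).mul (ih fun j hj => hH j (by simp [hj]))
    convert this using 1
    funext s; ring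

/-- A linear factor costs at most one unit of the exponential rate. Since every rate is available,
the class is stable under multiplication by `s`, that is, under the Euler operator. -/
theorem isBigO_linear (z : ℂ) : (fun u : ℝ => (u : ℂ) + z) =O[atTop] fun u => Real.exp u := by
  refine IsBigO.of_bound (1 + ‖z‖) ?_
  filter_upwards [eventually_ge_atTop 0] with u hu
  rw [Real.norm_of_nonneg (Real.exp_pos u).le]
  have h1 : 1 + u ≤ Real.exp u := by linarith [Real.add_one_le_exp u]
  have h2 : ‖(u : ℂ) + z‖ ≤ u + ‖z‖ := (norm_add_le _ _).trans
    (by rw [Complex.norm_real, Real.norm_of_nonneg hu])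
  nlinarith [norm_nonneg z]

theorem id_mul (hh : LoopClass c h) : LoopClass c (fun s => s * h s) := by
  refine ⟨differentiableOn_id.mul hh.diff, fun R => ?_, fun R => ?_⟩
  · refine ((isBigO_linear Complex.I).mul (hh.decay_add (R + 1))).congr_right fun u => ?_
    rw [← Real.exp_add]; ring_nf
  · simp_rw [sub_eq_add_neg]
    refine ((isBigO_linear (-Complex.I)).mul (hh.decay_sub (R + 1))).congr_right fun u => ?_
    rw [← Real.exp_add]; ring_nf

theorem pow_mul (hh : LoopClass c h) (n : ℕ) : LoopClass c (fun s => s ^ n * h s) := by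
  induction n with
  | zero => simpa using hh
  | succ n ih =>
    convert ih.id_mul using 1
    funext s; ring

/-- On a horizontal ray the functions of the class may be multiplied by exponentials. -/
theorem integrableOn_ray (hh : LoopClass c h) (b r : ℝ) {z : ℂ}
    (hz : z = Complex.I ∨ z = -Complex.I) :
    IntegrableOn (fun u : ℝ => Real.exp (r * ‖(u : ℂ) + z‖) * ‖h (u + z)‖) (Ioi b) := by
  have hz1 : ‖z‖ = 1 := by rcases hz with rfl | rfl <;> simp
  have hdec : ∀ R : ℝ, (fun u : ℝ => h (u + z)) =O[atTop] fun u => Real.exp (-R * u) := by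
    rcases hz with rfl | rfl
    · exact hh.decay_add
    · simpa [sub_eq_add_neg] using hh.decay_sub
  have hcont : Continuous fun u : ℝ => h (u + z) := by
    refine hh.diff.continuousOn.comp_continuous (by fun_prop) fun u => Or.inr ?_
    rcases hz with rfl | rfl <;> simp
  have hlin : Continuous fun u : ℝ => (u : ℂ) + z := by fun_prop
  refine integrable_of_isBigO_exp_neg one_pos
    ((Real.continuous_exp.comp (continuous_const.mul hlin.norm)).mul hcont.norm).continuousOn ?_
  have h1 : (fun u : ℝ => Real.exp (r * ‖(u : ℂ) + z‖)) =O[atTop] fun u => Real.exp (|r| * u) := by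
    refine IsBigO.of_bound (Real.exp |r|) ?_
    filter_upwards [eventually_ge_atTop 0] with u hu
    rw [Real.norm_of_nonneg (Real.exp_pos _).le, Real.norm_of_nonneg (Real.exp_pos _).le,
      ← Real.exp_add]
    refine Real.exp_le_exp.2 ?_
    have h2 : ‖(u : ℂ) + z‖ ≤ u + 1 := (norm_add_le _ _).trans
      (by rw [Complex.norm_real, Real.norm_of_nonneg hu, hz1])
    calc r * ‖(u : ℂ) + z‖ ≤ |r| * ‖(u : ℂ) + z‖ := by gcongr; exact le_abs_self r
      _ ≤ |r| * (u + 1) := by gcongr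
      _ = _ := by ring
  refine (h1.mul (hdec (|r| + 1)).norm_left).congr_right fun u => ?_
  rw [← Real.exp_add]; ring_nf

theorem continuous_ray (hh : LoopClass c h) {z : ℂ} (hz : z = Complex.I ∨ z = -Complex.I) :
    Continuous fun u : ℝ => h (u + z) := by
  refine hh.diff.continuousOn.comp_continuous (by fun_prop) fun u => Or.inr ?_
  rcases hz with rfl | rfl <;> simp

theorem continuous_vertical (hh : LoopClass c h) {b : ℝ} (hb : b < c) :
    Continuous fun v : ℝ => h ((b : ℂ) + v * Complex.I) :=
  hh.diff.continuousOn.comp_continuous (by fun_prop) fun v => Or.inl (by simpa using hb)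

theorem integrableOn_vertical (hh : LoopClass c h) {b : ℝ} (hb : b < c) (r : ℝ) :
    IntegrableOn (fun v : ℝ => Real.exp (r * ‖(b : ℂ) + v * Complex.I‖) *
      ‖h ((b : ℂ) + v * Complex.I)‖) (Ioc (-1) 1) := by
  have hlin : Continuous fun v : ℝ => (b : ℂ) + v * Complex.I := by fun_prop
  exact ((Real.continuous_exp.comp (continuous_const.mul hlin.norm)).mul
    (hh.continuous_vertical hb).norm).integrableOn_Icc.mono_set Ioc_subset_Icc_self

end LoopClass

/-- The integral of `h(s) x^s` over the loop that comes from `+∞ - i` to `c - i`, goes up to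
`c + i` and returns to `+∞ + i`. -/
noncomputable def loop (c : ℝ) (h : ℂ → ℂ) (x : ℝ) : ℂ :=
  -(∫ u in Ioi c, h ((u : ℂ) - Complex.I) * (x : ℂ) ^ ((u : ℂ) - Complex.I))
    + Complex.I * (∫ v in (-1 : ℝ)..1, h ((c : ℂ) + v * Complex.I) *
        (x : ℂ) ^ ((c : ℂ) + v * Complex.I))
    + ∫ u in Ioi c, h ((u : ℂ) + Complex.I) * (x : ℂ) ^ ((u : ℂ) + Complex.I)

namespace LoopClass

variable {c b x : ℝ} {h h' : ℂ → ℂ}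

theorem integrableOn_ray_cpow (hh : LoopClass c h) (b : ℝ) (hx : 0 < x) {z : ℂ}
    (hz : z = Complex.I ∨ z = -Complex.I) :
    IntegrableOn (fun u : ℝ => h (u + z) * (x : ℂ) ^ ((u : ℂ) + z)) (Ioi b) :=
  integrable_mul_cpow (hh.continuous_ray hz).aestronglyMeasurable
    (by fun_prop) (fun r => hh.integrableOn_ray b r hz) hx

theorem intervalIntegrable_vertical_cpow (hh : LoopClass c h) (hb : b < c) (hx : 0 < x) :
    IntervalIntegrable (fun v : ℝ => h ((b : ℂ) + v * Complex.I) *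
      (x : ℂ) ^ ((b : ℂ) + v * Complex.I)) volume (-1) 1 := by
  rw [intervalIntegrable_iff_integrableOn_Ioc_of_le (by norm_num)]
  exact integrable_mul_cpow (hh.continuous_vertical hb).aestronglyMeasurable
    (by fun_prop) (fun r => hh.integrableOn_vertical hb r) hx

/-- In terms of the symbol, `x d/dx` is multiplication by `s`: the basic rule of the Mellin calculus
used for `φ_j` and `ψ_j`. -/
theorem hasDerivAt_loop (hh : LoopClass c h) (hb : b < c) (hx : 0 < x) :
    HasDerivAt (loop b h) (loop b (fun s => s * h s) x / x) x := by
  have h1 := hasDerivAt_integral_cpow (μ := volume.restrict (Ioi b))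
    (hh.continuous_ray (Or.inr rfl)).aestronglyMeasurable (by fun_prop)
    (fun r => hh.integrableOn_ray b r (Or.inr rfl)) hx
  have h2 := hasDerivAt_integral_cpow (μ := volume.restrict (Ioi b))
    (hh.continuous_ray (Or.inl rfl)).aestronglyMeasurable (by fun_prop)
    (fun r => hh.integrableOn_ray b r (Or.inl rfl)) hx
  have h3 := hasDerivAt_integral_cpow (μ := volume.restrict (Ioc (-1 : ℝ) 1))
    (hh.continuous_vertical hb).aestronglyMeasurable (by fun_prop)
    (fun r => hh.integrableOn_vertical hb r) hx
  have h4 := (h1.neg.add (h3.const_mul Complex.I)).add h2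
  have hle : (-1 : ℝ) ≤ 1 := by norm_num
  refine (h4.congr_deriv ?_).congr_of_eventuallyEq (Eventually.of_forall fun y => ?_)
  · simp only [loop, intervalIntegral.integral_of_le hle, sub_eq_add_neg]; ring
  · simp only [loop, intervalIntegral.integral_of_le hle, sub_eq_add_neg, Pi.add_apply,
      Pi.neg_apply]

theorem loop_add (hh : LoopClass c h) (hh' : LoopClass c h') (hb : b < c) (hx : 0 < x) :
    loop b (fun s => h s + h' s) x = loop b h x + loop b h' x := by
  have h1 := integral_add (hh.integrableOn_ray_cpow b hx (Or.inl rfl))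
    (hh'.integrableOn_ray_cpow b hx (Or.inl rfl))
  have h2 := integral_add (hh.integrableOn_ray_cpow b hx (Or.inr rfl))
    (hh'.integrableOn_ray_cpow b hx (Or.inr rfl))
  have h3 := intervalIntegral.integral_add (hh.intervalIntegrable_vertical_cpow hb hx)
    (hh'.intervalIntegrable_vertical_cpow hb hx)
  simp only [loop, add_mul, sub_eq_add_neg, h1, h2, h3]
  ring

theorem _root_.GenBessel.loop_const_mul (a : ℂ) (b : ℝ) (h : ℂ → ℂ) (x : ℝ) :
    loop b (fun s => a * h s) x = a * loop b h x := by
  simp only [loop, mul_assoc, integral_const_mul, intervalIntegral.integral_const_mul]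
  ring

theorem loop_sum {ι : Type*} {H : ι → ℂ → ℂ} (S : Finset ι) (hH : ∀ i ∈ S, LoopClass c (H i))
    (hb : b < c) (hx : 0 < x) :
    loop b (fun s => ∑ i ∈ S, H i s) x = ∑ i ∈ S, loop b (H i) x := by
  classical
  induction S using Finset.induction_on with
  | empty => simp [loop]
  | insert i S hi ih =>
    simp only [Finset.sum_insert hi]
    rw [(hH i (by simp)).loop_add (LoopClass.sum S fun j hj => hH j (by simp [hj])) hb hx,
      ih fun j hj => hH j (by simp [hj])]

theorem _root_.GenBessel.loop_congr (hb : b < c) (heq : EqOn h h' (raySlit c)) (x : ℝ) :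
    loop b h x = loop b h' x := by
  have h1 : ∀ u : ℝ, h (u - Complex.I) = h' (u - Complex.I) := fun u =>
    heq (Or.inr (by simp))
  have h2 : ∀ u : ℝ, h (u + Complex.I) = h' (u + Complex.I) := fun u =>
    heq (Or.inr (by simp))
  have h3 : ∀ v : ℝ, h ((b : ℂ) + v * Complex.I) = h' ((b : ℂ) + v * Complex.I) := fun v =>
    heq (Or.inl (by simpa using hb))
  simp only [loop, h1, h2, h3]

/-- The loop may be moved horizontally inside the domain of holomorphy. -/
theorem loop_eq (hh : LoopClass c h) {b' : ℝ} (hb : b < c) (hb' : b' < c) (hx : 0 < x) :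
    loop b h x = loop b' h x := by
  wlog hle : b ≤ b' generalizing b b'
  · exact (this hb' hb (le_of_not_ge hle)).symm
  -- Cauchy's theorem on the rectangle between the two vertical sides. Its horizontal sides are
  -- exactly the pieces by which the rays of the two loops differ.
  have hrect := Complex.integral_boundary_rect_eq_zero_of_differentiableOn
    (fun s => h s * (x : ℂ) ^ s) ((b : ℂ) - Complex.I) ((b' : ℂ) + Complex.I) (by
      refine DifferentiableOn.mul (hh.diff.mono ?_) ?_
      · intro s hs
        left
        have := hs.1
        simp only [Complex.sub_re, Complex.ofReal_re, Complex.I_re, sub_zero, Complex.add_re,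
          add_zero, mem_preimage] at this
        rw [uIcc_of_le hle] at this
        exact this.2.trans_lt hb'
      · exact fun s _ => (DifferentiableAt.const_cpow differentiableAt_id
          (Or.inl (by exact_mod_cast hx.ne'))).differentiableWithinAt)
  have h1 := intervalIntegral.integral_interval_add_Ioi
    (hh.integrableOn_ray_cpow b hx (Or.inl rfl)) (hh.integrableOn_ray_cpow b' hx (Or.inl rfl))
  have h2 := intervalIntegral.integral_interval_add_Ioi
    (hh.integrableOn_ray_cpow b hx (Or.inr rfl)) (hh.integrableOn_ray_cpow b' hx (Or.inr rfl))
  simp only [Complex.sub_re, Complex.ofReal_re, Complex.I_re, sub_zero, Complex.add_re, add_zero,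
    Complex.sub_im, Complex.ofReal_im, Complex.I_im, zero_sub, Complex.add_im, zero_add,
    Complex.ofReal_neg, Complex.ofReal_one, neg_mul, one_mul, smul_eq_mul] at hrect
  simp only [loop, sub_eq_add_neg]
  rw [← h1, ← h2]
  linear_combination -hrect

/-- Substitute `s ↦ s + 1` and use `x ^ s = x * x ^ (s - 1)`. A recurrence of the symbol thereby
becomes a differential equation with coefficient `x`; the price is a loop displaced by one, to be
moved back with `loop_eq`. -/
theorem _root_.GenBessel.loop_comp_sub_one (b : ℝ) (h : ℂ → ℂ) (hx : 0 < x) :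
    loop b (fun s => h (s - 1)) x = x * loop (b - 1) h x := by
  have hxc : (x : ℂ) ≠ 0 := by exact_mod_cast hx.ne'
  have hpow : ∀ s : ℂ, (x : ℂ) ^ s = x * (x : ℂ) ^ (s - 1) := fun s => by
    rw [Complex.cpow_sub _ _ hxc, Complex.cpow_one]; field_simp
  have hray : ∀ z : ℂ, ∫ u in Ioi b, h ((u : ℂ) + z - 1) * (x : ℂ) ^ ((u : ℂ) + z)
      = x * ∫ u in Ioi (b - 1), h ((u : ℂ) + z) * (x : ℂ) ^ ((u : ℂ) + z) := by
    intro z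
    have h0 := (measurePreserving_sub_right volume (1 : ℝ)).setIntegral_preimage_emb
      (measurableEmbedding_subRight (1 : ℝ))
      (fun u : ℝ => h ((u : ℂ) + z) * (x : ℂ) ^ ((u : ℂ) + z)) (Ioi (b - 1))
    have hpre : (fun u : ℝ => u - 1) ⁻¹' Ioi (b - 1) = Ioi b := by
      ext u; simp
    rw [hpre] at h0
    rw [← h0, ← integral_const_mul]
    refine integral_congr_ae (ae_of_all _ fun u => ?_)
    have : ((u - 1 : ℝ) : ℂ) + z = u + z - 1 := by push_cast; ring
    simp only [this]
    rw [hpow (u + z)]; ring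
  have h1 := hray Complex.I
  have h2 := hray (-Complex.I)
  have h3 : ∫ v in (-1 : ℝ)..1, h ((b : ℂ) + v * Complex.I - 1) *
        (x : ℂ) ^ ((b : ℂ) + v * Complex.I)
      = x * ∫ v in (-1 : ℝ)..1, h (((b - 1 : ℝ) : ℂ) + v * Complex.I) *
        (x : ℂ) ^ (((b - 1 : ℝ) : ℂ) + v * Complex.I) := by
    rw [← intervalIntegral.integral_const_mul]
    refine intervalIntegral.integral_congr fun v _ => ?_
    have : ((b - 1 : ℝ) : ℂ) + v * Complex.I = b + v * Complex.I - 1 := by push_cast; ring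
    simp only [this]
    rw [hpow (b + v * Complex.I)]; ring
  simp only [loop]
  simp only [sub_eq_add_neg _ Complex.I]
  rw [h1, h2, h3]
  ring

/-- On the whole loop `Re s ≥ b`. The attainable exponent at the origin is therefore limited only by
the first singularity of the symbol. -/
theorem norm_loop_le (hh : LoopClass c h) (hb : b < c) :
    ∃ C, ∀ x : ℝ, 0 < x → x ≤ 1 → ‖loop b h x‖ ≤ C * x ^ b := by
  have hi1 : IntegrableOn (fun u : ℝ => h (u + -Complex.I)) (Ioi b) := by
    have := hh.integrableOn_ray b 0 (Or.inr rfl)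
    simp only [zero_mul, Real.exp_zero, one_mul] at this
    exact (integrable_norm_iff (hh.continuous_ray (Or.inr rfl)).aestronglyMeasurable).1 this
  have hi2 : IntegrableOn (fun u : ℝ => h (u + Complex.I)) (Ioi b) := by
    have := hh.integrableOn_ray b 0 (Or.inl rfl)
    simp only [zero_mul, Real.exp_zero, one_mul] at this
    exact (integrable_norm_iff (hh.continuous_ray (Or.inl rfl)).aestronglyMeasurable).1 this
  have hi3 : IntegrableOn (fun v : ℝ => h ((b : ℂ) + v * Complex.I)) (Ioc (-1) 1) := by
    have := hh.continuous_vertical hb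
    exact (Continuous.integrableOn_Icc this).mono_set Ioc_subset_Icc_self
  have hae : ∀ z : ℂ, z.re = 0 → ∀ᵐ u : ℝ ∂volume.restrict (Ioi b), b ≤ ((u : ℂ) + z).re := by
    intro z hz
    filter_upwards [ae_restrict_mem measurableSet_Ioi] with u hu
    simpa [hz] using (le_of_lt hu)
  refine ⟨(∫ u in Ioi b, ‖h ((u : ℂ) + -Complex.I)‖) +
    (∫ v in Ioc (-1 : ℝ) 1, ‖h ((b : ℂ) + v * Complex.I)‖) +
    ∫ u in Ioi b, ‖h ((u : ℂ) + Complex.I)‖, fun x hx hx1 => ?_⟩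
  have h1 := norm_integral_cpow_le hi1 hx hx1 (hae (-Complex.I) (by simp))
  have h2 := norm_integral_cpow_le hi2 hx hx1 (hae Complex.I (by simp))
  have h3 := norm_integral_cpow_le hi3 hx hx1
    (γ := fun v : ℝ => (b : ℂ) + v * Complex.I) (c := b) (ae_of_all _ fun v => by simp)
  have hle : (-1 : ℝ) ≤ 1 := by norm_num
  simp only [loop, intervalIntegral.integral_of_le hle, sub_eq_add_neg]
  refine norm_add₃_le.trans ?_
  rw [norm_neg, norm_mul, Complex.norm_I, one_mul, add_mul, add_mul]
  exact add_le_add (add_le_add h1 h3) h2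

end LoopClass

end Loop

end GenBessel

namespace GenBessel

open MeasureTheory Set Filter Asymptotics Topology

/-! ### Decay of the Gamma function along horizontal lines -/

section GammaDecay

/-- An elementary replacement of Stirling's formula. A unit step divides `|G|` by `|u + β|`, which
is at least `exp R` for `u ≥ A`; so `exp (R u) |G u|` does not grow under unit steps and is bounded
by its maximum over `[A, A + 1]`. -/
theorem isBigO_exp_of_step {G : ℝ → ℂ} (hG : Continuous G) (β : ℂ)
    (hstep : ∀ u : ℝ, ‖G (u + 1)‖ * ‖(u : ℂ) + β‖ = ‖G u‖) (R : ℝ) :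
    G =O[atTop] fun u => Real.exp (-R * u) := by
  set A := Real.exp R + ‖β‖ with hA
  obtain ⟨C, hC⟩ := (isCompact_Icc (a := A) (b := A + 1)).exists_bound_of_continuousOn
    (f := fun u : ℝ => Real.exp (R * u) * ‖G u‖) (by fun_prop)
  have hdec : ∀ u, A ≤ u → Real.exp (R * (u + 1)) * ‖G (u + 1)‖ ≤ Real.exp (R * u) * ‖G u‖ := by
    intro u hu
    have h1 : Real.exp R ≤ ‖(u : ℂ) + β‖ := by
      have h2 : ‖(u : ℂ)‖ ≤ ‖(u : ℂ) + β‖ + ‖β‖ := by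
        simpa using norm_sub_le ((u : ℂ) + β) β
      rw [Complex.norm_real] at h2
      have := le_abs_self u
      rw [Real.norm_eq_abs] at h2
      linarith
    rw [← hstep u, mul_add, Real.exp_add, mul_one, mul_assoc]
    refine mul_le_mul_of_nonneg_left ?_ (Real.exp_pos _).le
    rw [mul_comm]
    exact mul_le_mul_of_nonneg_left h1 (norm_nonneg _)
  have hind : ∀ (n : ℕ) (u : ℝ), u ∈ Icc A (A + 1) →
      Real.exp (R * (u + n)) * ‖G (u + n)‖ ≤ C := by
    intro n u hu
    induction n with
    | zero => simpa using (le_abs_self _).trans (hC u hu)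
    | succ n ih =>
      have := hdec (u + n) (by have := hu.1; have : (0 : ℝ) ≤ n := n.cast_nonneg; linarith)
      rw [Nat.cast_succ, ← add_assoc]
      exact this.trans ih
  refine IsBigO.of_bound C ?_
  filter_upwards [eventually_ge_atTop A] with u hu
  have h0 : 0 ≤ u - A := sub_nonneg.2 hu
  have h1 := Nat.floor_le h0
  have h2 := Nat.lt_floor_add_one (u - A)
  have h3 := hind ⌊u - A⌋₊ (u - ⌊u - A⌋₊) ⟨by linarith, by linarith⟩
  rw [sub_add_cancel] at h3
  rw [Real.norm_of_nonneg (Real.exp_pos _).le, neg_mul, Real.exp_neg, ← div_eq_mul_inv,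
    le_div_iff₀ (Real.exp_pos _), mul_comm]
  exact h3

/-- The functional equation gives `Γ(β - u) = (β - u - 1) Γ(β - u - 1)`, and the nonzero imaginary
part keeps the line away from the poles. -/
theorem isBigO_Gamma_sub {β : ℂ} (hβ : β.im ≠ 0) (R : ℝ) :
    (fun u : ℝ => Complex.Gamma (β - u)) =O[atTop] fun u => Real.exp (-R * u) := by
  have him : ∀ u : ℝ, (β - u).im ≠ 0 := fun u => by simpa using hβ
  refine isBigO_exp_of_step ?_ (1 - β) (fun u => ?_) R
  · refine continuous_iff_continuousAt.2 fun u => ?_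
    refine ContinuousAt.comp (f := fun u : ℝ => β - (u : ℂ))
      (Complex.differentiableAt_Gamma _ fun m h => him u ?_).continuousAt (by fun_prop)
    rw [h]; simp
  · have h1 : β - u - 1 ≠ 0 := fun h => him u (by rw [sub_eq_zero.1 h]; simp)
    have h2 := Complex.Gamma_add_one _ h1
    rw [sub_add_cancel] at h2
    rw [h2, norm_mul, mul_comm, ← norm_neg]
    push_cast
    ring_nf

theorem isBigO_Gamma_add_inv {β : ℂ} (hβ : β.im ≠ 0) (R : ℝ) :
    (fun u : ℝ => (Complex.Gamma (β + u))⁻¹) =O[atTop] fun u => Real.exp (-R * u) := by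
  refine isBigO_exp_of_step ?_ β (fun u => ?_) R
  · exact Complex.differentiable_one_div_Gamma.continuous.comp (by fun_prop)
  · have h1 : β + u ≠ 0 := fun h => hβ (by simpa using congrArg Complex.im h)
    have h2 := Complex.Gamma_add_one _ h1
    push_cast
    rw [← add_assoc, h2, norm_inv, norm_mul, norm_inv, mul_inv, add_comm (u : ℂ),
      mul_comm (‖β + u‖⁻¹), mul_assoc, inv_mul_cancel₀ (norm_ne_zero_iff.2 h1), mul_one]

theorem loopClass_Gamma_sub (b : ℝ) : LoopClass b (fun s => Complex.Gamma (b - s)) := by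
  refine ⟨fun s hs => ?_, fun R => ?_, fun R => ?_⟩
  · refine DifferentiableAt.differentiableWithinAt ?_
    refine DifferentiableAt.comp (f := fun s : ℂ => (b : ℂ) - s) s
      (Complex.differentiableAt_Gamma _ fun m h => ?_) (by fun_prop)
    have h1 : s = b + m := by linear_combination -h
    rcases hs with hs | hs
    · rw [h1] at hs
      simp only [Complex.add_re, Complex.ofReal_re, Complex.natCast_re] at hs
      have : (0 : ℝ) ≤ m := m.cast_nonneg
      linarith
    · exact hs (by rw [h1]; simp)
  · refine (isBigO_Gamma_sub (β := b - Complex.I) (by simp) R).congr_left fun u => ?_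
    ring_nf
  · refine (isBigO_Gamma_sub (β := b + Complex.I) (by simp) R).congr_left fun u => ?_
    ring_nf

theorem loopClass_Gamma_add_inv (b c : ℝ) :
    LoopClass c (fun s => (Complex.Gamma (b + s))⁻¹) := by
  refine ⟨?_, fun R => ?_, fun R => ?_⟩
  · exact (Complex.differentiable_one_div_Gamma.comp
      (f := fun s : ℂ => (b : ℂ) + s) (by fun_prop)).differentiableOn
  · refine (isBigO_Gamma_add_inv (β := b + Complex.I) (by simp) R).congr_left fun u => ?_
    ring_nf
  · refine (isBigO_Gamma_add_inv (β := b - Complex.I) (by simp) R).congr_left fun u => ?_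
    ring_nf

end GammaDecay

/-! ### The functions `φ_j` and `ψ_j` -/

section PhiPsi

variable {M : ℕ} (ν : Fin M → ℕ)

theorem euler_iterate_loop {F : ℝ → ℂ} {κ : ℂ} {b c : ℝ} {h : ℂ → ℂ} (hh : LoopClass c h)
    (hb : b < c) (hF : ∀ x, 0 < x → F x = κ * loop b h x) (n : ℕ) :
    ∀ x, 0 < x → euler^[n] F x = κ * loop b (fun s => s ^ n * h s) x := by
  induction n with
  | zero => simpa using hF
  | succ n ih =>
    intro x hx
    have h1 := ((hh.pow_mul n).hasDerivAt_loop hb hx).const_mul κ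
    have h2 := h1.congr_of_eventuallyEq
      (f₁ := euler^[n] F) (by
        filter_upwards [Ioi_mem_nhds hx] with y hy using ih y hy)
    have hxc : (x : ℂ) ≠ 0 := by exact_mod_cast hx.ne'
    rw [Function.iterate_succ_apply', euler, h2.deriv]
    simp only [pow_succ', mul_assoc]
    field_simp

/-- The symbol of `f`. -/
noncomputable def symbolF (s : ℂ) : ℂ :=
  Complex.Gamma (-s) * ∏ j, (Complex.Gamma (1 + ν j + s))⁻¹

/-- The symbol of `g`. -/
noncomputable def symbolG (s : ℂ) : ℂ :=
  (Complex.Gamma (1 + s))⁻¹ * ∏ j, Complex.Gamma (ν j - s)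

/-- The symbol of `φ_j`. -/
noncomputable def symbolPhi (j : Fin (M + 1)) (s : ℂ) : ℂ :=
  (-1) ^ (M - j.val + 1) * (s ^ j.val * symbolF ν s)

/-- The symbol of `ψ_j`. -/
noncomputable def symbolPsi (j : Fin (M + 1)) (s : ℂ) : ℂ :=
  ∑ i ∈ Finset.range (M - j.val + 1), alphaCoeff ν (i + j.val) * (s ^ i * symbolG ν s)

theorem loopClass_prod_Gamma_add_inv {c : ℝ} {h : ℂ → ℂ} (hh : LoopClass c h) :
    LoopClass c (fun s => h s * ∏ j, (Complex.Gamma (1 + ν j + s))⁻¹) := by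
  refine hh.mul_prod _ fun j _ => ?_
  simpa using loopClass_Gamma_add_inv (1 + ν j) c

theorem loopClass_symbolF : LoopClass 0 (symbolF ν) := by
  refine loopClass_prod_Gamma_add_inv ν ?_
  simpa using loopClass_Gamma_sub 0

theorem loopClass_symbolG : LoopClass 0 (symbolG ν) := by
  refine LoopClass.mul_prod _ (by simpa using loopClass_Gamma_add_inv 1 0) fun j _ => ?_
  have h := loopClass_Gamma_sub (ν j)
  simp only [Complex.ofReal_natCast] at h
  exact h.mono (Nat.cast_nonneg _)

theorem loopClass_symbolPhi (j : Fin (M + 1)) : LoopClass 0 (symbolPhi ν j) :=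
  ((loopClass_symbolF ν).pow_mul _).const_mul _

theorem loopClass_symbolPsi (j : Fin (M + 1)) : LoopClass 0 (symbolPsi ν j) :=
  LoopClass.sum _ fun _ _ => ((loopClass_symbolG ν).pow_mul _).const_mul _

theorem meijerIntegrand_f (x s : ℂ) :
    meijerIntegrand 1 (fun j : Fin (M + 1) => -nuFull ν j) x s = symbolF ν s * x ^ s := by
  have h1 : (∏ j : Fin (M + 1) with j.val < 1, Complex.Gamma (-nuFull ν j - s))
      = Complex.Gamma (-s) := by
    rw [Finset.prod_filter, Fin.prod_univ_succ]
    simp [nuFull]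
  have h2 : (∏ j : Fin (M + 1) with 1 ≤ j.val, Complex.Gamma (1 - -nuFull ν j + s))
      = ∏ j, Complex.Gamma (1 + ν j + s) := by
    rw [Finset.prod_filter, Fin.prod_univ_succ]
    simp [nuFull]
  rw [meijerIntegrand, h1, h2, symbolF, Finset.prod_inv_distrib, div_eq_mul_inv]

theorem meijerIntegrand_g (x s : ℂ) :
    meijerIntegrand M (Fin.snoc (α := fun _ => ℂ) (fun i : Fin M => (ν i : ℂ)) 0) x s
      = symbolG ν s * x ^ s := by
  have h1 : (∏ j : Fin (M + 1) with j.val < M,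
      Complex.Gamma (Fin.snoc (α := fun _ => ℂ) (fun i : Fin M => (ν i : ℂ)) 0 j - s))
      = ∏ j, Complex.Gamma (ν j - s) := by
    rw [Finset.prod_filter, Fin.prod_univ_castSucc]
    simp
  have h2 : (∏ j : Fin (M + 1) with M ≤ j.val,
      Complex.Gamma (1 - Fin.snoc (α := fun _ => ℂ) (fun i : Fin M => (ν i : ℂ)) 0 j + s))
      = Complex.Gamma (1 + s) := by
    rw [Finset.prod_filter, Fin.prod_univ_castSucc, Finset.prod_eq_one fun j _ => by simp]
    simp
  rw [meijerIntegrand, h1, h2, symbolG, div_eq_mul_inv, mul_comm (∏ j, Complex.Gamma (ν j - s))]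

/-- The normalization of the Mellin-Barnes integral. -/
noncomputable def loopConst : ℂ := (2 * Real.pi * Complex.I)⁻¹

theorem fFun_eq (x : ℝ) : fFun ν x = loopConst * loop (-1 / 2) (symbolF ν) x := by
  simp only [fFun, meijerG, meijerIntegrand_f, loop, loopConst]

theorem gFun_eq (x : ℝ) : gFun ν x = loopConst * loop (-1 / 2) (symbolG ν) x := by
  simp only [gFun, meijerG, meijerIntegrand_g, loop, loopConst]

theorem phi_eq (j : Fin (M + 1)) {x : ℝ} (hx : 0 < x) :
    phi ν j x = loopConst * loop (-1 / 2) (symbolPhi ν j) x := by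
  rw [phi, euler_iterate_loop (loopClass_symbolF ν) (by norm_num) (fun x _ => fFun_eq ν x) _ x hx]
  unfold symbolPhi
  rw [loop_const_mul]; ring

theorem psi_eq (j : Fin (M + 1)) {x : ℝ} (hx : 0 < x) :
    psi ν j x = loopConst * loop (-1 / 2) (symbolPsi ν j) x := by
  unfold psi symbolPsi
  rw [LoopClass.loop_sum (c := 0) _
    (fun _ _ => ((loopClass_symbolG ν).pow_mul _).const_mul _) (by norm_num) hx, Finset.mul_sum]
  refine Finset.sum_congr rfl fun i _ => ?_
  rw [euler_iterate_loop (loopClass_symbolG ν) (by norm_num) (fun x _ => gFun_eq ν x) _ x hx,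
    loop_const_mul]
  ring

theorem hasDerivAt_phi_loop (j : Fin (M + 1)) {x : ℝ} (hx : 0 < x) :
    HasDerivAt (phi ν j) (loopConst * loop (-1 / 2) (fun s => s * symbolPhi ν j s) x / x) x := by
  have h := ((loopClass_symbolPhi ν j).hasDerivAt_loop (b := -1 / 2) (by norm_num) hx).const_mul
    loopConst
  rw [mul_div_assoc]
  refine h.congr_of_eventuallyEq ?_
  filter_upwards [Ioi_mem_nhds hx] with y hy using phi_eq ν j hy

theorem hasDerivAt_psi_loop (j : Fin (M + 1)) {x : ℝ} (hx : 0 < x) :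
    HasDerivAt (psi ν j) (loopConst * loop (-1 / 2) (fun s => s * symbolPsi ν j s) x / x) x := by
  have h := ((loopClass_symbolPsi ν j).hasDerivAt_loop (b := -1 / 2) (by norm_num) hx).const_mul
    loopConst
  rw [mul_div_assoc]
  refine h.congr_of_eventuallyEq ?_
  filter_upwards [Ioi_mem_nhds hx] with y hy using psi_eq ν j hy

theorem natDegree_prod_X_sub_nu :
    (∏ l : Fin M, (Polynomial.X - Polynomial.C (ν l : ℂ))).natDegree = M := by
  simpa using Polynomial.natDegree_finsetProd_X_sub_C_eq_card Finset.univ fun l => (ν l : ℂ)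

theorem alphaCoeff_self : alphaCoeff ν M = 1 := by
  have h : (∏ l : Fin M, (Polynomial.X - Polynomial.C (ν l : ℂ))).Monic :=
    Polynomial.monic_prod_of_monic _ _ fun l _ => Polynomial.monic_X_sub_C _
  have h' := h.coeff_natDegree
  rwa [natDegree_prod_X_sub_nu] at h'

theorem sum_alphaCoeff_mul_pow (z : ℂ) :
    ∑ i ∈ Finset.range (M + 1), alphaCoeff ν i * z ^ i = ∏ l, (z - ν l) := by
  have h := Polynomial.eval_eq_sum_range (p := ∏ l : Fin M,
    (Polynomial.X - Polynomial.C (ν l : ℂ))) z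
  rw [natDegree_prod_X_sub_nu, Polynomial.eval_prod] at h
  simpa [alphaCoeff] using h.symm

theorem ne_zero_of_mem_raySlit {s : ℂ} (hs : s ∈ raySlit 0) (n : ℕ) : (n : ℂ) - s ≠ 0 := by
  intro h
  rw [← sub_eq_zero.1 h] at hs
  rcases hs with hs | hs
  · simp only [Complex.natCast_re] at hs
    exact absurd hs (not_lt.2 n.cast_nonneg)
  · exact hs (by simp)

/-- The functional equation of `Γ`, applied to each factor. With `θ = x d/dx` it is the Mellin form
of `θ ∏ (θ + ν_j) f = -x f`. -/
theorem neg_mul_prod_mul_symbolF {s : ℂ} (hs : s ∈ raySlit 0) :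
    -s * (∏ j, (s + ν j)) * symbolF ν s = symbolF ν (s - 1) := by
  have hs0 : -s ≠ 0 := by simpa using ne_zero_of_mem_raySlit hs 0
  have h1 := Complex.Gamma_add_one _ hs0
  have h2 : ∏ j, (Complex.Gamma (1 + ν j + (s - 1)))⁻¹
      = (∏ j, (s + ν j)) * ∏ j, (Complex.Gamma (1 + ν j + s))⁻¹ := by
    rw [← Finset.prod_mul_distrib]
    refine Finset.prod_congr rfl fun j _ => ?_
    rw [show (1 : ℂ) + ν j + (s - 1) = s + ν j by ring,
      Complex.one_div_Gamma_eq_self_mul_one_div_Gamma_add_one,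
      show s + ν j + 1 = 1 + ν j + s by ring]
  rw [symbolF, symbolF, h2, show -(s - 1) = -s + 1 by ring, h1]
  ring

/-- The Mellin form of `θ ∏ (θ - ν_j) g = (-1)^M y g`, where `θ = y d/dy`. Off the ray no factor
`ν_j - s` vanishes, which the functional equation requires. -/
theorem mul_prod_mul_symbolG {s : ℂ} (hs : s ∈ raySlit 0) :
    s * (∏ j, (s - ν j)) * symbolG ν s = (-1) ^ M * symbolG ν (s - 1) := by
  have h1 : (Complex.Gamma (1 + (s - 1)))⁻¹ = s * (Complex.Gamma (1 + s))⁻¹ := by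
    rw [add_sub_cancel, Complex.one_div_Gamma_eq_self_mul_one_div_Gamma_add_one, add_comm s 1]
  have h2 : (∏ j, (s - ν j)) * ∏ j, Complex.Gamma (ν j - s)
      = (-1) ^ M * ∏ j, Complex.Gamma (ν j - (s - 1)) := by
    rw [show ((-1 : ℂ)) ^ M = ∏ _j : Fin M, (-1 : ℂ) by simp, ← Finset.prod_mul_distrib,
      ← Finset.prod_mul_distrib]
    refine Finset.prod_congr rfl fun j _ => ?_
    rw [show (ν j : ℂ) - (s - 1) = ν j - s + 1 by ring,
      Complex.Gamma_add_one _ (ne_zero_of_mem_raySlit hs _)]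
    ring
  rw [symbolG, symbolG, h1]
  linear_combination s * (Complex.Gamma (1 + s))⁻¹ * h2

theorem symbolPsi_last (s : ℂ) : symbolPsi ν (Fin.last M) s = symbolG ν s := by
  simp [symbolPsi, alphaCoeff_self]

theorem symbolPsi_zero (s : ℂ) : symbolPsi ν 0 s = (∏ j, (s - ν j)) * symbolG ν s := by
  rw [← sum_alphaCoeff_mul_pow, Finset.sum_mul]
  simp [symbolPsi, mul_assoc]

/-- The `ψ_j` come from the Horner scheme of `∏ (X - ν_i)`: their polynomials arise by repeatedly
removing the constant coefficient and dividing by `X`. Hence the chain from `ψ_M = g` down to `ψ_0 =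
∏ (θ - ν_i) g`. -/
theorem mul_symbolPsi_succ (j : Fin M) (s : ℂ) :
    s * symbolPsi ν j.succ s
      = symbolPsi ν j.castSucc s - alphaCoeff ν j * symbolPsi ν (Fin.last M) s := by
  have h1 : M - j.val + 1 = (M - (j.val + 1) + 1) + 1 := by have := j.2; omega
  rw [symbolPsi_last, symbolPsi, symbolPsi, Fin.val_castSucc, h1,
    Finset.sum_range_succ' _ (M - (j.val + 1) + 1), Finset.mul_sum]
  simp only [Fin.val_succ, zero_add, pow_zero, one_mul, add_sub_cancel_right]
  refine Finset.sum_congr rfl fun i _ => ?_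
  rw [show i + 1 + j.val = i + (j.val + 1) by ring]
  ring

theorem mul_symbolPhi_castSucc (j : Fin M) (s : ℂ) :
    s * symbolPhi ν j.castSucc s = -1 * symbolPhi ν j.succ s := by
  have h1 : M - j.val + 1 = (M - (j.val + 1) + 1) + 1 := by have := j.2; omega
  rw [symbolPhi, symbolPhi, Fin.val_castSucc, Fin.val_succ, h1]
  ring

/-- The chain `φ_0, ..., φ_M` of Euler derivatives is closed by the recurrence of the symbol of `f`.
The product `∏ (s + ν_j) = (-1)^M ∏ (-s - ν_j)` is expanded in the `α_i`, and the alternating signs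
of the `φ_j` match those of `(-s)^i`. -/
theorem mul_symbolPhi_last {s : ℂ} (hs : s ∈ raySlit 0) :
    s * symbolPhi ν (Fin.last M) s
      + ∑ i : Fin M, -alphaCoeff ν i * symbolPhi ν i.succ s = symbolF ν (s - 1) := by
  rw [← neg_mul_prod_mul_symbolF ν hs]
  have h1 : ∏ j, (s + ν j) = (-1) ^ M * ∏ j, (-s - ν j) := by
    rw [show ((-1 : ℂ)) ^ M = ∏ _j : Fin M, (-1 : ℂ) by simp, ← Finset.prod_mul_distrib]
    refine Finset.prod_congr rfl fun j _ => by ring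
  rw [h1, ← sum_alphaCoeff_mul_pow, Finset.sum_range_succ, alphaCoeff_self, mul_add]
  have h2 : ∀ i : Fin M, -alphaCoeff ν i * symbolPhi ν i.succ s
      = -s * ((-1) ^ M * (alphaCoeff ν i * (-s) ^ i.val)) * symbolF ν s := by
    intro i
    have h3 : M = (M - (i.val + 1)) + (i.val + 1) := by have := i.2; omega
    rw [symbolPhi, Fin.val_succ]
    generalize hk : M - (i.val + 1) = k at h3 ⊢
    have h4 : ((-1 : ℂ)) ^ M = (-1) ^ (k + 1) * (-1) ^ i.val := by
      rw [← pow_add]; congr 1; omega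
    have h5 : ((-1 : ℂ)) ^ i.val * (-1) ^ i.val = 1 := by
      rw [← pow_add, ← two_mul, pow_mul]; simp
    rw [h4, neg_pow s]
    linear_combination (-alphaCoeff ν i * (-1) ^ (k + 1) * s ^ (i.val + 1) * symbolF ν s) * (-h5)
  rw [Finset.sum_congr rfl fun i _ => h2 i, ← Finset.sum_mul, ← Finset.mul_sum, ← Finset.mul_sum,
    ← Fin.sum_univ_eq_sum_range (fun i => alphaCoeff ν i * (-s) ^ i), symbolPhi, Fin.val_last,
    neg_pow s M]
  have h5 : ((-1 : ℂ)) ^ M * (-1) ^ M = 1 := by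
    rw [← pow_add, ← two_mul, pow_mul]; simp
  simp only [Nat.sub_self, zero_add, pow_one]
  linear_combination (s ^ (M + 1) * symbolF ν s) * h5

theorem hasDerivAt_phi_castSucc (j : Fin M) {x : ℝ} (hx : 0 < x) :
    HasDerivAt (phi ν j.castSucc) (-phi ν j.succ x / x) x := by
  have h := hasDerivAt_phi_loop ν j.castSucc hx
  simp only [mul_symbolPhi_castSucc] at h
  rw [loop_const_mul, mul_left_comm, ← phi_eq ν j.succ hx] at h
  simpa using h

theorem hasDerivAt_phi_last {x : ℝ} (hx : 0 < x) :
    HasDerivAt (phi ν (Fin.last M))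
      (((-1) ^ (M + 1) * x * phi ν 0 x + ∑ i : Fin M, alphaCoeff ν i * phi ν i.succ x) / x) x := by
  refine (hasDerivAt_phi_loop ν (Fin.last M) hx).congr_deriv ?_
  congr 1
  have hcl : ∀ i ∈ (Finset.univ : Finset (Fin M)),
      LoopClass 0 (fun s => -alphaCoeff ν i * symbolPhi ν i.succ s) := fun i _ =>
    (loopClass_symbolPhi ν i.succ).const_mul _
  have h1 := loop_congr (b := -1 / 2) (c := 0) (by norm_num)
    (fun s hs => mul_symbolPhi_last ν hs) x
  -- The shift of the symbol leaves a loop at `-3/2`; it is moved back to `-1/2`, since the symbol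
  -- of `f` has no singularities to the left of `0`.
  rw [(loopClass_symbolPhi ν (Fin.last M)).id_mul.loop_add (LoopClass.sum _ hcl) (by norm_num) hx,
    LoopClass.loop_sum _ hcl (by norm_num) hx, loop_comp_sub_one _ _ hx,
    (loopClass_symbolF ν).loop_eq (b' := -1 / 2) (by norm_num) (by norm_num) hx] at h1
  have h2 : phi ν 0 x = (-1) ^ (M + 1) * (loopConst * loop (-1 / 2) (symbolF ν) x) := by
    rw [← fFun_eq]; simp [phi]
  have h3 : ∀ i : Fin M, alphaCoeff ν i * phi ν i.succ x
      = -(loopConst * loop (-1 / 2) (fun s => -alphaCoeff ν i * symbolPhi ν i.succ s) x) := by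
    intro i
    rw [phi_eq ν i.succ hx, loop_const_mul]; ring
  have h5 : ((-1 : ℂ)) ^ (M + 1) * (-1) ^ (M + 1) = 1 := by
    rw [← pow_add, ← two_mul, pow_mul]; simp
  rw [Finset.sum_congr rfl fun i _ => h3 i, Finset.sum_neg_distrib, ← Finset.mul_sum, h2]
  linear_combination loopConst * h1 - (x * loopConst * loop (-1 / 2) (symbolF ν) x) * h5

theorem hasDerivAt_psi_succ (j : Fin M) {x : ℝ} (hx : 0 < x) :
    HasDerivAt (psi ν j.succ)
      ((psi ν j.castSucc x - alphaCoeff ν j * psi ν (Fin.last M) x) / x) x := by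
  have h := hasDerivAt_psi_loop ν j.succ hx
  simp only [mul_symbolPsi_succ, sub_eq_add_neg, ← neg_mul] at h
  rw [(loopClass_symbolPsi ν _).loop_add ((loopClass_symbolPsi ν _).const_mul _) (by norm_num) hx,
    loop_const_mul] at h
  rw [psi_eq ν _ hx, psi_eq ν _ hx]
  exact h.congr_deriv (by ring)

theorem hasDerivAt_psi_zero {x : ℝ} (hx : 0 < x) :
    HasDerivAt (psi ν 0) ((-1) ^ M * x * psi ν (Fin.last M) x / x) x := by
  refine (hasDerivAt_psi_loop ν 0 hx).congr_deriv ?_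
  have h1 := loop_congr (b := -1 / 2) (c := 0) (h := fun s => s * symbolPsi ν 0 s)
    (h' := fun s => (-1) ^ M * symbolG ν (s - 1)) (by norm_num)
    (fun s hs => by
      simp only [symbolPsi_zero, ← mul_prod_mul_symbolG ν hs]; ring) x
  rw [h1, loop_const_mul, loop_comp_sub_one _ _ hx,
    (loopClass_symbolG ν).loop_eq (b' := -1 / 2) (by norm_num) (by norm_num) hx,
    psi_eq ν _ hx, funext (symbolPsi_last ν)]
  ring

/-- The loop may stand anywhere to the left of the pole at `0`. The exponent `-1/4` is chosen so
that products of two such functions are integrable at the origin. -/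
theorem norm_phi_le (j : Fin (M + 1)) :
    ∃ C, ∀ x : ℝ, 0 < x → x ≤ 1 → ‖phi ν j x‖ ≤ C * x ^ (-1 / 4 : ℝ) := by
  obtain ⟨C, hC⟩ := ((loopClass_symbolPhi ν j).const_mul loopConst).norm_loop_le
    (b := -1 / 4) (by norm_num)
  refine ⟨C, fun x hx hx1 => ?_⟩
  rw [phi_eq ν j hx, ← loop_const_mul, ((loopClass_symbolPhi ν j).const_mul _).loop_eq
    (b' := -1 / 4) (by norm_num) (by norm_num) hx]
  exact hC x hx hx1

theorem norm_psi_le (j : Fin (M + 1)) :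
    ∃ C, ∀ x : ℝ, 0 < x → x ≤ 1 → ‖psi ν j x‖ ≤ C * x ^ (-1 / 4 : ℝ) := by
  obtain ⟨C, hC⟩ := ((loopClass_symbolPsi ν j).const_mul loopConst).norm_loop_le
    (b := -1 / 4) (by norm_num)
  refine ⟨C, fun x hx hx1 => ?_⟩
  rw [psi_eq ν j hx, ← loop_const_mul, ((loopClass_symbolPsi ν j).const_mul _).loop_eq
    (b' := -1 / 4) (by norm_num) (by norm_num) hx]
  exact hC x hx hx1

/-- For positive index the symbol contains a factor `s`, and `s Γ(-s) = -Γ(1 - s)` has no pole at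
`0`. The loop can therefore be moved to `1/2`. -/
theorem norm_phi_succ_le (j : Fin M) :
    ∃ C, ∀ x : ℝ, 0 < x → x ≤ 1 → ‖phi ν j.succ x‖ ≤ C * x ^ (1 / 2 : ℝ) := by
  set h : ℂ → ℂ := fun s => loopConst * (-1) ^ (M - j.succ.val + 1) * -1 *
    (s ^ j.val * (Complex.Gamma (1 - s) * ∏ j, (Complex.Gamma (1 + ν j + s))⁻¹)) with hdef
  have hh : LoopClass 1 h := LoopClass.const_mul (LoopClass.pow_mul
    (loopClass_prod_Gamma_add_inv ν (by simpa using loopClass_Gamma_sub 1)) _) _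
  obtain ⟨C, hC⟩ := hh.norm_loop_le (b := 1 / 2) (by norm_num)
  refine ⟨C, fun x hx hx1 => ?_⟩
  rw [phi_eq ν j.succ hx, ← loop_const_mul, loop_congr (c := 0) (h' := h) (by norm_num) ?_ x,
    hh.loop_eq (b' := 1 / 2) (by norm_num) (by norm_num) hx]
  · exact hC x hx hx1
  · intro s hs
    have hs0 : -s ≠ 0 := by simpa using ne_zero_of_mem_raySlit hs 0
    have h1 := Complex.Gamma_add_one _ hs0
    simp only [hdef, symbolPhi, symbolF]
    rw [show (1 : ℂ) - s = -s + 1 by ring, h1, Fin.val_succ, pow_succ s]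
    ring

/-- The factor `∏ (s - ν_j)` in the symbol of `ψ_0` turns each `Γ(ν_j - s)` into `-Γ(ν_j + 1 - s)`,
so all poles are at `1` or further to the right. -/
theorem norm_psi_zero_le :
    ∃ C, ∀ x : ℝ, 0 < x → x ≤ 1 → ‖psi ν 0 x‖ ≤ C * x ^ (1 / 2 : ℝ) := by
  set h : ℂ → ℂ := fun s => loopConst * (-1) ^ M *
    ((Complex.Gamma (1 + s))⁻¹ * ∏ j, Complex.Gamma (ν j + 1 - s)) with hdef
  have hh : LoopClass 1 h := by
    refine LoopClass.const_mul (LoopClass.mul_prod _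
      (by simpa using loopClass_Gamma_add_inv 1 1) fun j _ => ?_) _
    have h := loopClass_Gamma_sub (ν j + 1)
    push_cast at h
    exact h.mono (by linarith [(Nat.cast_nonneg (ν j) : (0 : ℝ) ≤ ν j)])
  obtain ⟨C, hC⟩ := hh.norm_loop_le (b := 1 / 2) (by norm_num)
  refine ⟨C, fun x hx hx1 => ?_⟩
  rw [psi_eq ν 0 hx, ← loop_const_mul, loop_congr (c := 0) (h' := h) (by norm_num) ?_ x,
    hh.loop_eq (b' := 1 / 2) (by norm_num) (by norm_num) hx]
  · exact hC x hx hx1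
  · intro s hs
    have h2 : (∏ j, (s - ν j)) * ∏ j, Complex.Gamma (ν j - s)
        = (-1) ^ M * ∏ j, Complex.Gamma (ν j + 1 - s) := by
      rw [show ((-1 : ℂ)) ^ M = ∏ _j : Fin M, (-1 : ℂ) by simp, ← Finset.prod_mul_distrib,
        ← Finset.prod_mul_distrib]
      refine Finset.prod_congr rfl fun j _ => ?_
      rw [show (ν j : ℂ) + 1 - s = ν j - s + 1 by ring,
        Complex.Gamma_add_one _ (ne_zero_of_mem_raySlit hs _)]
      ring
    simp only [hdef, symbolPsi_zero, symbolG]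
    linear_combination loopConst * (Complex.Gamma (1 + s))⁻¹ * h2

end PhiPsi

end GenBessel

namespace GenBessel

open MeasureTheory Set Filter Topology

/-! ### Integrals of products along rays through the origin -/

section RayIntegral

/-- Functions on `(0, ∞)` that are continuous and `O(x^{-1/4})` at the origin. -/
structure Tame (p : ℝ → ℂ) : Prop where
  cont : ContinuousOn p (Ioi 0)
  bound : ∃ C, ∀ x : ℝ, 0 < x → x ≤ 1 → ‖p x‖ ≤ C * x ^ (-1 / 4 : ℝ)

theorem Tame.add {p q : ℝ → ℂ} (hp : Tame p) (hq : Tame q) : Tame (fun x => p x + q x) := by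
  obtain ⟨C, hC⟩ := hp.bound
  obtain ⟨C', hC'⟩ := hq.bound
  refine ⟨hp.cont.add hq.cont, C + C', fun x hx hx1 => ?_⟩
  rw [add_mul]
  exact (norm_add_le _ _).trans (add_le_add (hC x hx hx1) (hC' x hx hx1))

theorem Tame.const_mul {p : ℝ → ℂ} (hp : Tame p) (a : ℂ) : Tame (fun x => a * p x) := by
  obtain ⟨C, hC⟩ := hp.bound
  refine ⟨continuousOn_const.mul hp.cont, ‖a‖ * C, fun x hx hx1 => ?_⟩
  rw [norm_mul, mul_assoc]
  exact mul_le_mul_of_nonneg_left (hC x hx hx1) (norm_nonneg _)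

theorem Tame.bound_Ioc {p : ℝ → ℂ} (hp : Tame p) (X : ℝ) :
    ∃ C, 0 ≤ C ∧ ∀ x : ℝ, 0 < x → x ≤ X → ‖p x‖ ≤ C * x ^ (-1 / 4 : ℝ) := by
  obtain ⟨C, hC⟩ := hp.bound
  obtain ⟨C', hC'⟩ := (isCompact_Icc (a := (1 : ℝ)) (b := X)).exists_bound_of_continuousOn
    (hp.cont.mono fun x hx => lt_of_lt_of_le one_pos hx.1)
  -- On `[1, X]` one has `x ^ (-1/4) ≥ X ^ (-1/4)`, whence the factor `X ^ (1/4)` in the constant.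
  refine ⟨max (max C (C' * X ^ (1 / 4 : ℝ))) 0, le_max_right _ _, fun x hx hxX => ?_⟩
  have hpos := Real.rpow_pos_of_pos hx (-1 / 4)
  rcases le_total x 1 with h1 | h1
  · exact (hC x hx h1).trans (mul_le_mul_of_nonneg_right
      ((le_max_left _ _).trans (le_max_left _ _)) hpos.le)
  · have h2 := hC' x ⟨h1, hxX⟩
    have h0 : 0 ≤ C' := (norm_nonneg _).trans h2
    have h3 : 1 ≤ X ^ (1 / 4 : ℝ) * x ^ (-1 / 4 : ℝ) := by
      rw [show (-1 / 4 : ℝ) = -(1 / 4) by norm_num, Real.rpow_neg hx.le, ← div_eq_mul_inv,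
        one_le_div (Real.rpow_pos_of_pos hx _)]
      exact Real.rpow_le_rpow hx.le hxX (by norm_num)
    calc ‖p x‖ ≤ C' * 1 := by rw [mul_one]; exact h2
      _ ≤ C' * (X ^ (1 / 4 : ℝ) * x ^ (-1 / 4 : ℝ)) := mul_le_mul_of_nonneg_left h3 h0
      _ = (C' * X ^ (1 / 4 : ℝ)) * x ^ (-1 / 4 : ℝ) := by ring
      _ ≤ _ := mul_le_mul_of_nonneg_right ((le_max_right _ _).trans (le_max_left _ _)) hpos.le

/-- `∫_0^1 p(tx) q(ty) dt`. -/
noncomputable def rayIntegral (p q : ℝ → ℂ) (x y : ℝ) : ℂ :=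
  ∫ t in Ioc (0 : ℝ) 1, p (t * x) * q (t * y)

theorem rayIntegral_swap (p q : ℝ → ℂ) (x y : ℝ) : rayIntegral p q x y = rayIntegral q p y x := by
  simp only [rayIntegral, mul_comm]

variable {p q Dp Dq : ℝ → ℂ}

/-- Two exponents `-1/4` add up to the integrable exponent `-1/2`, uniformly for `x`, `y` in a
compact set. This is the majorant for all integrals along rays. -/
theorem Tame.bound_mul (hp : Tame p) (hq : Tame q) {x₁ : ℝ} (hx₁ : 0 < x₁) (X : ℝ) :
    ∃ C, 0 ≤ C ∧ ∀ t ∈ Ioc (0 : ℝ) 1, ∀ x ∈ Icc x₁ X, ∀ y ∈ Icc x₁ X,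
      ‖p (t * x) * q (t * y)‖ ≤ C * t ^ (-1 / 2 : ℝ) := by
  obtain ⟨C, hC0, hC⟩ := hp.bound_Ioc X
  obtain ⟨C', hC0', hC'⟩ := hq.bound_Ioc X
  have key : ∀ t ∈ Ioc (0 : ℝ) 1, ∀ x ∈ Icc x₁ X, 0 < t * x ∧ t * x ≤ X ∧
      (t * x) ^ (-1 / 4 : ℝ) ≤ x₁ ^ (-1 / 4 : ℝ) * t ^ (-1 / 4 : ℝ) := by
    intro t ht x hx
    have hx0 : 0 < x := hx₁.trans_le hx.1
    refine ⟨mul_pos ht.1 hx0, ?_, ?_⟩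
    · calc t * x ≤ 1 * x := mul_le_mul_of_nonneg_right ht.2 hx0.le
        _ ≤ X := by linarith [hx.2]
    · rw [← Real.mul_rpow hx₁.le ht.1.le, mul_comm x₁]
      exact Real.rpow_le_rpow_of_nonpos (mul_pos ht.1 hx₁)
        (mul_le_mul_of_nonneg_left hx.1 ht.1.le) (by norm_num)
  refine ⟨C * C' * (x₁ ^ (-1 / 4 : ℝ)) ^ 2, by positivity, fun t ht x hx y hy => ?_⟩
  obtain ⟨h1, h2, h3⟩ := key t ht x hx
  obtain ⟨h4, h5, h6⟩ := key t ht y hy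
  have h7 : t ^ (-1 / 2 : ℝ) = t ^ (-1 / 4 : ℝ) * t ^ (-1 / 4 : ℝ) := by
    rw [← Real.rpow_add ht.1]; norm_num
  have h8 := (hC _ h1 h2).trans (mul_le_mul_of_nonneg_left h3 hC0)
  have h9 := (hC' _ h4 h5).trans (mul_le_mul_of_nonneg_left h6 hC0')
  rw [norm_mul, h7]
  refine (mul_le_mul h8 h9 (norm_nonneg _) ((norm_nonneg _).trans h8)).trans_eq ?_
  ring

theorem integrableOn_rpow_neg_half : IntegrableOn (fun t : ℝ => t ^ (-1 / 2 : ℝ)) (Ioc 0 1) := by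
  have := intervalIntegral.intervalIntegrable_rpow' (a := 0) (b := 1) (r := -1 / 2) (by norm_num)
  rwa [intervalIntegrable_iff_integrableOn_Ioc_of_le (by norm_num)] at this

theorem Tame.continuousOn_mul (hp : Tame p) (hq : Tame q) {x y : ℝ} (hx : 0 < x) (hy : 0 < y) :
    ContinuousOn (fun t : ℝ => p (t * x) * q (t * y)) (Ioi 0) :=
  (hp.cont.comp (by fun_prop) fun _ ht => mul_pos ht hx).mul
    (hq.cont.comp (by fun_prop) fun _ ht => mul_pos ht hy)

theorem Tame.aestronglyMeasurable (hp : Tame p) (hq : Tame q) {x y : ℝ} (hx : 0 < x)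
    (hy : 0 < y) :
    AEStronglyMeasurable (fun t : ℝ => p (t * x) * q (t * y)) (volume.restrict (Ioc 0 1)) :=
  ((hp.continuousOn_mul hq hx hy).mono fun _ ht => ht.1).aestronglyMeasurable measurableSet_Ioc

theorem Tame.integrableOn (hp : Tame p) (hq : Tame q) {x y : ℝ} (hx : 0 < x) (hy : 0 < y) :
    IntegrableOn (fun t : ℝ => p (t * x) * q (t * y)) (Ioc 0 1) := by
  obtain ⟨C, -, hC⟩ := hp.bound_mul hq (lt_min hx hy) (max x y)
  refine (integrableOn_rpow_neg_half.const_mul C).mono' (hp.aestronglyMeasurable hq hx hy) ?_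
  filter_upwards [ae_restrict_mem measurableSet_Ioc] with t ht
  exact hC t ht x ⟨min_le_left _ _, le_max_left _ _⟩ y ⟨min_le_right _ _, le_max_right _ _⟩

theorem continuousOn_rayIntegral (hp : Tame p) (hq : Tame q) :
    ContinuousOn (Function.uncurry (rayIntegral p q)) (Ioi 0 ×ˢ Ioi 0) := by
  rintro ⟨x₀, y₀⟩ ⟨hx₀ : 0 < x₀, hy₀ : 0 < y₀⟩
  refine ContinuousAt.continuousWithinAt ?_
  set x₁ := min x₀ y₀ / 2 with hx₁
  have h₁ : 0 < x₁ := by have := lt_min hx₀ hy₀; positivity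
  set X := max x₀ y₀ + 1 with hX
  obtain ⟨C, -, hC⟩ := hp.bound_mul hq h₁ X
  have hmin := min_le_left x₀ y₀
  have hmin' := min_le_right x₀ y₀
  have hmax := le_max_left x₀ y₀
  have hmax' := le_max_right x₀ y₀
  have hnhds : ∀ᶠ z : ℝ × ℝ in 𝓝 (x₀, y₀), z.1 ∈ Icc x₁ X ∧ z.2 ∈ Icc x₁ X := by
    exact (continuousAt_fst.eventually (Icc_mem_nhds (a := x₁) (b := X) (by simp only; linarith)
      (by simp only; linarith))).and (continuousAt_snd.eventually (Icc_mem_nhds (a := x₁) (b := X)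
        (by simp only; linarith) (by simp only; linarith)))
  refine continuousAt_of_dominated (F := fun (z : ℝ × ℝ) t => p (t * z.1) * q (t * z.2))
    (bound := fun t => C * t ^ (-1 / 2 : ℝ)) ?_ ?_ (integrableOn_rpow_neg_half.const_mul C) ?_
  · filter_upwards [hnhds] with z hz
    exact hp.aestronglyMeasurable hq (h₁.trans_le hz.1.1) (h₁.trans_le hz.2.1)
  · filter_upwards [hnhds] with z hz
    filter_upwards [ae_restrict_mem measurableSet_Ioc] with t ht
    exact hC t ht _ hz.1 _ hz.2
  · filter_upwards [ae_restrict_mem measurableSet_Ioc] with t ht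
    have h2 : ContinuousAt (fun z : ℝ × ℝ => t * z.1) (x₀, y₀) := by fun_prop
    have h3 : ContinuousAt (fun z : ℝ × ℝ => t * z.2) (x₀, y₀) := by fun_prop
    exact (ContinuousAt.comp (f := fun z : ℝ × ℝ => t * z.1) (g := p)
      (hp.cont.continuousAt (Ioi_mem_nhds (mul_pos ht.1 hx₀))) h2).mul
      (ContinuousAt.comp (f := fun z : ℝ × ℝ => t * z.2) (g := q)
        (hq.cont.continuousAt (Ioi_mem_nhds (mul_pos ht.1 hy₀))) h3)

/-- The derivative of `p (t x)` in `x` is `t p'(t x) = Dp (t x) / x`. The powers of `t` cancel, so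
the differentiated integrand is no more singular at `t = 0`. -/
theorem hasDerivAt_rayIntegral (hp : Tame p) (hq : Tame q) (hDp : Tame Dp)
    (hder : ∀ x, 0 < x → HasDerivAt p (Dp x / x) x) {x y : ℝ} (hx : 0 < x) (hy : 0 < y) :
    HasDerivAt (fun x => rayIntegral p q x y) (rayIntegral Dp q x y / x) x := by
  set x₁ := min (x / 2) y with hx₁
  have h₁ : 0 < x₁ := lt_min (by positivity) hy
  set X := max (2 * x) y with hX
  obtain ⟨C, hC0, hC⟩ := hDp.bound_mul hq h₁ X
  have hmem : ∀ z ∈ Ioo (x / 2) (2 * x), 0 < z ∧ z ∈ Icc x₁ X := fun z hz =>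
    ⟨lt_trans (by positivity) hz.1, (min_le_left _ _).trans hz.1.le,
      hz.2.le.trans (le_max_left _ _)⟩
  have hy' : y ∈ Icc x₁ X := ⟨min_le_right _ _, le_max_right _ _⟩
  have h := hasDerivAt_integral_of_dominated_loc_of_deriv_le (μ := volume.restrict (Ioc (0 : ℝ) 1))
    (F := fun (z : ℝ) t => p (t * z) * q (t * y)) (x₀ := x) (s := Ioo (x / 2) (2 * x))
    (F' := fun (z : ℝ) t => Dp (t * z) * q (t * y) / z)
    (bound := fun t => 2 / x * (C * t ^ (-1 / 2 : ℝ)))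
    (Ioo_mem_nhds (by linarith) (by linarith))
    (by
      filter_upwards [Ioi_mem_nhds hx] with z hz
      exact hp.aestronglyMeasurable hq hz hy)
    (hp.integrableOn hq hx hy)
    (by
      simp_rw [div_eq_mul_inv]
      exact (hDp.aestronglyMeasurable hq hx hy).mul_const _)
    (by
      filter_upwards [ae_restrict_mem measurableSet_Ioc] with t ht z hz
      obtain ⟨hz0, hz1⟩ := hmem z hz
      rw [norm_div, Complex.norm_real, Real.norm_of_nonneg hz0.le, div_eq_inv_mul]
      refine mul_le_mul ?_ (hC t ht z hz1 y hy') (norm_nonneg _) (by positivity)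
      rw [inv_eq_one_div, div_le_div_iff₀ hz0 hx]
      linarith [hz.1])
    ((integrableOn_rpow_neg_half.const_mul C).const_mul _)
    (by
      filter_upwards [ae_restrict_mem measurableSet_Ioc] with t ht z hz
      have hz0 := (hmem z hz).1
      have h1 : HasDerivAt (fun z : ℝ => t * z) t z := by
        simpa using (hasDerivAt_id z).const_mul t
      have h2 := ((hder (t * z) (mul_pos ht.1 hz0)).scomp z h1).mul_const (q (t * y))
      refine h2.congr_deriv ?_
      have ht0 : (t : ℂ) ≠ 0 := by exact_mod_cast ht.1.ne'
      have hz0' : (z : ℂ) ≠ 0 := by exact_mod_cast hz0.ne'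
      rw [Complex.real_smul]
      push_cast
      field_simp)
  have h' := h.2
  rwa [integral_div] at h'

theorem tendsto_norm_le_rpow {F : ℝ → ℂ} {C r : ℝ} (hr : 0 < r) {δ : ℝ} (hδ : 0 < δ)
    (hF : ∀ t ∈ Ioc (0 : ℝ) δ, ‖F t‖ ≤ C * t ^ r) : Tendsto F (𝓝[>] 0) (𝓝 0) := by
  refine squeeze_zero_norm' (a := fun t : ℝ => C * t ^ r) ?_ ?_
  · filter_upwards [Ioc_mem_nhdsGT hδ] with t ht using hF t ht
  · have h1 : Tendsto (fun t : ℝ => C * t ^ r) (𝓝 0) (𝓝 (C * (0 : ℝ) ^ r)) :=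
      ((Real.continuousAt_rpow_const 0 r (Or.inr hr.le)).tendsto).const_mul C
    rw [Real.zero_rpow hr.ne', mul_zero] at h1
    exact h1.mono_left nhdsWithin_le_nhds

/-- The fundamental theorem of calculus on `(0, 1]` for functions vanishing at `0`. -/
theorem integral_Ioc_eq_of_tendsto {F F' : ℝ → ℂ} (hF : ∀ t, 0 < t → HasDerivAt F (F' t) t)
    (hint : IntegrableOn F' (Ioc 0 1)) (h0 : Tendsto F (𝓝[>] 0) (𝓝 0)) :
    ∫ t in Ioc (0 : ℝ) 1, F' t = F 1 := by
  rw [← intervalIntegral.integral_of_le zero_le_one]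
  have h := intervalIntegral.integral_eq_sub_of_hasDerivAt_of_tendsto (a := 0) (b := 1)
    zero_lt_one (fun t ht => hF t ht.1)
    ((intervalIntegrable_iff_integrableOn_Ioc_of_le zero_le_one).2 hint) h0
    ((hF 1 one_pos).continuousAt.tendsto.mono_left nhdsWithin_le_nhds)
  simpa using h

/-- The integrand on the left is the `t`-derivative of `t p(t x) q(t y)`, which is `O(t ^ (1/2))` at
the origin. This becomes the rank one identity of the kernel. -/
theorem rayIntegral_euler (hp : Tame p) (hq : Tame q) (hDp : Tame Dp) (hDq : Tame Dq)
    (hder : ∀ x, 0 < x → HasDerivAt p (Dp x / x) x)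
    (hder' : ∀ x, 0 < x → HasDerivAt q (Dq x / x) x) {x y : ℝ} (hx : 0 < x) (hy : 0 < y) :
    rayIntegral Dp q x y + rayIntegral p Dq x y + rayIntegral p q x y = p x * q y := by
  have hi1 := hDp.integrableOn hq hx hy
  have hi2 := hp.integrableOn hDq hx hy
  have hi3 := hp.integrableOn hq hx hy
  simp only [rayIntegral]
  have hadd : ∫ t in Ioc (0 : ℝ) 1,
      (Dp (t * x) * q (t * y) + p (t * x) * Dq (t * y) + p (t * x) * q (t * y)) = _ :=
    (integral_add (hi1.add hi2) hi3).trans (congrArg (· + _) (integral_add hi1 hi2))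
  rw [← hadd]
  obtain ⟨C, hC0, hC⟩ := hp.bound_mul hq (lt_min hx hy) (max x y)
  have h := integral_Ioc_eq_of_tendsto (F := fun t : ℝ => (t : ℂ) * (p (t * x) * q (t * y)))
    (F' := fun t => Dp (t * x) * q (t * y) + p (t * x) * Dq (t * y) + p (t * x) * q (t * y))
    (fun t ht => ?_) ((hi1.add hi2).add hi3) ?_
  · simpa using h
  · have h1 : HasDerivAt (fun z : ℝ => z * x) x t := by simpa using (hasDerivAt_id t).mul_const x
    have h2 : HasDerivAt (fun z : ℝ => z * y) y t := by simpa using (hasDerivAt_id t).mul_const y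
    have h3 := ((hder _ (mul_pos ht hx)).scomp t h1).mul ((hder' _ (mul_pos ht hy)).scomp t h2)
    have h4 := (hasDerivAt_id t).ofReal_comp.mul h3
    refine h4.congr_deriv ?_
    have ht0 : (t : ℂ) ≠ 0 := by exact_mod_cast ht.ne'
    have hx0 : (x : ℂ) ≠ 0 := by exact_mod_cast hx.ne'
    have hy0 : (y : ℂ) ≠ 0 := by exact_mod_cast hy.ne'
    simp only [Complex.real_smul, Pi.mul_apply, Function.comp, id]
    push_cast
    field_simp
    ring
  · refine tendsto_norm_le_rpow (C := C) (r := 1 / 2) (by norm_num) one_pos fun t ht => ?_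
    rw [norm_mul, Complex.norm_real, Real.norm_of_nonneg ht.1.le]
    refine (mul_le_mul_of_nonneg_left (hC t ht x ⟨min_le_left _ _, le_max_left _ _⟩ y
      ⟨min_le_right _ _, le_max_right _ _⟩) ht.1.le).trans_eq ?_
    rw [show (1 / 2 : ℝ) = 1 + -1 / 2 by norm_num, Real.rpow_add ht.1, Real.rpow_one]
    ring

end RayIntegral

/-! ### The regularity of the kernel -/

section Kernel

/-- Kernels `k(x,y) = ∑_j A_j(x) B_j(y) / (x - y)` on `(0, ∞)` that are continuously differentiable
and satisfy `(x ∂_x + y ∂_y + 1) k = α(x) β(y)`. -/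
structure IntegrableKernel {ι : Type*} [Fintype ι] (A B : ι → ℝ → ℂ) (α β : ℝ → ℂ)
    (k k₁ k₂ : ℝ → ℝ → ℂ) : Prop where
  contA : ∀ j, ContinuousOn (A j) (Ioi 0)
  contB : ∀ j, ContinuousOn (B j) (Ioi 0)
  contα : ContinuousOn α (Ioi 0)
  contβ : ContinuousOn β (Ioi 0)
  cont : ContinuousOn (Function.uncurry k) (Ioi 0 ×ˢ Ioi 0)
  cont₁ : ContinuousOn (Function.uncurry k₁) (Ioi 0 ×ˢ Ioi 0)
  cont₂ : ContinuousOn (Function.uncurry k₂) (Ioi 0 ×ˢ Ioi 0)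
  deriv₁ : ∀ x y, 0 < x → 0 < y → HasDerivAt (fun x => k x y) (k₁ x y) x
  deriv₂ : ∀ x y, 0 < x → 0 < y → HasDerivAt (fun y => k x y) (k₂ x y) y
  sum_eq : ∀ x y : ℝ, 0 < x → 0 < y → ∑ j, A j x * B j y = ((x : ℂ) - y) * k x y
  euler_eq : ∀ x y : ℝ, 0 < x → 0 < y → x * k₁ x y + y * k₂ x y + k x y = α x * β y

theorem continuousOn_uncurry_flip {k : ℝ → ℝ → ℂ}
    (h : ContinuousOn (Function.uncurry k) (Ioi 0 ×ˢ Ioi 0)) :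
    ContinuousOn (Function.uncurry fun x y => k y x) (Ioi 0 ×ˢ Ioi 0) :=
  h.comp continuous_swap.continuousOn fun _ hz => ⟨hz.2, hz.1⟩

/-- The hypotheses are symmetric under transposition, up to the sign of `x - y`, which is put into
`A`. All results for `Q_j` thus transfer to `P_j`. -/
theorem IntegrableKernel.flip {ι : Type*} [Fintype ι] {A B : ι → ℝ → ℂ} {α β : ℝ → ℂ}
    {k k₁ k₂ : ℝ → ℝ → ℂ} (h : IntegrableKernel A B α β k k₁ k₂) :
    IntegrableKernel B (fun j x => -A j x) β α (fun x y => k y x) (fun x y => k₂ y x)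
      (fun x y => k₁ y x) where
  contA := h.contB
  contB := fun j => (h.contA j).neg
  contα := h.contβ
  contβ := h.contα
  cont := continuousOn_uncurry_flip h.cont
  cont₁ := continuousOn_uncurry_flip h.cont₂
  cont₂ := continuousOn_uncurry_flip h.cont₁
  deriv₁ := fun x y hx hy => h.deriv₂ y x hy hx
  deriv₂ := fun x y hx hy => h.deriv₁ y x hy hx
  sum_eq := fun x y hx hy => by
    have := h.sum_eq y x hy hx
    have h' : ∑ j, B j x * -A j y = -∑ j, A j y * B j x := by
      rw [← Finset.sum_neg_distrib]
      exact Finset.sum_congr rfl fun j _ => by ring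
    rw [h', this]
    ring
  euler_eq := fun x y hx hy => by
    have := h.euler_eq y x hy hx
    linear_combination this

variable {M : ℕ} (ν : Fin M → ℕ)

theorem continuousOn_phi (j : Fin (M + 1)) : ContinuousOn (phi ν j) (Ioi 0) := fun _ hx =>
  (hasDerivAt_phi_loop ν j hx).continuousAt.continuousWithinAt

theorem continuousOn_psi (j : Fin (M + 1)) : ContinuousOn (psi ν j) (Ioi 0) := fun _ hx =>
  (hasDerivAt_psi_loop ν j hx).continuousAt.continuousWithinAt

theorem tame_phi (j : Fin (M + 1)) : Tame (phi ν j) := ⟨continuousOn_phi ν j, norm_phi_le ν j⟩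

theorem tame_psi (j : Fin (M + 1)) : Tame (psi ν j) := ⟨continuousOn_psi ν j, norm_psi_le ν j⟩

/-- In each product one factor is `O(x ^ (1/2))`, namely `ψ_0` for `j = 0` and `φ_j` for `j ≥ 1`,
and the other is `O(x ^ (-1/4))`. So the integral along a ray has no boundary term at the origin. -/
theorem tendsto_phi_mul_psi (j : Fin (M + 1)) {x y : ℝ} (hx : 0 < x) (hy : 0 < y) :
    Tendsto (fun t : ℝ => phi ν j (t * x) * psi ν j (t * y)) (𝓝[>] 0) (𝓝 0) := by
  have key : ∃ C C' r s : ℝ, 0 < r + s ∧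
      (∀ x : ℝ, 0 < x → x ≤ 1 → ‖phi ν j x‖ ≤ C * x ^ r) ∧
      (∀ x : ℝ, 0 < x → x ≤ 1 → ‖psi ν j x‖ ≤ C' * x ^ s) := by
    induction j using Fin.cases with
    | zero =>
      obtain ⟨C, hC⟩ := norm_phi_le ν 0
      obtain ⟨C', hC'⟩ := norm_psi_zero_le ν
      exact ⟨C, C', _, _, by norm_num, hC, hC'⟩
    | succ j =>
      obtain ⟨C, hC⟩ := norm_phi_succ_le ν j
      obtain ⟨C', hC'⟩ := norm_psi_le ν j.succ
      exact ⟨C, C', _, _, by norm_num, hC, hC'⟩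
  obtain ⟨C, C', r, s, hrs, hC, hC'⟩ := key
  have hm : 0 < max x y := hx.trans_le (le_max_left _ _)
  refine tendsto_norm_le_rpow (C := C * x ^ r * (C' * y ^ s)) hrs (inv_pos.2 hm) fun t ht => ?_
  have h1 : ∀ z, 0 < z → z ≤ max x y → t * z ≤ 1 := fun z hz hzm => by
    calc t * z ≤ (max x y)⁻¹ * max x y := mul_le_mul ht.2 hzm hz.le (inv_pos.2 hm).le
      _ = 1 := inv_mul_cancel₀ hm.ne'
  have h2 := hC _ (mul_pos ht.1 hx) (h1 x hx (le_max_left _ _))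
  have h3 := hC' _ (mul_pos ht.1 hy) (h1 y hy (le_max_right _ _))
  rw [norm_mul]
  refine (mul_le_mul h2 h3 (norm_nonneg _) ((norm_nonneg _).trans h2)).trans_eq ?_
  rw [Real.mul_rpow ht.1.le hx.le, Real.mul_rpow ht.1.le hy.le, Real.rpow_add ht.1]
  ring

/-- The bilinear concomitant: `(x ∂_x + y ∂_y) ∑_j φ_j(x) ψ_j(y) = (-1)^{M+1} (x-y) φ_0(x) ψ_M(y)`. -/
theorem hasDerivAt_sum_phi_mul_psi {x y : ℝ} (hx : 0 < x) (hy : 0 < y) {t : ℝ} (ht : 0 < t) :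
    HasDerivAt (fun t : ℝ => ∑ j, phi ν j (t * x) * psi ν j (t * y))
      ((-1) ^ (M + 1) * ((x : ℂ) - y) * (phi ν 0 (t * x) * psi ν (Fin.last M) (t * y))) t := by
  have h1 : HasDerivAt (fun z : ℝ => z * x) x t := by simpa using (hasDerivAt_id t).mul_const x
  have h2 : HasDerivAt (fun z : ℝ => z * y) y t := by simpa using (hasDerivAt_id t).mul_const y
  have ht0 : (t : ℂ) ≠ 0 := by exact_mod_cast ht.ne'
  have hx0 : (x : ℂ) ≠ 0 := by exact_mod_cast hx.ne'
  have hy0 : (y : ℂ) ≠ 0 := by exact_mod_cast hy.ne'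
  have htx := mul_pos ht hx
  have hty := mul_pos ht hy
  have hφ : ∀ j : Fin M, HasDerivAt (fun z : ℝ => phi ν j.castSucc (z * x))
      (-phi ν j.succ (t * x) / t) t := fun j => by
    refine ((hasDerivAt_phi_castSucc ν j htx).scomp t h1).congr_deriv ?_
    rw [Complex.real_smul]; push_cast; field_simp
  have hφl : HasDerivAt (fun z : ℝ => phi ν (Fin.last M) (z * x))
      (((-1) ^ (M + 1) * (t * x) * phi ν 0 (t * x)
        + ∑ i : Fin M, alphaCoeff ν i * phi ν i.succ (t * x)) / t) t := by
    refine ((hasDerivAt_phi_last ν htx).scomp t h1).congr_deriv ?_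
    rw [Complex.real_smul]; push_cast; field_simp
  have hψ : ∀ j : Fin M, HasDerivAt (fun z : ℝ => psi ν j.succ (z * y))
      ((psi ν j.castSucc (t * y) - alphaCoeff ν j * psi ν (Fin.last M) (t * y)) / t) t :=
    fun j => by
    refine ((hasDerivAt_psi_succ ν j hty).scomp t h2).congr_deriv ?_
    rw [Complex.real_smul]; push_cast; field_simp
  have hψ0 : HasDerivAt (fun z : ℝ => psi ν 0 (z * y))
      ((-1) ^ M * (t * y) * psi ν (Fin.last M) (t * y) / t) t := by
    refine ((hasDerivAt_psi_zero ν hty).scomp t h2).congr_deriv ?_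
    rw [Complex.real_smul]; push_cast; field_simp
  -- the two derivatives of a product, with the sum over `j` split at different ends
  have hφ' : ∀ j, DifferentiableAt ℝ (fun z : ℝ => phi ν j (z * x)) t := fun j => by
    induction j using Fin.lastCases with
    | last => exact hφl.differentiableAt
    | cast j => exact (hφ j).differentiableAt
  have hψ' : ∀ j, DifferentiableAt ℝ (fun z : ℝ => psi ν j (z * y)) t := fun j => by
    induction j using Fin.cases with
    | zero => exact hψ0.differentiableAt
    | succ j => exact (hψ j).differentiableAt
  have h := HasDerivAt.fun_sum (u := Finset.univ) fun j _ =>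
    (hφ' j).hasDerivAt.mul (hψ' j).hasDerivAt
  refine h.congr_deriv ?_
  rw [Finset.sum_add_distrib, Fin.sum_univ_castSucc, hφl.deriv,
    Fin.sum_univ_succ (fun j => phi ν j (t * x) * deriv (fun z : ℝ => psi ν j (z * y)) t), hψ0.deriv]
  simp only [(hφ _).deriv, (hψ _).deriv]
  rw [add_div, add_mul, Finset.sum_div, Finset.sum_mul]
  -- The inner products telescope and the `α_i` cancel. Only the two terms with the explicit factors
  -- `x` and `y` are left, both multiples of `φ_0 ψ_M`.
  have h3 : ∑ i : Fin M, -phi ν i.succ (t * x) / t * psi ν i.castSucc (t * y)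
      + ∑ i : Fin M, alphaCoeff ν i * phi ν i.succ (t * x) / t * psi ν (Fin.last M) (t * y)
      + ∑ i : Fin M, phi ν i.succ (t * x) *
        ((psi ν i.castSucc (t * y) - alphaCoeff ν i * psi ν (Fin.last M) (t * y)) / t) = 0 := by
    rw [← Finset.sum_add_distrib, ← Finset.sum_add_distrib]
    exact Finset.sum_eq_zero fun i _ => by ring
  rw [pow_succ]
  linear_combination h3 +
    ((-1) ^ M * ((y : ℂ) - x) * phi ν 0 (t * x) * psi ν (Fin.last M) (t * y)) *
      (div_self ht0)

/-- The bilinear concomitant, integrated over `t` from `0` to `1`. The numerator of the kernel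
acquires `x - y` as an explicit factor, which removes the apparent singularity on the diagonal. -/
theorem sum_phi_mul_psi {x y : ℝ} (hx : 0 < x) (hy : 0 < y) :
    ∑ j, phi ν j x * psi ν j y
      = ((x : ℂ) - y) * ((-1) ^ (M + 1) * rayIntegral (phi ν 0) (psi ν (Fin.last M)) x y) := by
  have h := integral_Ioc_eq_of_tendsto (fun t ht => hasDerivAt_sum_phi_mul_psi ν hx hy ht)
    (((tame_phi ν 0).integrableOn (tame_psi ν (Fin.last M)) hx hy).const_mul _)
    (by simpa using tendsto_finsetSum Finset.univ fun j _ => tendsto_phi_mul_psi ν j hx hy)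
  rw [integral_const_mul] at h
  simp only [one_mul] at h
  rw [← h, rayIntegral]
  ring

/-- Off the diagonal divide by `x - y`. On it, the value by L'Hospital's rule is the derivative at
`z = x` of `(z - x)` times a differentiable function, hence the value of that function. -/
theorem besselKernel_eq (hM : 1 ≤ M) {x y : ℝ} (hx : 0 < x) (hy : 0 < y) :
    besselKernel ν x y = (-1) ^ (M + 1) * rayIntegral (phi ν 0) (psi ν (Fin.last M)) x y := by
  rw [besselKernel]
  split_ifs with hxy
  · subst hxy
    have h1 := HasDerivAt.fun_sum (u := Finset.univ) fun j _ =>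
      (hasDerivAt_phi_loop ν j hx).differentiableAt.hasDerivAt.mul_const (psi ν j x)
    refine h1.unique ?_
    have h2 : DifferentiableAt ℝ (fun z => rayIntegral (phi ν 0) (psi ν (Fin.last M)) z x) x := by
      -- For `M ≥ 1` the function `φ_1` exists, and the Euler derivative of `φ_0` is the tame
      -- function `-φ_1`.
      obtain ⟨n, rfl⟩ : ∃ n, M = n + 1 := ⟨M - 1, by omega⟩
      exact (hasDerivAt_rayIntegral (Dp := fun x => -1 * phi ν (Fin.succ 0) x) (tame_phi ν 0)
        (tame_psi ν _) ((tame_phi ν _).const_mul _)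
        (fun z hz => by simpa using hasDerivAt_phi_castSucc ν 0 hz) hx hx).differentiableAt
    have h3 := ((hasDerivAt_id x).ofReal_comp.sub_const (x : ℂ)).mul
      (h2.hasDerivAt.const_mul ((-1) ^ (M + 1)))
    refine (h3.congr_of_eventuallyEq ?_).congr_deriv (by simp)
    filter_upwards [Ioi_mem_nhds hx] with z hz
    exact sum_phi_mul_psi ν hz hx
  · rw [sum_phi_mul_psi ν hx hy, mul_div_cancel_left₀]
    exact sub_ne_zero.2 (by exact_mod_cast hxy)

/-- All properties are read off from the representation along rays. Beyond this point the argument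
uses the kernel only through them, together with the linear systems for `φ_j` and `ψ_j`. -/
theorem integrableKernel_besselKernel (hM : 1 ≤ M) : ∃ k₁ k₂,
    IntegrableKernel (phi ν) (psi ν) (fun x => (-1) ^ (M + 1) * phi ν 0 x) (psi ν (Fin.last M))
      (besselKernel ν) k₁ k₂ := by
  have hK : ∀ x y, 0 < x → 0 < y → besselKernel ν x y
      = (-1) ^ (M + 1) * rayIntegral (phi ν 0) (psi ν (Fin.last M)) x y := fun x y hx hy =>
    besselKernel_eq ν hM hx hy
  obtain ⟨Dp, hDp, hder⟩ : ∃ Dp, Tame Dp ∧ ∀ x, 0 < x → HasDerivAt (phi ν 0) (Dp x / x) x := by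
    obtain ⟨n, rfl⟩ : ∃ n, M = n + 1 := ⟨M - 1, by omega⟩
    exact ⟨fun x => -1 * phi ν (Fin.succ 0) x, (tame_phi ν _).const_mul _,
      fun z hz => by simpa using hasDerivAt_phi_castSucc ν 0 hz⟩
  obtain ⟨Dq, hDq, hder'⟩ : ∃ Dq, Tame Dq ∧
      ∀ x, 0 < x → HasDerivAt (psi ν (Fin.last M)) (Dq x / x) x := by
    obtain ⟨n, rfl⟩ : ∃ n, M = n + 1 := ⟨M - 1, by omega⟩
    refine ⟨fun x => psi ν (Fin.last n).castSucc x
      + -alphaCoeff ν (Fin.last n) * psi ν (Fin.last (n + 1)) x,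
      (tame_psi ν _).add ((tame_psi ν _).const_mul _), fun z hz => ?_⟩
    simpa [sub_eq_add_neg] using hasDerivAt_psi_succ ν (Fin.last n) hz
  have hp := tame_phi ν 0
  have hq := tame_psi ν (Fin.last M)
  have hxc : ContinuousOn (fun z : ℝ × ℝ => (z.1 : ℂ)) (Ioi 0 ×ˢ Ioi 0) := by fun_prop
  have hyc : ContinuousOn (fun z : ℝ × ℝ => (z.2 : ℂ)) (Ioi 0 ×ˢ Ioi 0) := by fun_prop
  refine ⟨fun x y => (-1) ^ (M + 1) * (rayIntegral Dp (psi ν (Fin.last M)) x y / x),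
    fun x y => (-1) ^ (M + 1) * (rayIntegral (phi ν 0) Dq x y / y),
    ⟨continuousOn_phi ν, continuousOn_psi ν, continuousOn_const.mul hp.cont, hq.cont,
    ?_, ?_, ?_, ?_, ?_, ?_, ?_⟩⟩
  · exact (continuousOn_const.mul (continuousOn_rayIntegral hp hq)).congr
      fun z hz => hK z.1 z.2 hz.1 hz.2
  · exact continuousOn_const.mul ((continuousOn_rayIntegral hDp hq).div hxc
      fun z hz => by exact_mod_cast (ne_of_gt hz.1))
  · exact continuousOn_const.mul ((continuousOn_rayIntegral hp hDq).div hyc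
      fun z hz => by exact_mod_cast (ne_of_gt hz.2))
  · intro x y hx hy
    refine ((hasDerivAt_rayIntegral hp hq hDp hder hx hy).const_mul _).congr_of_eventuallyEq ?_
    filter_upwards [Ioi_mem_nhds hx] with z hz using hK z y hz hy
  · intro x y hx hy
    have h := hasDerivAt_rayIntegral hq hp hDq hder' hy hx
    rw [funext fun z => rayIntegral_swap (psi ν (Fin.last M)) (phi ν 0) z x,
      rayIntegral_swap Dq] at h
    refine (h.const_mul _).congr_of_eventuallyEq ?_
    filter_upwards [Ioi_mem_nhds hy] with z hz using hK x z hx hz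
  · intro x y hx hy
    rw [hK x y hx hy]
    exact sum_phi_mul_psi ν hx hy
  · intro x y hx hy
    rw [hK x y hx hy]
    have hx0 : (x : ℂ) ≠ 0 := by exact_mod_cast hx.ne'
    have hy0 : (y : ℂ) ≠ 0 := by exact_mod_cast hy.ne'
    have h := rayIntegral_euler hp hq hDp hDq hder hder' hx hy
    field_simp
    linear_combination h

end Kernel

end GenBessel

namespace GenBessel

open MeasureTheory Set Filter Topology

/-! ### Hadamard's inequality -/

section Hadamard

open scoped ComplexOrder

theorem prod_le_arith_mean_pow {n : ℕ} {l : Fin n → ℝ} (hl : ∀ i, 0 ≤ l i) :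
    ∏ i, l i ≤ ((∑ i, l i) / n) ^ n := by
  rcases Nat.eq_zero_or_pos n with rfl | hn
  · simp
  have hn0 : (n : ℝ) ≠ 0 := by exact_mod_cast hn.ne'
  have h := Real.geom_mean_le_arith_mean_weighted Finset.univ (fun _ : Fin n => (n : ℝ)⁻¹) l
    (fun _ _ => by positivity) (by simp [hn0]) (fun i _ => hl i)
  have h2 := pow_le_pow_left₀ (Finset.prod_nonneg fun i _ => Real.rpow_nonneg (hl i) _) h n
  rw [← Finset.prod_pow, ← Finset.mul_sum] at h2
  refine le_trans (le_of_eq (Finset.prod_congr rfl fun i _ => ?_)) (h2.trans_eq ?_)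
  · rw [← Real.rpow_natCast, ← Real.rpow_mul (hl i), inv_mul_cancel₀ hn0, Real.rpow_one]
  · rw [div_eq_inv_mul]

/-- `|det A|²` is the product of the eigenvalues of `A* A`. By the inequality of the means it is at
most `(tr (A* A) / n)^n`, and the trace is the sum of all `|A i j|²`, at most `n² B²`. -/
theorem norm_det_sq_le {n : ℕ} {B : ℝ} (A : Matrix (Fin n) (Fin n) ℂ) (hA : ∀ i j, ‖A i j‖ ≤ B) :
    ‖A.det‖ ^ 2 ≤ (n * B ^ 2) ^ n := by
  have hpos := Matrix.posSemidef_conjTranspose_mul_self A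
  have hdet : (‖A.det‖ ^ 2 : ℝ) = ∏ i, hpos.1.eigenvalues i := by
    have h1 := hpos.1.det_eq_prod_eigenvalues
    have h2 : (A.conjTranspose * A).det = ((‖A.det‖ ^ 2 : ℝ) : ℂ) := by
      rw [Matrix.det_mul, Matrix.det_conjTranspose]
      exact_mod_cast Complex.conj_mul' A.det
    rw [h2, ← RCLike.ofReal_prod] at h1
    exact RCLike.ofReal_injective (K := ℂ) h1
  have htr : ∑ i, hpos.1.eigenvalues i = ∑ j, ∑ i, ‖A i j‖ ^ 2 := by
    have h1 := hpos.1.trace_eq_sum_eigenvalues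
    have h2 : (A.conjTranspose * A).trace = ((∑ j, ∑ i, ‖A i j‖ ^ 2 : ℝ) : ℂ) := by
      simp only [Matrix.trace, Matrix.diag, Matrix.mul_apply, Matrix.conjTranspose_apply]
      push_cast
      exact Finset.sum_congr rfl fun j _ => Finset.sum_congr rfl fun i _ =>
        Complex.conj_mul' (A i j)
    rw [h2, ← RCLike.ofReal_sum] at h1
    exact (RCLike.ofReal_injective (K := ℂ) h1).symm
  rw [hdet]
  refine (prod_le_arith_mean_pow hpos.eigenvalues_nonneg).trans ?_
  rcases Nat.eq_zero_or_pos n with rfl | hn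
  · simp
  have hn0 : (0 : ℝ) < n := by exact_mod_cast hn
  refine pow_le_pow_left₀ (div_nonneg (Finset.sum_nonneg fun i _ =>
    hpos.eigenvalues_nonneg i) hn0.le) ?_ n
  rw [htr, div_le_iff₀ hn0]
  have h3 : ∑ j : Fin n, ∑ i : Fin n, ‖A i j‖ ^ 2 ≤ ∑ _j : Fin n, ∑ _i : Fin n, B ^ 2 :=
    Finset.sum_le_sum fun j _ => Finset.sum_le_sum fun i _ =>
      pow_le_pow_left₀ (norm_nonneg _) (hA i j) 2
  refine h3.trans_eq ?_
  simp
  ring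

/-- A weak form of Hadamard's inequality. -/
theorem norm_det_le {n : ℕ} {B : ℝ} (hB : 0 ≤ B) (A : Matrix (Fin n) (Fin n) ℂ)
    (hA : ∀ i j, ‖A i j‖ ≤ B) : ‖A.det‖ ≤ (2 * B) ^ n * √(n.factorial) := by
  refine le_of_sq_le_sq ((norm_det_sq_le A hA).trans ?_) (by positivity)
  rw [mul_pow _ (√_), Real.sq_sqrt (by positivity), mul_pow, mul_pow]
  -- From `n^n ≤ e^n n!` and `e < 4` the bound `n^(n/2)` becomes `2^n √(n!)`, which against `1 / n!`
  -- leaves a convergent series.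
  have h1 := Real.pow_div_factorial_le_exp n n.cast_nonneg n
  rw [div_le_iff₀ (by positivity)] at h1
  have h2 : Real.exp n ≤ (2 ^ n) ^ 2 := by
    rw [← pow_mul, mul_comm, pow_mul, ← Real.exp_one_pow]
    exact pow_le_pow_left₀ (Real.exp_pos _).le (by linarith [Real.exp_one_lt_d9]) n
  have h3 : (0 : ℝ) ≤ n.factorial := by positivity
  calc (n : ℝ) ^ n * (B ^ 2) ^ n ≤ ((2 ^ n) ^ 2 * n.factorial) * (B ^ 2) ^ n :=
        mul_le_mul_of_nonneg_right (h1.trans (mul_le_mul_of_nonneg_right h2 h3)) (by positivity)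
    _ = _ := by ring

theorem summable_pow_div_sqrt_factorial (C : ℝ) :
    Summable fun n : ℕ => C ^ n / √(n.factorial) := by
  rcases eq_or_ne C 0 with rfl | hC
  · refine summable_of_ne_finset_zero (s := {0}) fun n hn => ?_
    have : n ≠ 0 := by simpa using hn
    simp [this]
  refine summable_of_ratio_test_tendsto_lt_one (l := 0) one_pos
    (Eventually.of_forall fun n => ?_) ?_
  · have : √(n.factorial : ℝ) ≠ 0 := (Real.sqrt_pos.2 (by positivity)).ne'
    positivity
  · have h1 : ∀ n : ℕ, ‖C ^ (n + 1) / √((n + 1).factorial)‖ / ‖C ^ n / √(n.factorial)‖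
        = |C| / √((n : ℝ) + 1) := by
      intro n
      have h2 : √(n.factorial : ℝ) ≠ 0 := (Real.sqrt_pos.2 (by positivity)).ne'
      have h3 : √((n : ℝ) + 1) ≠ 0 := (Real.sqrt_pos.2 (by positivity)).ne'
      have h4 : |C| ≠ 0 := abs_ne_zero.2 hC
      rw [Nat.factorial_succ]
      push_cast
      rw [Real.sqrt_mul (by positivity), norm_div, norm_div, norm_pow, norm_pow, Real.norm_eq_abs,
        Real.norm_of_nonneg (by positivity), Real.norm_of_nonneg (by positivity)]
      field_simp
      ring
    simp only [h1]
    have h5 : Tendsto (fun n : ℕ => √((n : ℝ) + 1)) atTop atTop :=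
      Real.tendsto_sqrt_atTop.comp (tendsto_atTop_add_const_right _ 1 tendsto_natCast_atTop_atTop)
    exact h5.const_div_atTop _

end Hadamard

/-! ### Fredholm determinants and minors -/

section Fredholm

/-- The determinant with entries `K(x_i, y_j)`. -/
noncomputable def kernelDet (K : ℝ → ℝ → ℂ) {n : ℕ} (x y : Fin n → ℝ) : ℂ :=
  (Matrix.of fun i j => K (x i) (y j)).det

theorem kernelDet_swap (K : ℝ → ℝ → ℂ) {n : ℕ} (x y : Fin n → ℝ) :
    kernelDet (fun s t => K t s) x y = kernelDet K y x := by
  rw [kernelDet, kernelDet, ← Matrix.det_transpose]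
  rfl

/-- Moving row `i` to the front is a cycle of sign `(-1)^i`. If the column moves as well, as in the
next lemma, the signs cancel. -/
theorem kernelDet_insertNth_left (K : ℝ → ℝ → ℂ) {n : ℕ} (i : Fin (n + 1)) (v : ℝ)
    (z : Fin n → ℝ) (u : Fin (n + 1) → ℝ) :
    kernelDet K (i.insertNth (α := fun _ => ℝ) v z) u
      = (-1) ^ i.val * kernelDet K (Fin.cons (α := fun _ => ℝ) v z) u := by
  have h := Matrix.det_permute i.cycleRange.symm
    (Matrix.of fun r c => K (i.insertNth (α := fun _ => ℝ) v z r) (u c))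
  have h1 : (Matrix.of fun r c => K (i.insertNth (α := fun _ => ℝ) v z r) (u c)).submatrix
      i.cycleRange.symm id = Matrix.of fun r c => K (Fin.cons (α := fun _ => ℝ) v z r) (u c) := by
    ext r c
    simp [Fin.insertNth_apply_cycleRange_symm]
  rw [h1, Equiv.Perm.sign_symm, Fin.sign_cycleRange] at h
  rw [kernelDet, kernelDet, h]
  push_cast
  rw [← mul_assoc, ← pow_add, ← two_mul, pow_mul]
  simp

theorem kernelDet_insertNth_self (K : ℝ → ℝ → ℂ) {n : ℕ} (i : Fin (n + 1)) (v : ℝ)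
    (z : Fin n → ℝ) :
    kernelDet K (i.insertNth (α := fun _ => ℝ) v z) (i.insertNth (α := fun _ => ℝ) v z)
      = kernelDet K (Fin.cons (α := fun _ => ℝ) v z) (Fin.cons (α := fun _ => ℝ) v z) := by
  have h := Matrix.det_submatrix_equiv_self i.cycleRange.symm
    (Matrix.of fun r c => K (i.insertNth (α := fun _ => ℝ) v z r)
      (i.insertNth (α := fun _ => ℝ) v z c))
  rw [kernelDet, ← h, kernelDet]
  congr 1
  ext r c
  simp [Fin.insertNth_apply_cycleRange_symm]

/-- The expansion of a bordered determinant along its first row. -/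
theorem kernelDet_cons_cons (K : ℝ → ℝ → ℂ) {n : ℕ} (x y : ℝ) (z : Fin (n + 1) → ℝ) :
    kernelDet K (Fin.cons (α := fun _ => ℝ) x z) (Fin.cons (α := fun _ => ℝ) y z)
      = K x y * kernelDet K z z + ∑ i : Fin (n + 1), (-1) ^ (i.val + 1) * K x (z i) *
          kernelDet K z (Fin.cons (α := fun _ => ℝ) y (fun r => z (i.succAbove r))) := by
  rw [kernelDet, Matrix.det_succ_row_zero, Fin.sum_univ_succ]
  congr 1
  · simp only [Fin.val_zero, pow_zero, one_mul, Matrix.of_apply, Fin.cons_zero]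
    congr 1
  · refine Finset.sum_congr rfl fun i _ => ?_
    simp only [Fin.val_succ, Matrix.of_apply, Fin.cons_zero, Fin.cons_succ]
    congr 1
    rw [kernelDet]
    congr 1
    ext r c
    simp only [Matrix.submatrix_apply, Matrix.of_apply, Fin.cons_succ]
    induction c using Fin.cases with
    | zero => simp
    | succ c => simp [Fin.succ_succAbove_succ]

/-- Bounded continuous kernels. -/
structure BoundedKernel (K : ℝ → ℝ → ℂ) (B : ℝ) : Prop where
  cont : Continuous (Function.uncurry K)
  bound : ∀ x y, ‖K x y‖ ≤ B

theorem BoundedKernel.swap {K : ℝ → ℝ → ℂ} {B : ℝ} (hK : BoundedKernel K B) :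
    BoundedKernel (fun x y => K y x) B :=
  ⟨hK.cont.comp continuous_swap, fun x y => hK.bound y x⟩

theorem BoundedKernel.nonneg {K : ℝ → ℝ → ℂ} {B : ℝ} (hK : BoundedKernel K B) : 0 ≤ B :=
  (norm_nonneg _).trans (hK.bound 0 0)

/-- Measurable weights of modulus at most one. -/
structure IsWeight (w : ℝ → ℂ) : Prop where
  meas : Measurable w
  bound : ∀ x, ‖w x‖ ≤ 1

variable (μ : Measure ℝ) (K : ℝ → ℝ → ℂ) (w : ℝ → ℂ)

/-- The coefficient of order `n` of the Fredholm determinant of the kernel `K(x,y) w(y)`. -/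
noncomputable def fredholmCoeff (n : ℕ) : ℂ :=
  ∫ z : Fin n → ℝ, (∏ i, w (z i)) * kernelDet K z z ∂(Measure.pi fun _ => μ)

/-- The coefficient of order `n` of the first Fredholm minor. -/
noncomputable def minorCoeff (n : ℕ) (x y : ℝ) : ℂ :=
  ∫ z : Fin n → ℝ, (∏ i, w (z i)) * kernelDet K (Fin.cons (α := fun _ => ℝ) x z)
    (Fin.cons (α := fun _ => ℝ) y z) ∂(Measure.pi fun _ => μ)

/-- The Fredholm series. -/
noncomputable def fredholmSum : ℂ :=
  ∑' n : ℕ, (-1) ^ n / (n.factorial : ℂ) * fredholmCoeff μ K w n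

/-- The first Fredholm minor. -/
noncomputable def fredholmMinor (x y : ℝ) : ℂ :=
  ∑' n : ℕ, (-1) ^ n / (n.factorial : ℂ) * minorCoeff μ K w n x y

variable {μ K w} {B : ℝ}

theorem BoundedKernel.norm_kernelDet_le (hK : BoundedKernel K B) {n : ℕ} (x y : Fin n → ℝ) :
    ‖kernelDet K x y‖ ≤ (2 * B) ^ n * √(n.factorial) :=
  norm_det_le hK.nonneg _ fun _ _ => hK.bound _ _

theorem IsWeight.norm_prod_le (hw : IsWeight w) {n : ℕ} (z : Fin n → ℝ) : ‖∏ i, w (z i)‖ ≤ 1 := by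
  rw [norm_prod]
  exact Finset.prod_le_one (fun _ _ => norm_nonneg _) fun _ _ => hw.bound _

theorem IsWeight.measurable_prod (hw : IsWeight w) (n : ℕ) :
    Measurable fun z : Fin n → ℝ => ∏ i, w (z i) :=
  Finset.measurable_prod _ fun i _ => hw.meas.comp (measurable_pi_apply i)

theorem BoundedKernel.continuous_kernelDet (hK : BoundedKernel K B) {X : Type*}
    [TopologicalSpace X] {n : ℕ} {f g : X → Fin n → ℝ} (hf : Continuous f) (hg : Continuous g) :
    Continuous fun p => kernelDet K (f p) (g p) := by
  refine Continuous.matrix_det (continuous_matrix fun i j => ?_)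
  exact hK.cont.comp ((continuous_pi_iff.1 hf i).prodMk (continuous_pi_iff.1 hg j))

theorem minorCoeff_swap (n : ℕ) (x y : ℝ) :
    minorCoeff μ (fun s t => K t s) w n x y = minorCoeff μ K w n y x := by
  simp only [minorCoeff, kernelDet_swap]

theorem fredholmCoeff_swap (n : ℕ) :
    fredholmCoeff μ (fun s t => K t s) w n = fredholmCoeff μ K w n := by
  simp only [fredholmCoeff, kernelDet_swap]

theorem fredholmMinor_swap (x y : ℝ) :
    fredholmMinor μ (fun s t => K t s) w x y = fredholmMinor μ K w y x := by
  simp only [fredholmMinor, minorCoeff_swap]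

theorem fredholmSum_swap : fredholmSum μ (fun s t => K t s) w = fredholmSum μ K w := by
  simp only [fredholmSum, fredholmCoeff_swap]

variable [IsFiniteMeasure μ]

theorem integrable_weight_mul (hw : IsWeight w) {n : ℕ} {F : (Fin n → ℝ) → ℂ}
    (hF : Continuous F) {C : ℝ} (hC : ∀ z, ‖F z‖ ≤ C) :
    Integrable (fun z : Fin n → ℝ => (∏ i, w (z i)) * F z) (Measure.pi fun _ => μ) := by
  refine Integrable.of_bound ((hw.measurable_prod n).mul hF.measurable).aestronglyMeasurable C
    (ae_of_all _ fun z => ?_)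
  rw [norm_mul]
  exact (mul_le_of_le_one_left (norm_nonneg _) (hw.norm_prod_le z)).trans (hC z)

theorem measureReal_pi_univ (n : ℕ) :
    (Measure.pi fun _ : Fin n => μ).real univ = μ.real univ ^ n := by
  simp [Measure.real, Measure.pi_univ]

theorem norm_integral_weight_mul_le (hw : IsWeight w) {n : ℕ} {F : (Fin n → ℝ) → ℂ} {C : ℝ}
    (hC : ∀ z, ‖F z‖ ≤ C) :
    ‖∫ z : Fin n → ℝ, (∏ i, w (z i)) * F z ∂(Measure.pi fun _ => μ)‖ ≤ C * μ.real univ ^ n := by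
  rw [← measureReal_pi_univ]
  refine norm_integral_le_of_norm_le_const (ae_of_all _ fun z => ?_)
  rw [norm_mul]
  exact (mul_le_of_le_one_left (norm_nonneg _) (hw.norm_prod_le z)).trans (hC z)

theorem integral_pi_succ {n : ℕ} (i : Fin (n + 1)) {F : (Fin (n + 1) → ℝ) → ℂ}
    (hF : Integrable F (Measure.pi fun _ => μ)) :
    ∫ z, F z ∂(Measure.pi fun _ => μ)
      = ∫ v, ∫ z : Fin n → ℝ, F (i.insertNth (α := fun _ => ℝ) v z) ∂(Measure.pi fun _ => μ) ∂μ := by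
  have hmp := (measurePreserving_piFinSuccAbove (fun _ : Fin (n + 1) => μ) i).symm
  rw [← hmp.integral_comp' F, integral_prod]
  · rfl
  · exact hmp.integrable_comp_of_integrable hF

theorem prod_insertNth {n : ℕ} (w : ℝ → ℂ) (i : Fin (n + 1)) (v : ℝ) (z : Fin n → ℝ) :
    ∏ r, w (i.insertNth (α := fun _ => ℝ) v z r) = w v * ∏ r, w (z r) := by
  rw [Fin.prod_univ_succAbove _ i]
  simp

theorem minorCoeff_zero (x y : ℝ) : minorCoeff μ K w 0 x y = K x y := by
  simp [minorCoeff, kernelDet, measureReal_pi_univ]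

theorem fredholmCoeff_zero : fredholmCoeff μ K w 0 = 1 := by
  simp [fredholmCoeff, kernelDet, measureReal_pi_univ]

/-- Expand the bordered determinant along its first row. Once `z_i` is singled out as `v` and its
row moved to the front, the signs combine to `(-1)^(i+1) (-1)^i = -1`, so the `n + 1` border terms
contribute equally. Fredholm's identities are the generating form of this recursion. -/
theorem minorCoeff_succ (hK : BoundedKernel K B) (hw : IsWeight w) (n : ℕ) (x y : ℝ) :
    minorCoeff μ K w (n + 1) x y = K x y * fredholmCoeff μ K w (n + 1)
      - (n + 1) * ∫ v, w v * K x v * minorCoeff μ K w n v y ∂μ := by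
  have hcons : Continuous fun z : Fin n → ℝ => (Fin.cons (α := fun _ => ℝ) y z : Fin (n + 1) → ℝ) :=
    by fun_prop
  have hterm : ∀ i : Fin (n + 1), Integrable (fun z : Fin (n + 1) → ℝ => (∏ r, w (z r)) *
      ((-1) ^ (i.val + 1) * K x (z i) *
        kernelDet K z (Fin.cons (α := fun _ => ℝ) y (fun r => z (i.succAbove r)))))
      (Measure.pi fun _ => μ) := by
    intro i
    refine integrable_weight_mul hw ?_ (C := B * ((2 * B) ^ (n + 1) * √((n + 1).factorial)))
      fun z => ?_
    · refine (continuous_const.mul (hK.cont.comp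
        (continuous_const.prodMk (continuous_apply i)))).mul ?_
      exact hK.continuous_kernelDet continuous_id (hcons.comp (by fun_prop))
    · rw [norm_mul, norm_mul, norm_pow, norm_neg, norm_one, one_pow, one_mul]
      exact mul_le_mul (hK.bound _ _) (hK.norm_kernelDet_le _ _) (norm_nonneg _) hK.nonneg
  have hmain : Integrable (fun z : Fin (n + 1) → ℝ => (∏ r, w (z r)) * (K x y * kernelDet K z z))
      (Measure.pi fun _ => μ) := by
    refine integrable_weight_mul hw ?_ (C := B * ((2 * B) ^ (n + 1) * √((n + 1).factorial)))
      fun z => ?_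
    · exact continuous_const.mul (hK.continuous_kernelDet continuous_id continuous_id)
    · rw [norm_mul]
      exact mul_le_mul (hK.bound _ _) (hK.norm_kernelDet_le _ _) (norm_nonneg _) hK.nonneg
  have hval : ∀ i : Fin (n + 1), ∫ z : Fin (n + 1) → ℝ, (∏ r, w (z r)) *
      ((-1) ^ (i.val + 1) * K x (z i) *
        kernelDet K z (Fin.cons (α := fun _ => ℝ) y (fun r => z (i.succAbove r))))
      ∂(Measure.pi fun _ => μ) = -∫ v, w v * K x v * minorCoeff μ K w n v y ∂μ := by
    intro i
    rw [integral_pi_succ i (hterm i), ← integral_neg]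
    refine integral_congr_ae (ae_of_all _ fun v => ?_)
    simp only [minorCoeff]
    rw [← integral_const_mul, ← integral_neg]
    refine integral_congr_ae (ae_of_all _ fun z => ?_)
    simp only [prod_insertNth, Fin.insertNth_apply_same, Fin.insertNth_apply_succAbove,
      kernelDet_insertNth_left]
    have h1 : ((-1 : ℂ)) ^ (i.val + 1) * (-1) ^ i.val = -1 := by
      rw [← pow_add, show i.val + 1 + i.val = 2 * i.val + 1 by ring, pow_succ, pow_mul]; simp
    linear_combination (w v * K x v * (∏ r, w (z r)) * kernelDet K
      (Fin.cons (α := fun _ => ℝ) v z) (Fin.cons (α := fun _ => ℝ) y z)) * h1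
  rw [minorCoeff]
  simp only [kernelDet_cons_cons, mul_add, Finset.mul_sum]
  rw [integral_add hmain (integrable_finsetSum _ fun i _ => hterm i),
    integral_finsetSum _ fun i _ => hterm i]
  simp only [hval, Finset.sum_const, Finset.card_univ, Fintype.card_fin, nsmul_eq_mul]
  rw [fredholmCoeff, ← integral_const_mul]
  push_cast
  rw [show (fun z : Fin (n + 1) → ℝ => (∏ r, w (z r)) * (K x y * kernelDet K z z))
    = fun z => K x y * ((∏ r, w (z r)) * kernelDet K z z) from funext fun z => by ring]
  ring

theorem continuous_minorCoeff (hK : BoundedKernel K B) (hw : IsWeight w) (n : ℕ) :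
    Continuous (Function.uncurry (minorCoeff μ K w n)) := by
  refine continuous_of_dominated (F := fun (p : ℝ × ℝ) (z : Fin n → ℝ) => (∏ i, w (z i)) *
    kernelDet K (Fin.cons (α := fun _ => ℝ) p.1 z) (Fin.cons (α := fun _ => ℝ) p.2 z))
    (bound := fun _ => (2 * B) ^ (n + 1) * √((n + 1).factorial)) (fun p => ?_) (fun p => ?_)
    (integrable_const _) (ae_of_all _ fun z => ?_)
  · exact ((hw.measurable_prod n).mul (hK.continuous_kernelDet (by fun_prop)
      (by fun_prop)).measurable).aestronglyMeasurable
  · refine ae_of_all _ fun z => ?_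
    rw [norm_mul]
    exact (mul_le_of_le_one_left (norm_nonneg _) (hw.norm_prod_le z)).trans
      (hK.norm_kernelDet_le _ _)
  · exact continuous_const.mul (hK.continuous_kernelDet (by fun_prop) (by fun_prop))

theorem norm_neg_one_pow_div_factorial (n : ℕ) :
    ‖(-1 : ℂ) ^ n / (n.factorial : ℂ)‖ = (n.factorial : ℝ)⁻¹ := by
  rw [norm_div, norm_pow, norm_neg, norm_one, one_pow, Complex.norm_natCast, one_div]

theorem sqrt_factorial_mul_inv (n : ℕ) :
    √(n.factorial : ℝ) * (n.factorial : ℝ)⁻¹ = (√(n.factorial : ℝ))⁻¹ := by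
  rw [← div_eq_mul_inv, Real.sqrt_div_self]

theorem norm_fredholm_term_le (hK : BoundedKernel K B) (hw : IsWeight w) (n : ℕ) :
    ‖(-1) ^ n / (n.factorial : ℂ) * fredholmCoeff μ K w n‖
      ≤ (2 * B * μ.real univ) ^ n / √(n.factorial) := by
  rw [norm_mul, norm_neg_one_pow_div_factorial]
  have h := norm_integral_weight_mul_le (μ := μ) hw (F := fun z : Fin n → ℝ => kernelDet K z z)
    fun z => hK.norm_kernelDet_le z z
  refine (mul_le_mul_of_nonneg_left h (by positivity)).trans_eq ?_
  rw [mul_pow, div_eq_mul_inv, ← sqrt_factorial_mul_inv]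
  ring

/-- The bordered determinant has order `n + 1` but is divided by `n!` only; `√((n+1)!) ≤ 2^n √(n!)`
accounts for the additional factor `2` in the geometric term. -/
theorem norm_minor_term_le (hK : BoundedKernel K B) (hw : IsWeight w) (n : ℕ) (x y : ℝ) :
    ‖(-1) ^ n / (n.factorial : ℂ) * minorCoeff μ K w n x y‖
      ≤ 2 * B * ((2 * (2 * B * μ.real univ)) ^ n / √(n.factorial)) := by
  rw [norm_mul, norm_neg_one_pow_div_factorial]
  have h := norm_integral_weight_mul_le (μ := μ) hw (F := fun z : Fin n → ℝ => kernelDet K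
    (Fin.cons (α := fun _ => ℝ) x z) (Fin.cons (α := fun _ => ℝ) y z))
    fun z => hK.norm_kernelDet_le _ _
  refine (mul_le_mul_of_nonneg_left h (by positivity)).trans ?_
  have h1 : √((n + 1).factorial : ℝ) ≤ 2 ^ n * √(n.factorial : ℝ) := by
    rw [Nat.factorial_succ]
    push_cast
    rw [Real.sqrt_mul (by positivity)]
    refine mul_le_mul_of_nonneg_right ?_ (Real.sqrt_nonneg _)
    rw [Real.sqrt_le_left (by positivity)]
    have h2 : (n : ℝ) + 1 ≤ 2 ^ n := by exact_mod_cast Nat.lt_two_pow_self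
    exact h2.trans (le_self_pow₀ (one_le_pow₀ one_le_two) two_ne_zero)
  have hB := hK.nonneg
  calc (n.factorial : ℝ)⁻¹ * ((2 * B) ^ (n + 1) * √((n + 1).factorial) * μ.real univ ^ n)
      ≤ (n.factorial : ℝ)⁻¹ * ((2 * B) ^ (n + 1) * (2 ^ n * √(n.factorial : ℝ)) *
        μ.real univ ^ n) := by gcongr
    _ = _ := by
      rw [div_eq_mul_inv, ← sqrt_factorial_mul_inv, mul_pow 2 (2 * B * μ.real univ),
        mul_pow (2 * B) (μ.real univ), pow_succ (2 * B)]
      ring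

theorem summable_fredholm_term (hK : BoundedKernel K B) (hw : IsWeight w) :
    Summable fun n : ℕ => (-1) ^ n / (n.factorial : ℂ) * fredholmCoeff μ K w n :=
  Summable.of_norm_bounded (summable_pow_div_sqrt_factorial _)
    fun n => norm_fredholm_term_le hK hw n

theorem summable_minor_term (hK : BoundedKernel K B) (hw : IsWeight w) (x y : ℝ) :
    Summable fun n : ℕ => (-1) ^ n / (n.factorial : ℂ) * minorCoeff μ K w n x y :=
  Summable.of_norm_bounded ((summable_pow_div_sqrt_factorial _).mul_left _)
    fun n => norm_minor_term_le hK hw n x y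

/-- The series converges uniformly in both arguments. So the minor is again the kernel of an
operator on bounded continuous functions. -/
theorem boundedKernel_fredholmMinor (hK : BoundedKernel K B) (hw : IsWeight w) :
    ∃ C, BoundedKernel (fredholmMinor μ K w) C := by
  have hs := (summable_pow_div_sqrt_factorial (2 * (2 * B * μ.real univ))).mul_left (2 * B)
  refine ⟨∑' n : ℕ, 2 * B * ((2 * (2 * B * μ.real univ)) ^ n / √(n.factorial)), ?_, fun x y => ?_⟩
  · refine continuous_tsum (f := fun (n : ℕ) (p : ℝ × ℝ) => (-1) ^ n / (n.factorial : ℂ) *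
      minorCoeff μ K w n p.1 p.2) (fun n => ?_) hs fun n p => norm_minor_term_le hK hw n p.1 p.2
    exact continuous_const.mul (continuous_minorCoeff hK hw n)
  · exact tsum_of_norm_bounded hs.hasSum fun n => norm_minor_term_le hK hw n x y

/-- The first of Fredholm's identities. -/
theorem fredholmMinor_eq_left (hK : BoundedKernel K B) (hw : IsWeight w) (x y : ℝ) :
    fredholmMinor μ K w x y = fredholmSum μ K w * K x y
      + ∫ v, w v * K x v * fredholmMinor μ K w v y ∂μ := by
  set D : ℕ → ℝ → ℂ := fun n v => w v * K x v *
    ((-1) ^ n / (n.factorial : ℂ) * minorCoeff μ K w n v y) with hD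
  have hmeas : ∀ n, AEStronglyMeasurable (D n) μ := fun n => by
    refine Measurable.aestronglyMeasurable ?_
    exact (hw.meas.mul (hK.cont.comp (Continuous.prodMk_right x)).measurable).mul
      (measurable_const.mul ((continuous_minorCoeff hK hw n).comp
        (Continuous.prodMk_left y)).measurable)
  have hbound : ∀ n v, ‖D n v‖ ≤
      B * (2 * B * ((2 * (2 * B * μ.real univ)) ^ n / √(n.factorial))) := fun n v => by
    rw [hD]
    simp only
    rw [norm_mul]
    refine mul_le_mul ?_ (norm_minor_term_le hK hw n v y) (norm_nonneg _) hK.nonneg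
    rw [norm_mul]
    exact (mul_le_of_le_one_left (norm_nonneg _) (hw.bound v)).trans (hK.bound _ _)
  have hint : ∀ n, Integrable (D n) μ := fun n =>
    Integrable.of_bound (hmeas n) _ (ae_of_all _ (hbound n))
  have hsum : HasSum (fun n => ∫ v, D n v ∂μ) (∫ v, ∑' n, D n v ∂μ) := by
    refine hasSum_integral_of_summable_integral_norm hint ?_
    refine Summable.of_nonneg_of_le (fun n => integral_nonneg fun v => norm_nonneg _) (fun n => ?_)
      ((((summable_pow_div_sqrt_factorial (2 * (2 * B * μ.real univ))).mul_left (2 * B)).mul_left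
        B).mul_right (μ.real univ))
    have h1 := norm_integral_le_of_norm_le_const (μ := μ) (f := fun v => ‖D n v‖)
      (ae_of_all _ fun v => (norm_norm (D n v)).le.trans (hbound n v))
    exact (le_abs_self _).trans h1
  have h0 : ∀ v, ∑' n, D n v = w v * K x v * fredholmMinor μ K w v y := fun v => by
    rw [fredholmMinor, ← tsum_mul_left]
  simp only [h0] at hsum
  have hS := summable_fredholm_term (μ := μ) hK hw
  have hM := summable_minor_term (μ := μ) hK hw x y
  rw [← hsum.tsum_eq, fredholmMinor, hM.tsum_eq_zero_add, fredholmSum, hS.tsum_eq_zero_add,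
    minorCoeff_zero, fredholmCoeff_zero, add_mul, ← tsum_mul_right, add_assoc,
    ← Summable.tsum_add (((summable_nat_add_iff 1).2 hS).mul_right _) hsum.summable]
  congr 1
  · ring
  · refine tsum_congr fun n => ?_
    -- Terms of order `n + 1` are compared: `(n + 1) / (n + 1)! = 1 / n!`, and the change of sign of
    -- `(-1)^(n+1)` absorbs the minus of the recursion.
    rw [minorCoeff_succ hK hw]
    have h2 : ∫ v, D n v ∂μ = (-1) ^ n / (n.factorial : ℂ) *
        ∫ v, w v * K x v * minorCoeff μ K w n v y ∂μ := by
      rw [← integral_const_mul]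
      exact integral_congr_ae (ae_of_all _ fun v => by simp only [hD]; ring)
    rw [h2, Nat.factorial_succ]
    have h3 : (n.factorial : ℂ) ≠ 0 := by exact_mod_cast n.factorial_ne_zero
    have h4 : (n : ℂ) + 1 ≠ 0 := by exact_mod_cast n.succ_ne_zero
    push_cast
    field_simp
    ring

/-- The second of Fredholm's identities. -/
theorem fredholmMinor_eq_right (hK : BoundedKernel K B) (hw : IsWeight w) (x y : ℝ) :
    fredholmMinor μ K w x y = fredholmSum μ K w * K x y
      + ∫ v, fredholmMinor μ K w x v * (w v * K v y) ∂μ := by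
  have h := fredholmMinor_eq_left (μ := μ) hK.swap hw y x
  rw [fredholmMinor_swap, fredholmSum_swap] at h
  simp only [fredholmMinor_swap] at h
  rw [h]
  congr 1
  exact integral_congr_ae (ae_of_all _ fun v => by ring)

/-! ### The variation of the Fredholm determinant with the weight -/

/-- Taylor expansion of a product of numbers of modulus at most one, to first and second order. The
bounds are proved together because the induction for the second order uses the first order bound. -/
theorem norm_prod_add_sub_le {ι : Type*} [DecidableEq ι] (s : Finset ι) {a b : ι → ℂ}
    (ha : ∀ i, ‖a i‖ ≤ 1) (hab : ∀ i, ‖a i + b i‖ ≤ 1) :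
    ‖∏ i ∈ s, (a i + b i) - ∏ i ∈ s, a i‖ ≤ ∑ i ∈ s, ‖b i‖ ∧
    ‖∏ i ∈ s, (a i + b i) - ∏ i ∈ s, a i - ∑ i ∈ s, b i * ∏ j ∈ s.erase i, a j‖
      ≤ ∑ i ∈ s, ∑ j ∈ s.erase i, ‖b i‖ * ‖b j‖ := by
  induction s using Finset.induction_on with
  | empty => simp
  | insert k s hk ih =>
    obtain ⟨ih1, ih2⟩ := ih
    have hprod : ‖∏ i ∈ s, (a i + b i)‖ ≤ 1 := by
      rw [norm_prod]
      exact Finset.prod_le_one (fun _ _ => norm_nonneg _) fun i _ => hab i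
    have herase : ∀ i ∈ s, (insert k s).erase i = insert k (s.erase i) := fun i hi =>
      Finset.erase_insert_of_ne fun h => hk (h ▸ hi)
    have hkn : ∀ i, k ∉ s.erase i := fun i h => hk (Finset.mem_of_mem_erase h)
    refine ⟨?_, ?_⟩
    · rw [Finset.prod_insert hk, Finset.prod_insert hk, Finset.sum_insert hk]
      have h1 : (a k + b k) * ∏ i ∈ s, (a i + b i) - a k * ∏ i ∈ s, a i
          = b k * ∏ i ∈ s, (a i + b i) + a k * (∏ i ∈ s, (a i + b i) - ∏ i ∈ s, a i) := by ring
      rw [h1]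
      refine (norm_add_le _ _).trans (add_le_add ?_ ?_)
      · rw [norm_mul]; exact mul_le_of_le_one_right (norm_nonneg _) hprod
      · rw [norm_mul]; exact (mul_le_of_le_one_left (norm_nonneg _) (ha k)).trans ih1
    · rw [Finset.prod_insert hk, Finset.prod_insert hk, Finset.sum_insert hk,
        Finset.sum_insert hk, Finset.erase_insert hk]
      have h2 : ∑ i ∈ s, b i * ∏ j ∈ (insert k s).erase i, a j
          = a k * ∑ i ∈ s, b i * ∏ j ∈ s.erase i, a j := by
        rw [Finset.mul_sum]
        refine Finset.sum_congr rfl fun i hi => ?_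
        rw [herase i hi, Finset.prod_insert (hkn i)]
        ring
      have h3 : ∑ i ∈ s, ∑ j ∈ (insert k s).erase i, ‖b i‖ * ‖b j‖
          = ‖b k‖ * ∑ i ∈ s, ‖b i‖ + ∑ i ∈ s, ∑ j ∈ s.erase i, ‖b i‖ * ‖b j‖ := by
        rw [Finset.mul_sum, ← Finset.sum_add_distrib]
        refine Finset.sum_congr rfl fun i hi => ?_
        rw [herase i hi, Finset.sum_insert (hkn i)]
        ring
      rw [h2, h3]
      have h1 : (a k + b k) * ∏ i ∈ s, (a i + b i) - a k * ∏ i ∈ s, a i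
          - (b k * ∏ j ∈ s, a j + a k * ∑ i ∈ s, b i * ∏ j ∈ s.erase i, a j)
          = b k * (∏ i ∈ s, (a i + b i) - ∏ i ∈ s, a i)
            + a k * (∏ i ∈ s, (a i + b i) - ∏ i ∈ s, a i
              - ∑ i ∈ s, b i * ∏ j ∈ s.erase i, a j) := by ring
      rw [h1]
      have h4 : ‖b k * (∏ i ∈ s, (a i + b i) - ∏ i ∈ s, a i)‖ ≤ ‖b k‖ * ∑ i ∈ s, ‖b i‖ := by
        rw [norm_mul]; exact mul_le_mul_of_nonneg_left ih1 (norm_nonneg _)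
      have h5 : ‖a k * (∏ i ∈ s, (a i + b i) - ∏ i ∈ s, a i
              - ∑ i ∈ s, b i * ∏ j ∈ s.erase i, a j)‖
          ≤ ∑ i ∈ s, ∑ j ∈ s.erase i, ‖b i‖ * ‖b j‖ := by
        rw [norm_mul]; exact (mul_le_of_le_one_left (norm_nonneg _) (ha k)).trans ih2
      have h6 : 0 ≤ ∑ j ∈ s, ‖b k‖ * ‖b j‖ :=
        Finset.sum_nonneg fun _ _ => mul_nonneg (norm_nonneg _) (norm_nonneg _)
      calc _ ≤ _ := norm_add_le _ _
        _ ≤ ‖b k‖ * ∑ i ∈ s, ‖b i‖ + ∑ i ∈ s, ∑ j ∈ s.erase i, ‖b i‖ * ‖b j‖ :=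
          add_le_add h4 h5
        _ ≤ _ := by linarith

/-- Two coordinates contribute `∫ ‖v‖` each and every other one the total mass, at most `L`. Because
`L ≥ 1`, the number of the other coordinates may be replaced by `n`. -/
theorem integral_norm_mul_norm_le {v : ℝ → ℂ} {n : ℕ} {i j : Fin n}
    (hij : j ≠ i) {L : ℝ} (hL : μ.real univ ≤ L) (hL1 : 1 ≤ L) :
    ∫ z : Fin n → ℝ, ‖v (z i)‖ * ‖v (z j)‖ ∂(Measure.pi fun _ => μ)
      ≤ (∫ x, ‖v x‖ ∂μ) ^ 2 * L ^ n := by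
  classical
  have h1 : ∀ z : Fin n → ℝ, ‖v (z i)‖ * ‖v (z j)‖
      = ∏ k, (if k = i ∨ k = j then fun x => ‖v x‖ else fun _ => (1 : ℝ)) (z k) := by
    intro z
    have h2 : ∏ k, (if k = i ∨ k = j then fun x => ‖v x‖ else fun _ => (1 : ℝ)) (z k)
        = ∏ k ∈ {i, j}, ‖v (z k)‖ := by
      rw [← Finset.prod_subset (Finset.subset_univ {i, j})]
      · refine Finset.prod_congr rfl fun k hk => ?_
        rw [if_pos (by simpa using hk)]
      · intro k _ hk
        rw [if_neg (by simpa using hk)]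
    rw [h2, Finset.prod_pair hij.symm]
  simp only [h1]
  rw [integral_fintype_prod_eq_prod (𝕜 := ℝ)
    (fun k => if k = i ∨ k = j then fun x => ‖v x‖ else fun _ => (1 : ℝ))]
  rw [← Finset.prod_mul_prod_compl ({i, j} : Finset (Fin n)), Finset.prod_pair hij.symm]
  have hI : (0 : ℝ) ≤ ∫ x, ‖v x‖ ∂μ := integral_nonneg fun _ => norm_nonneg _
  have h3 : ∏ k ∈ ({i, j} : Finset (Fin n))ᶜ,
      ∫ x, (if k = i ∨ k = j then fun x => ‖v x‖ else fun _ => (1 : ℝ)) x ∂μ ≤ L ^ n := by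
    rw [Finset.prod_congr rfl (g := fun _ => μ.real univ) fun k hk => by
      rw [if_neg (by simpa using hk)]; simp]
    rw [Finset.prod_const]
    exact (pow_le_pow_left₀ measureReal_nonneg hL _).trans
      (pow_le_pow_right₀ hL1 ((Finset.card_le_univ _).trans_eq (by simp)))
  simp only [true_or, or_true, if_true]
  rw [sq]
  exact mul_le_mul_of_nonneg_left h3 (mul_nonneg hI hI)

/-- Expand the product of the weights. The linear terms give `n + 1` equal integrals by symmetry of
the determinant; the remainder is controlled by at most `(n + 1)²` pairs of coordinates. -/
theorem norm_fredholmCoeff_sub_le (hK : BoundedKernel K B) (hw : IsWeight w) {v : ℝ → ℂ}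
    (hv : IsWeight v) (hwv : IsWeight (fun x => w x + v x)) {L : ℝ} (hL : μ.real univ ≤ L)
    (hL1 : 1 ≤ L) (n : ℕ) :
    ‖fredholmCoeff μ K (fun x => w x + v x) (n + 1) - fredholmCoeff μ K w (n + 1)
        - (n + 1) * ∫ x, v x * minorCoeff μ K w n x x ∂μ‖
      ≤ ((n : ℝ) + 1) ^ 2 * ((∫ x, ‖v x‖ ∂μ) ^ 2 * L ^ (n + 1)) *
        ((2 * B) ^ (n + 1) * √((n + 1).factorial)) := by
  classical
  set C : ℝ := (2 * B) ^ (n + 1) * √((n + 1).factorial) with hC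
  have hC0 : 0 ≤ C := (norm_nonneg _).trans (hK.norm_kernelDet_le (n := n + 1) 0 0)
  have hdet : Continuous fun z : Fin (n + 1) → ℝ => kernelDet K z z :=
    hK.continuous_kernelDet continuous_id continuous_id
  have hbd : ∀ z : Fin (n + 1) → ℝ, ‖kernelDet K z z‖ ≤ C := fun z => hK.norm_kernelDet_le z z
  have hterm : ∀ i : Fin (n + 1), Integrable (fun z : Fin (n + 1) → ℝ =>
      v (z i) * (∏ j ∈ Finset.univ.erase i, w (z j)) * kernelDet K z z)
      (Measure.pi fun _ => μ) := by
    intro i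
    refine Integrable.of_bound (Measurable.aestronglyMeasurable ?_) C (ae_of_all _ fun z => ?_)
    · exact ((hv.meas.comp (measurable_pi_apply i)).mul (Finset.measurable_prod _ fun j _ =>
        hw.meas.comp (measurable_pi_apply j))).mul hdet.measurable
    · rw [norm_mul, norm_mul, norm_prod]
      refine (mul_le_of_le_one_left (norm_nonneg _) ?_).trans (hbd z)
      exact mul_le_one₀ (hv.bound _) (Finset.prod_nonneg fun _ _ => norm_nonneg _)
        (Finset.prod_le_one (fun _ _ => norm_nonneg _) fun _ _ => hw.bound _)
  have hval : ∀ i : Fin (n + 1), ∫ z : Fin (n + 1) → ℝ,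
      v (z i) * (∏ j ∈ Finset.univ.erase i, w (z j)) * kernelDet K z z ∂(Measure.pi fun _ => μ)
      = ∫ x, v x * minorCoeff μ K w n x x ∂μ := by
    intro i
    rw [integral_pi_succ i (hterm i)]
    refine integral_congr_ae (ae_of_all _ fun x => ?_)
    simp only [minorCoeff]
    rw [← integral_const_mul]
    refine integral_congr_ae (ae_of_all _ fun z => ?_)
    have h1 : ∏ j ∈ Finset.univ.erase i, w (i.insertNth (α := fun _ => ℝ) x z j)
        = ∏ j, w (z j) := by
      rw [show (Finset.univ.erase i : Finset (Fin (n + 1))) = Finset.univ.map i.succAboveEmb by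
        ext k; simp [Fin.exists_succAbove_eq_iff], Finset.prod_map]
      simp
    simp only [kernelDet_insertNth_self, Fin.insertNth_apply_same, h1]
    ring
  have hi1 := integrable_weight_mul (μ := μ) hwv hdet hbd
  have hi2 := integrable_weight_mul (μ := μ) hw hdet hbd
  have hi3 : Integrable (fun z : Fin (n + 1) → ℝ => ∑ i : Fin (n + 1),
      v (z i) * (∏ j ∈ Finset.univ.erase i, w (z j)) * kernelDet K z z)
      (Measure.pi fun _ => μ) := integrable_finsetSum _ fun i _ => hterm i
  have hsum : ∫ z : Fin (n + 1) → ℝ, ∑ i : Fin (n + 1),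
      v (z i) * (∏ j ∈ Finset.univ.erase i, w (z j)) * kernelDet K z z ∂(Measure.pi fun _ => μ)
      = (n + 1) * ∫ x, v x * minorCoeff μ K w n x x ∂μ := by
    rw [integral_finsetSum _ fun i _ => hterm i]
    simp [hval]
  have hdiff : ∫ z : Fin (n + 1) → ℝ, ((∏ i, (w (z i) + v (z i))) * kernelDet K z z
      - (∏ i, w (z i)) * kernelDet K z z
      - ∑ i, v (z i) * (∏ j ∈ Finset.univ.erase i, w (z j)) * kernelDet K z z)
      ∂(Measure.pi fun _ => μ) = _ :=
    (integral_sub (hi1.sub hi2) hi3).trans (congrArg (· - _) (integral_sub hi1 hi2))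
  rw [fredholmCoeff, fredholmCoeff, ← hsum, ← hdiff]
  have hpair : ∀ i j : Fin (n + 1), Integrable (fun z : Fin (n + 1) → ℝ => ‖v (z i)‖ * ‖v (z j)‖)
      (Measure.pi fun _ => μ) := by
    intro i j
    refine Integrable.of_bound (Measurable.aestronglyMeasurable ?_) 1 (ae_of_all _ fun z => ?_)
    · exact (hv.meas.comp (measurable_pi_apply i)).norm.mul
        (hv.meas.comp (measurable_pi_apply j)).norm
    · rw [norm_mul, norm_norm, norm_norm]
      exact mul_le_one₀ (hv.bound _) (norm_nonneg _) (hv.bound _)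
  refine (norm_integral_le_of_norm_le (g := fun z : Fin (n + 1) → ℝ =>
    (∑ i, ∑ j ∈ Finset.univ.erase i, ‖v (z i)‖ * ‖v (z j)‖) * C) ?_ (ae_of_all _ fun z => ?_)).trans
      ?_
  · exact (integrable_finsetSum _ fun i _ => integrable_finsetSum _ fun j _ =>
      hpair i j).mul_const _
  · have h1 := (norm_prod_add_sub_le Finset.univ (a := fun i => w (z i)) (b := fun i => v (z i))
      (fun i => hw.bound _) (fun i => hwv.bound _)).2
    have h2 : (∏ i, (w (z i) + v (z i))) * kernelDet K z z - (∏ i, w (z i)) * kernelDet K z z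
        - ∑ i, v (z i) * (∏ j ∈ Finset.univ.erase i, w (z j)) * kernelDet K z z
        = (∏ i, (w (z i) + v (z i)) - ∏ i, w (z i)
          - ∑ i, v (z i) * ∏ j ∈ Finset.univ.erase i, w (z j)) * kernelDet K z z := by
      rw [sub_mul, sub_mul, Finset.sum_mul]
    rw [h2, norm_mul]
    exact mul_le_mul h1 (hbd z) (norm_nonneg _) ((norm_nonneg _).trans h1)
  · rw [integral_mul_const]
    refine mul_le_mul_of_nonneg_right ?_ hC0
    rw [integral_finsetSum _ fun i _ => integrable_finsetSum _ fun j _ => hpair i j]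
    set T := (∫ x, ‖v x‖ ∂μ) ^ 2 * L ^ (n + 1) with hT
    have hT0 : 0 ≤ T := by positivity
    have h3 : ∀ i : Fin (n + 1), ∫ z : Fin (n + 1) → ℝ, ∑ j ∈ Finset.univ.erase i,
        ‖v (z i)‖ * ‖v (z j)‖ ∂(Measure.pi fun _ => μ) ≤ ((n : ℝ) + 1) * T := by
      intro i
      rw [integral_finsetSum _ fun j _ => hpair i j]
      refine (Finset.sum_le_sum fun j hj => integral_norm_mul_norm_le
        (Finset.ne_of_mem_erase hj) hL hL1).trans ?_
      rw [Finset.sum_const, nsmul_eq_mul]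
      refine mul_le_mul_of_nonneg_right ?_ hT0
      have : (Finset.univ.erase i : Finset (Fin (n + 1))).card ≤ n + 1 :=
        (Finset.card_le_univ _).trans_eq (by simp)
      exact_mod_cast this
    refine (Finset.sum_le_sum fun i _ => h3 i).trans_eq ?_
    simp
    ring

/-- The derivative of the determinant in the direction `v` is minus the integral of `v` against the
diagonal of the minor. The constant does not depend on the weights, so it serves for all
displacements of an end point at once. -/
theorem norm_fredholmSum_sub_le (μ : Measure ℝ) [IsFiniteMeasure μ] (hK : BoundedKernel K B) :
    ∃ C, ∀ w v : ℝ → ℂ, IsWeight w → IsWeight v → IsWeight (fun x => w x + v x) →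
      ‖fredholmSum μ K (fun x => w x + v x) - fredholmSum μ K w
        + ∫ x, v x * fredholmMinor μ K w x x ∂μ‖ ≤ C * (∫ x, ‖v x‖ ∂μ) ^ 2 := by
  set L : ℝ := max (μ.real univ) 1 with hL
  have hL1 : 1 ≤ L := le_max_right _ _
  have hB := hK.nonneg
  have hs := (summable_nat_add_iff 1).2 (summable_pow_div_sqrt_factorial (4 * (2 * B * L)))
  refine ⟨∑' n : ℕ, (4 * (2 * B * L)) ^ (n + 1) / √((n + 1).factorial), fun w v hw hv hwv => ?_⟩
  have hcont : ∀ n, Continuous fun x => minorCoeff μ K w n x x := fun n =>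
    (continuous_minorCoeff hK hw n).comp (continuous_id.prodMk continuous_id)
  set D : ℕ → ℝ → ℂ := fun n x => v x *
    ((-1) ^ n / (n.factorial : ℂ) * minorCoeff μ K w n x x) with hD
  have hbound : ∀ n x, ‖D n x‖ ≤ 2 * B * ((2 * (2 * B * μ.real univ)) ^ n / √(n.factorial)) :=
    fun n x => by
      rw [hD]
      simp only
      rw [norm_mul]
      exact (mul_le_of_le_one_left (norm_nonneg _) (hv.bound x)).trans
        (norm_minor_term_le hK hw n x x)
  have hint : ∀ n, Integrable (D n) μ := fun n =>
    Integrable.of_bound (hv.meas.mul (measurable_const.mul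
      (hcont n).measurable)).aestronglyMeasurable _ (ae_of_all _ (hbound n))
  have hsum : HasSum (fun n => ∫ x, D n x ∂μ) (∫ x, ∑' n, D n x ∂μ) := by
    refine hasSum_integral_of_summable_integral_norm hint ?_
    refine Summable.of_nonneg_of_le (fun n => integral_nonneg fun x => norm_nonneg _) (fun n => ?_)
      (((summable_pow_div_sqrt_factorial (2 * (2 * B * μ.real univ))).mul_left (2 * B)).mul_right
        (μ.real univ))
    have h1 := norm_integral_le_of_norm_le_const (μ := μ) (f := fun x => ‖D n x‖)
      (ae_of_all _ fun x => (norm_norm (D n x)).le.trans (hbound n x))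
    exact (le_abs_self _).trans h1
  have h0 : ∀ x, ∑' n, D n x = v x * fredholmMinor μ K w x x := fun x => by
    rw [fredholmMinor, ← tsum_mul_left]
  simp only [h0] at hsum
  have hS := summable_fredholm_term (μ := μ) hK hw
  have hS' := summable_fredholm_term (μ := μ) hK hwv
  have hSn := (summable_nat_add_iff 1).2 hS
  have hSn' := (summable_nat_add_iff 1).2 hS'
  rw [← hsum.tsum_eq, fredholmSum, fredholmSum, hS.tsum_eq_zero_add, hS'.tsum_eq_zero_add,
    fredholmCoeff_zero, fredholmCoeff_zero, add_sub_add_left_eq_sub,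
    ← Summable.tsum_sub hSn' hSn, ← Summable.tsum_add (hSn'.sub hSn) hsum.summable,
    ← tsum_mul_right]
  refine tsum_of_norm_bounded (hs.mul_right _).hasSum fun n => ?_
  have h2 : ∫ x, D n x ∂μ = (-1) ^ n / (n.factorial : ℂ) *
      ∫ x, v x * minorCoeff μ K w n x x ∂μ := by
    rw [← integral_const_mul]
    exact integral_congr_ae (ae_of_all _ fun x => by simp only [hD]; ring)
  -- The minor of order `n` is matched with the determinant coefficient of order `n + 1`.
  have h3 : (-1 : ℂ) ^ n / (n.factorial : ℂ)
      = -((-1) ^ (n + 1) / ((n + 1).factorial : ℂ)) * (n + 1) := by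
    rw [Nat.factorial_succ]
    have h3 : (n.factorial : ℂ) ≠ 0 := by exact_mod_cast n.factorial_ne_zero
    have h4 : (n : ℂ) + 1 ≠ 0 := by exact_mod_cast n.succ_ne_zero
    push_cast
    field_simp
    ring
  have h4 : (-1) ^ (n + 1) / ((n + 1).factorial : ℂ) * fredholmCoeff μ K (fun x => w x + v x) (n + 1)
      - (-1) ^ (n + 1) / ((n + 1).factorial : ℂ) * fredholmCoeff μ K w (n + 1) + ∫ x, D n x ∂μ
      = (-1) ^ (n + 1) / ((n + 1).factorial : ℂ) *
        (fredholmCoeff μ K (fun x => w x + v x) (n + 1) - fredholmCoeff μ K w (n + 1)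
        - (n + 1) * ∫ x, v x * minorCoeff μ K w n x x ∂μ) := by
    rw [h2, h3]; ring
  rw [h4, norm_mul, norm_neg_one_pow_div_factorial]
  refine (mul_le_mul_of_nonneg_left (norm_fredholmCoeff_sub_le hK hw hv hwv (le_max_left _ 1) hL1 n)
    (by positivity)).trans ?_
  -- The number of pairs is absorbed into the geometric factor, which explains the `4` in the
  -- majorant.
  have h5 : ((n : ℝ) + 1) ^ 2 ≤ 4 ^ (n + 1) := by
    have h6 : (n : ℝ) + 1 ≤ 2 ^ (n + 1) := by
      have : n + 1 < 2 ^ (n + 1) := Nat.lt_two_pow_self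
      exact_mod_cast this.le
    calc ((n : ℝ) + 1) ^ 2 ≤ (2 ^ (n + 1)) ^ 2 := by gcongr
      _ = 4 ^ (n + 1) := by rw [← pow_mul, mul_comm, pow_mul]; norm_num
  rw [div_eq_mul_inv, ← sqrt_factorial_mul_inv, mul_pow 4, mul_pow (2 * B)]
  have h7 : (0 : ℝ) ≤ L := zero_le_one.trans hL1
  calc ((n + 1).factorial : ℝ)⁻¹ * (((n : ℝ) + 1) ^ 2 * ((∫ x, ‖v x‖ ∂μ) ^ 2 * L ^ (n + 1)) *
        ((2 * B) ^ (n + 1) * √((n + 1).factorial)))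
      ≤ ((n + 1).factorial : ℝ)⁻¹ * (4 ^ (n + 1) * ((∫ x, ‖v x‖ ∂μ) ^ 2 * L ^ (n + 1)) *
        ((2 * B) ^ (n + 1) * √((n + 1).factorial))) := by gcongr
    _ = _ := by ring

end Fredholm

end GenBessel

namespace GenBessel

open MeasureTheory Set Filter Topology

/-! ### Integrals over the intervals -/

section Intervals

variable {m : ℕ}

/-- The end points lie in order in `(lo, hi)`, where `lo > 0`. -/
structure EndPts (lo hi : ℝ) (a : Fin (2 * m) → ℝ) : Prop where
  pos : 0 < lo
  lt : lo < hi
  mono : StrictMono a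
  mem : ∀ l, a l ∈ Ioo lo hi

theorem exists_endPts {a : Fin (2 * m) → ℝ} (ha : ∀ l, 0 < a l) (hmono : StrictMono a) :
    ∃ lo hi, EndPts lo hi a := by
  have h1 : ∀ᶠ x in 𝓝[>] (0 : ℝ), ∀ l, x < a l :=
    eventually_all.2 fun l => nhdsWithin_le_nhds (Iio_mem_nhds (ha l))
  obtain ⟨lo, hlo, hlo0⟩ := (h1.and self_mem_nhdsWithin).exists
  have h2 : ∀ᶠ x in atTop, ∀ l, a l < x := eventually_all.2 fun l => eventually_gt_atTop (a l)
  obtain ⟨hi, hhi, hlt⟩ := (h2.and (eventually_gt_atTop lo)).exists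
  exact ⟨lo, hi, hlo0, hlt, hmono, fun l => ⟨hlo l, hhi l⟩⟩

theorem continuous_update_apply (a : Fin (2 * m) → ℝ) (l i : Fin (2 * m)) :
    Continuous fun t => Function.update a l t i := by
  rcases eq_or_ne i l with rfl | h
  · simp only [Function.update_self]; exact continuous_id
  · simpa [Function.update_of_ne h] using continuous_const

theorem EndPts.eventually_update {lo hi : ℝ} {a : Fin (2 * m) → ℝ} (ha : EndPts lo hi a)
    (l : Fin (2 * m)) : ∀ᶠ t in 𝓝 (a l), EndPts lo hi (Function.update a l t) := by
  have h1 : ∀ᶠ t in 𝓝 (a l), ∀ i j : Fin (2 * m), i < j →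
      Function.update a l t i < Function.update a l t j := by
    refine eventually_all.2 fun i => eventually_all.2 fun j => ?_
    by_cases hij : i < j
    · have h2 : Function.update a l (a l) i < Function.update a l (a l) j := by
        rw [Function.update_eq_self]; exact ha.mono hij
      filter_upwards [(continuous_update_apply a l i).continuousAt.eventually_lt
        (continuous_update_apply a l j).continuousAt h2] with t ht _ using ht
    · exact Eventually.of_forall fun t h => absurd h hij
  have h3 : ∀ᶠ t in 𝓝 (a l), ∀ i, Function.update a l t i ∈ Ioo lo hi := by
    refine eventually_all.2 fun i => ?_
    have h2 : Function.update a l (a l) i ∈ Ioo lo hi := by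
      rw [Function.update_eq_self]; exact ha.mem i
    exact (continuous_update_apply a l i).continuousAt.eventually (isOpen_Ioo.mem_nhds h2)
  filter_upwards [h1, h3] with t ht1 ht3
  exact ⟨ha.pos, ha.lt, fun i j hij => ht1 i j hij, ht3⟩

/-- The orientation of the end points: `-1` for left and `1` for right end points. -/
noncomputable def endSign (l : Fin (2 * m)) : ℂ := if Even l.val then -1 else 1

theorem prefactor_mul_self (l : Fin (2 * m)) : prefactor l * prefactor l = -endSign l := by
  unfold prefactor endSign
  split_ifs <;> simp

theorem sum_fin_two_mul {F : Type*} [AddCommMonoid F] (f : Fin (2 * m) → F) :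
    ∑ l, f l = ∑ j : Fin m, (f ⟨2 * j.val, by omega⟩ + f ⟨2 * j.val + 1, by omega⟩) := by
  rw [← (finProdFinEquiv.trans (finCongr (Nat.mul_comm m 2))).sum_comp, Fintype.sum_prod_type]
  refine Finset.sum_congr rfl fun j _ => ?_
  rw [Fin.sum_univ_two]
  congr 2 <;> ext <;> simp [finProdFinEquiv, add_comm]

theorem sum_endSign_smul {F : Type*} [AddCommGroup F] [Module ℂ F] (f : Fin (2 * m) → F) :
    ∑ l, endSign l • f l
      = ∑ j : Fin m, (f ⟨2 * j.val + 1, by omega⟩ - f ⟨2 * j.val, by omega⟩) := by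
  rw [sum_fin_two_mul]
  refine Finset.sum_congr rfl fun j _ => ?_
  have h1 : ¬ Even (2 * j.val + 1) := by simp
  simp only [endSign, even_two_mul, h1, if_true, if_false, one_smul, neg_smul]
  abel

theorem measurableSet_intervals (a : Fin (2 * m) → ℝ) : MeasurableSet (intervals a) :=
  MeasurableSet.iUnion fun _ => measurableSet_Ioo

theorem EndPts.intervals_subset {lo hi : ℝ} {a : Fin (2 * m) → ℝ} (ha : EndPts lo hi a) :
    intervals a ⊆ Icc lo hi :=
  iUnion_subset fun _ _ hx => ⟨(ha.mem _).1.le.trans hx.1.le, hx.2.le.trans (ha.mem _).2.le⟩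

theorem EndPts.intervals_pos {lo hi : ℝ} {a : Fin (2 * m) → ℝ} (ha : EndPts lo hi a) {x : ℝ}
    (hx : x ∈ intervals a) : 0 < x := ha.pos.trans_le (ha.intervals_subset hx).1

theorem EndPts.pos_apply {lo hi : ℝ} {a : Fin (2 * m) → ℝ} (ha : EndPts lo hi a)
    (l : Fin (2 * m)) : 0 < a l := ha.pos.trans (ha.mem l).1

/-- Each interval is a difference of two intervals that start at `lo`. In this form every end point
enters through one term of its own, so the variation of a single `a_l` is transparent. -/
theorem EndPts.integral_intervals {lo hi : ℝ} {a : Fin (2 * m) → ℝ} (ha : EndPts lo hi a)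
    {g : ℝ → ℂ} (hg : IntegrableOn g (Icc lo hi)) :
    ∫ y in intervals a, g y = ∑ l, endSign l * ∫ y in lo..a l, g y := by
  have hsub : ∀ l, IntervalIntegrable g volume lo (a l) := fun l => by
    rw [intervalIntegrable_iff_integrableOn_Ioc_of_le (ha.mem l).1.le]
    exact hg.mono_set (Ioc_subset_Icc_self.trans (Icc_subset_Icc_right (ha.mem l).2.le))
  have hdisj : Pairwise (Function.onFun Disjoint fun j : Fin m =>
      Ioo (a ⟨2 * j.val, by omega⟩) (a ⟨2 * j.val + 1, by omega⟩)) := by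
    have key : ∀ i j : Fin m, i < j → Disjoint
        (Ioo (a ⟨2 * i.val, by omega⟩) (a ⟨2 * i.val + 1, by omega⟩))
        (Ioo (a ⟨2 * j.val, by omega⟩) (a ⟨2 * j.val + 1, by omega⟩)) := by
      intro i j hij
      rw [Set.disjoint_left]
      rintro x ⟨-, hx⟩ ⟨hx', -⟩
      have : a ⟨2 * i.val + 1, by omega⟩ < a ⟨2 * j.val, by omega⟩ :=
        ha.mono (by rw [Fin.mk_lt_mk]; have : i.val < j.val := hij; omega)
      linarith
    intro i j hij
    rcases lt_or_gt_of_ne hij with h | h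
    · exact key i j h
    · exact (key j i h).symm
  simp only [← smul_eq_mul (endSign _)]
  rw [sum_endSign_smul, intervals, integral_iUnion_fintype (fun _ => measurableSet_Ioo) hdisj]
  · refine Finset.sum_congr rfl fun j _ => ?_
    have hle : a ⟨2 * j.val, by omega⟩ ≤ a ⟨2 * j.val + 1, by omega⟩ :=
      (ha.mono (by rw [Fin.mk_lt_mk]; omega)).le
    rw [intervalIntegral.integral_interval_sub_left (hsub _) (hsub _),
      intervalIntegral.integral_of_le hle, integral_Ioc_eq_integral_Ioo]
  · exact fun j => hg.mono_set ((subset_iUnion (fun j : Fin m =>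
      Ioo (a ⟨2 * j.val, by omega⟩) (a ⟨2 * j.val + 1, by omega⟩)) j).trans ha.intervals_subset)

theorem EndPts.integral_intervals_update_sub {lo hi : ℝ} {a : Fin (2 * m) → ℝ}
    {l : Fin (2 * m)} {t : ℝ} (ha : EndPts lo hi a) (ht : EndPts lo hi (Function.update a l t))
    {g : ℝ → ℂ} (hg : IntegrableOn g (Icc lo hi)) :
    (∫ y in intervals (Function.update a l t), g y) - ∫ y in intervals a, g y
      = endSign l * ∫ y in a l..t, g y := by
  have hsub : ∀ s ∈ Ioo lo hi, IntervalIntegrable g volume lo s := fun s hs => by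
    rw [intervalIntegrable_iff_integrableOn_Ioc_of_le hs.1.le]
    exact hg.mono_set (Ioc_subset_Icc_self.trans (Icc_subset_Icc_right hs.2.le))
  have htl : t ∈ Ioo lo hi := by simpa using ht.mem l
  rw [ha.integral_intervals hg, ht.integral_intervals hg, ← Finset.sum_sub_distrib,
    Finset.sum_eq_single l]
  · rw [Function.update_self, ← mul_sub,
      intervalIntegral.integral_interval_sub_left (hsub _ htl) (hsub _ (ha.mem l))]
  · intro k _ hk
    rw [Function.update_of_ne hk, sub_self]
  · simp

/-- The fundamental theorem of calculus; the values `G lo` cancel because the signs of the end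
points sum to zero. It provides the boundary terms of the integrations by parts. -/
theorem EndPts.integral_intervals_deriv {lo hi : ℝ} {a : Fin (2 * m) → ℝ} (ha : EndPts lo hi a)
    {G G' : ℝ → ℂ} (hG : ∀ x, 0 < x → HasDerivAt G (G' x) x) (hG' : ContinuousOn G' (Ioi 0)) :
    ∫ y in intervals a, G' y = ∑ l, endSign l * G (a l) := by
  have hpos : ∀ x ∈ Icc lo hi, 0 < x := fun x hx => ha.pos.trans_le hx.1
  rw [ha.integral_intervals (hG'.mono hpos).integrableOn_Icc]
  have h1 : ∀ l, ∫ y in lo..a l, G' y = G (a l) - G lo := by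
    intro l
    have hsub : uIcc lo (a l) ⊆ Icc lo hi := by
      rw [uIcc_of_le (ha.mem l).1.le]
      exact Icc_subset_Icc_right (ha.mem l).2.le
    exact intervalIntegral.integral_eq_sub_of_hasDerivAt (fun x hx => hG x (hpos x (hsub hx)))
      (hG'.mono fun x hx => hpos x (hsub hx)).intervalIntegrable
  have h2 : ∑ l : Fin (2 * m), endSign l * G lo = 0 := by
    have := sum_endSign_smul (m := m) fun _ => G lo
    simpa using this
  simp only [h1, mul_sub, Finset.sum_sub_distrib, h2, sub_zero]

/-- A point outside the segment from `a_l` to `t` lies on the same side of both, so its membership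
in `J` does not change. The variation of the weight thus has `L¹` norm at most `|t - a_l|`. -/
theorem indicator_intervals_update_sub_le (a : Fin (2 * m) → ℝ) (l : Fin (2 * m)) (t x : ℝ) :
    ‖(intervals (Function.update a l t)).indicator (1 : ℝ → ℂ) x
      - (intervals a).indicator (1 : ℝ → ℂ) x‖ ≤ (uIcc (a l) t).indicator (1 : ℝ → ℝ) x := by
  by_cases hx : x ∈ uIcc (a l) t
  · rw [indicator_of_mem hx]
    unfold indicator
    split_ifs <;> simp
  · rw [indicator_of_notMem hx]
    have hx1 : (a l < x ↔ t < x) := by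
      rw [mem_uIcc] at hx
      push Not at hx
      constructor
      · intro h; exact hx.1 h.le
      · intro h; exact hx.2 h.le
    have hx2 : (x < a l ↔ x < t) := by
      rw [mem_uIcc] at hx
      push Not at hx
      constructor
      · intro h; by_contra h'; push Not at h'
        exact absurd (hx.2 h') (not_lt.2 h.le)
      · intro h; by_contra h'; push Not at h'
        exact absurd (hx.1 h') (not_lt.2 h.le)
    have hl : ∀ i, (Function.update a l t i < x ↔ a i < x) := by
      intro i
      by_cases hi : i = l
      · subst hi; rw [Function.update_self]; exact hx1.symm
      · rw [Function.update_of_ne hi]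
    have hr : ∀ i, (x < Function.update a l t i ↔ x < a i) := by
      intro i
      by_cases hi : i = l
      · subst hi; rw [Function.update_self]; exact hx2.symm
      · rw [Function.update_of_ne hi]
    have hmem : x ∈ intervals (Function.update a l t) ↔ x ∈ intervals a := by
      simp only [intervals, mem_iUnion, mem_Ioo, hl, hr]
    by_cases h : x ∈ intervals a
    · rw [indicator_of_mem h, indicator_of_mem (hmem.2 h)]; simp
    · rw [indicator_of_notMem h, indicator_of_notMem (mt hmem.1 h)]; simp

theorem isWeight_indicator (a : Fin (2 * m) → ℝ) : IsWeight ((intervals a).indicator 1) :=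
  ⟨measurable_one.indicator (measurableSet_intervals a), fun x => by
    unfold indicator; split_ifs <;> simp⟩

theorem EndPts.integral_weight {lo hi : ℝ} {a : Fin (2 * m) → ℝ} (ha : EndPts lo hi a)
    (g : ℝ → ℂ) :
    ∫ y in Icc lo hi, (intervals a).indicator 1 y * g y = ∫ y in intervals a, g y := by
  have h1 : ∀ y, (intervals a).indicator (1 : ℝ → ℂ) y * g y = (intervals a).indicator g y := by
    intro y
    unfold indicator
    split_ifs <;> simp
  simp only [h1]
  rw [setIntegral_indicator (measurableSet_intervals a), inter_eq_right.2 ha.intervals_subset]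

end Intervals

/-! ### Integral operators on bounded continuous functions -/

section Operators

/-- Bounded continuous functions on the line. -/
abbrev BCF : Type := BoundedContinuousFunction ℝ ℂ

variable {μ : Measure ℝ} [IsFiniteMeasure μ] {K L : ℝ → ℝ → ℂ} {B C : ℝ} {w : ℝ → ℂ}

theorem integrable_weight_mul_kernel (hK : BoundedKernel K B) (hw : IsWeight w) (x : ℝ) (u : BCF) :
    Integrable (fun y => w y * K x y * u y) μ := by
  refine Integrable.of_bound (Measurable.aestronglyMeasurable ?_) (B * ‖u‖) (ae_of_all _ fun y => ?_)
  · exact (hw.meas.mul (hK.cont.comp (Continuous.prodMk_right x)).measurable).mul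
      u.continuous.measurable
  · rw [norm_mul, norm_mul]
    exact mul_le_mul ((mul_le_of_le_one_left (norm_nonneg _) (hw.bound y)).trans (hK.bound _ _))
      (u.norm_coe_le_norm y) (norm_nonneg _) hK.nonneg

theorem norm_weight_mul_kernel_le (hK : BoundedKernel K B) (hw : IsWeight w) (x : ℝ) (u : BCF)
    (y : ℝ) : ‖w y * K x y * u y‖ ≤ B * ‖u‖ := by
  rw [norm_mul, norm_mul]
  exact mul_le_mul ((mul_le_of_le_one_left (norm_nonneg _) (hw.bound y)).trans (hK.bound _ _))
    (u.norm_coe_le_norm y) (norm_nonneg _) hK.nonneg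

/-- The integral operator with kernel `K(x,y) w(y)` with respect to `μ`. -/
noncomputable def kernelOp (μ : Measure ℝ) [IsFiniteMeasure μ] (hK : BoundedKernel K B)
    (hw : IsWeight w) : BCF →L[ℂ] BCF :=
  LinearMap.mkContinuous
    { toFun := fun u => BoundedContinuousFunction.ofNormedAddCommGroup
        (fun x => ∫ y, w y * K x y * u y ∂μ)
        (continuous_of_dominated
          (fun x => (integrable_weight_mul_kernel hK hw x u).aestronglyMeasurable)
          (fun x => ae_of_all _ (norm_weight_mul_kernel_le hK hw x u)) (integrable_const _)
          (ae_of_all _ fun y => (continuous_const.mul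
            (hK.cont.comp (Continuous.prodMk_left y))).mul continuous_const))
        (B * ‖u‖ * μ.real univ)
        (fun x => norm_integral_le_of_norm_le_const
          (ae_of_all _ (norm_weight_mul_kernel_le hK hw x u)))
      map_add' := fun u v => by
        ext x
        simp only [BoundedContinuousFunction.coe_ofNormedAddCommGroup,
          BoundedContinuousFunction.coe_add, Pi.add_apply, mul_add]
        exact integral_add (integrable_weight_mul_kernel hK hw x u)
          (integrable_weight_mul_kernel hK hw x v)
      map_smul' := fun c u => by
        ext x
        simp only [BoundedContinuousFunction.coe_ofNormedAddCommGroup,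
          BoundedContinuousFunction.coe_smul, smul_eq_mul, RingHom.id_apply]
        rw [← integral_const_mul]
        congr 1
        ext y
        ring }
    (B * μ.real univ) fun u => by
      have h0 : 0 ≤ B * μ.real univ * ‖u‖ := by
        have := hK.nonneg
        positivity
      rw [BoundedContinuousFunction.norm_le h0]
      intro x
      refine (norm_integral_le_of_norm_le_const
        (ae_of_all _ (norm_weight_mul_kernel_le hK hw x u))).trans_eq ?_
      ring

theorem kernelOp_apply (hK : BoundedKernel K B) (hw : IsWeight w) (u : BCF) (x : ℝ) :
    kernelOp μ hK hw u x = ∫ y, w y * K x y * u y ∂μ := rfl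

theorem kernelOp_kernelOp_apply (hK : BoundedKernel K B) (hL : BoundedKernel L C)
    (hw : IsWeight w) (u : BCF) (x : ℝ) :
    kernelOp μ hK hw (kernelOp μ hL hw u) x
      = ∫ y, w y * (∫ z, w z * K x z * L z y ∂μ) * u y ∂μ := by
  simp only [kernelOp_apply]
  have h1 : ∀ z, w z * K x z * ∫ y, w y * L z y * u y ∂μ
      = ∫ y, w z * K x z * (w y * L z y * u y) ∂μ := fun z => (integral_const_mul _ _).symm
  simp only [h1]
  rw [integral_integral_swap]
  · refine integral_congr_ae (ae_of_all _ fun y => ?_)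
    simp only
    rw [← integral_const_mul, ← integral_mul_const]
    exact integral_congr_ae (ae_of_all _ fun z => by ring)
  · refine Integrable.of_bound (Measurable.aestronglyMeasurable ?_) (B * (C * ‖u‖))
      (ae_of_all _ fun p => ?_)
    · have hL' : Measurable fun p : ℝ × ℝ => L p.1 p.2 := hL.cont.measurable
      have hK' : Measurable fun z => K x z :=
        (hK.cont.comp (Continuous.prodMk_right x)).measurable
      exact ((hw.meas.comp measurable_fst).mul (hK'.comp measurable_fst)).mul
        (((hw.meas.comp measurable_snd).mul hL').mul (u.continuous.measurable.comp measurable_snd))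
    · simp only [Function.uncurry]
      rw [norm_mul, norm_mul]
      exact mul_le_mul ((mul_le_of_le_one_left (norm_nonneg _) (hw.bound _)).trans (hK.bound _ _))
        (norm_weight_mul_kernel_le hL hw _ u _) (norm_nonneg _) hK.nonneg

/-- Let `T` be the operator, `S` the operator of the minor and `d` the determinant. Fredholm's
identities say `T S = S T = S - d T`, whence `1 + S / d` is a two-sided inverse of `1 - T`. -/
theorem isUnit_one_sub_kernelOp (hK : BoundedKernel K B) (hw : IsWeight w)
    (hd : fredholmSum μ K w ≠ 0) : IsUnit (1 - kernelOp μ hK hw) := by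
  obtain ⟨C, hD⟩ := boundedKernel_fredholmMinor (μ := μ) hK hw
  set d := fredholmSum μ K w with hd'
  set T := kernelOp μ hK hw with hT
  set S := kernelOp μ hD hw with hS
  have h1 : T * S = S - d • T := by
    ext u x
    simp only [mul_apply_eq_comp, sub_apply,
      smul_apply, BoundedContinuousFunction.coe_sub, Pi.sub_apply,
      BoundedContinuousFunction.coe_smul, smul_eq_mul]
    rw [hT, hS, kernelOp_kernelOp_apply, kernelOp_apply, kernelOp_apply, ← integral_const_mul,
      ← integral_sub (integrable_weight_mul_kernel hD hw x u)
        ((integrable_weight_mul_kernel hK hw x u).const_mul d)]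
    refine integral_congr_ae (ae_of_all _ fun y => ?_)
    simp only
    rw [fredholmMinor_eq_left hK hw x y]
    ring
  have h2 : S * T = S - d • T := by
    ext u x
    simp only [mul_apply_eq_comp, sub_apply,
      smul_apply, BoundedContinuousFunction.coe_sub, Pi.sub_apply,
      BoundedContinuousFunction.coe_smul, smul_eq_mul]
    rw [hT, hS, kernelOp_kernelOp_apply, kernelOp_apply, kernelOp_apply, ← integral_const_mul,
      ← integral_sub (integrable_weight_mul_kernel hD hw x u)
        ((integrable_weight_mul_kernel hK hw x u).const_mul d)]
    refine integral_congr_ae (ae_of_all _ fun y => ?_)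
    simp only
    have h3 : ∫ z, w z * fredholmMinor μ K w x z * K z y ∂μ
        = ∫ z, fredholmMinor μ K w x z * (w z * K z y) ∂μ :=
      integral_congr_ae (ae_of_all _ fun z => by ring)
    rw [fredholmMinor_eq_right hK hw x y, h3]
    ring
  have h3 : ∀ u x, T (S u) x = S u x - d * T u x := fun u x => congrArg (fun R => R u x) h1
  have h4 : ∀ u x, S (T u) x = S u x - d * T u x := fun u x => congrArg (fun R => R u x) h2
  refine ⟨⟨1 - T, 1 + d⁻¹ • S, ?_, ?_⟩, rfl⟩
  · ext u x
    have h5 : ((1 - T) * (1 + d⁻¹ • S)) u = u + d⁻¹ • S u - (T u + d⁻¹ • T (S u)) := by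
      change (u + d⁻¹ • S u) - T (u + d⁻¹ • S u) = _
      rw [map_add, map_smul]
    rw [h5]
    change u x + d⁻¹ * S u x - (T u x + d⁻¹ * T (S u) x) = u x
    rw [h3]
    field_simp
    ring
  · ext u x
    have h5 : ((1 + d⁻¹ • S) * (1 - T)) u = u - T u + d⁻¹ • (S u - S (T u)) := by
      change (u - T u) + d⁻¹ • S (u - T u) = _
      rw [map_sub]
    rw [h5]
    change u x - T u x + d⁻¹ * (S u x - S (T u) x) = u x
    rw [h4]
    field_simp
    ring

/-- The section `x ↦ K(x, y)`. -/
noncomputable def kernelSection (hK : BoundedKernel K B) (y : ℝ) : BCF :=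
  BoundedContinuousFunction.ofNormedAddCommGroup (fun x => K x y)
    (hK.cont.comp (Continuous.prodMk_left y)) B fun x => hK.bound x y

theorem norm_kernelSection_le (hK : BoundedKernel K B) (y : ℝ) : ‖kernelSection hK y‖ ≤ B :=
  (BoundedContinuousFunction.norm_le hK.nonneg).2 fun x => hK.bound x y

/-- Continuity in the supremum norm is where uniform continuity of the kernel enters. It allows
sections to be integrated as functions with values in the Banach space. -/
theorem continuous_kernelSection (hK : BoundedKernel K B)
    (hu : UniformContinuous (Function.uncurry K)) : Continuous (kernelSection hK) := by
  refine Metric.continuous_iff.2 fun y ε hε => ?_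
  obtain ⟨δ, hδ, h⟩ := Metric.uniformContinuous_iff.1 hu (ε / 2) (half_pos hε)
  refine ⟨δ, hδ, fun z hz => ?_⟩
  refine lt_of_le_of_lt ((BoundedContinuousFunction.dist_le (half_pos hε).le).2 fun x => ?_)
    (half_lt_self hε)
  have hd : dist (x, z) (x, y) < δ := by
    rw [Prod.dist_eq]; simpa [hδ] using hz
  exact (h hd).le

variable {m : ℕ} {lo hi : ℝ} {a : Fin (2 * m) → ℝ} {l : Fin (2 * m)}

/-- The integral operator with kernel `K(x,y) χ_J(y)`. -/
noncomputable def intervalOp (lo hi : ℝ) (hK : BoundedKernel K B) (a : Fin (2 * m) → ℝ) :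
    BCF →L[ℂ] BCF :=
  kernelOp (volume.restrict (Icc lo hi)) hK (isWeight_indicator a)

theorem EndPts.intervalOp_apply (ha : EndPts lo hi a) (hK : BoundedKernel K B) (u : BCF) (x : ℝ) :
    intervalOp lo hi hK a u x = ∫ y in intervals a, K x y * u y := by
  rw [intervalOp, kernelOp_apply, ← ha.integral_weight]
  exact integral_congr_ae (ae_of_all _ fun y => by ring)

theorem EndPts.intervalOp_update_sub (ha : EndPts lo hi a) (hK : BoundedKernel K B)
    (hu : UniformContinuous (Function.uncurry K)) {t : ℝ}
    (ht : EndPts lo hi (Function.update a l t)) (u : BCF) :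
    intervalOp lo hi hK (Function.update a l t) u - intervalOp lo hi hK a u
      = endSign l • ∫ y in a l..t, u y • kernelSection hK y := by
  have hc : Continuous fun y => u y • kernelSection hK y :=
    u.continuous.smul (continuous_kernelSection hK hu)
  ext x
  rw [BoundedContinuousFunction.coe_sub, Pi.sub_apply, ha.intervalOp_apply, ht.intervalOp_apply,
    ha.integral_intervals_update_sub ht]
  · change _ = endSign l * (∫ y in a l..t, u y • kernelSection hK y : BCF) x
    congr 1
    have h := (BoundedContinuousFunction.evalCLM ℂ x).intervalIntegral_comp_comm
      (hc.intervalIntegrable (μ := volume) (a l) t)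
    rw [BoundedContinuousFunction.evalCLM_apply] at h
    rw [← h]
    refine intervalIntegral.integral_congr fun y _ => ?_
    exact mul_comm _ _
  · exact ((hK.cont.comp (Continuous.prodMk_right x)).mul u.continuous).continuousOn.integrableOn_Icc

theorem norm_endSign (l : Fin (2 * m)) : ‖endSign l‖ = 1 := by
  unfold endSign; split_ifs <;> simp

theorem EndPts.tendsto_intervalOp (ha : EndPts lo hi a) (hK : BoundedKernel K B)
    (hu : UniformContinuous (Function.uncurry K)) (l : Fin (2 * m)) :
    Tendsto (fun t => intervalOp lo hi hK (Function.update a l t)) (𝓝 (a l))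
      (𝓝 (intervalOp lo hi hK a)) := by
  rw [tendsto_iff_norm_sub_tendsto_zero]
  have h1 : Tendsto (fun t => B * |t - a l|) (𝓝 (a l)) (𝓝 0) := by
    have : Continuous fun t => B * |t - a l| := by fun_prop
    simpa using this.tendsto (a l)
  refine squeeze_zero' (Eventually.of_forall fun t => norm_nonneg _) ?_ h1
  filter_upwards [ha.eventually_update l] with t ht
  refine ContinuousLinearMap.opNorm_le_bound _ (mul_nonneg hK.nonneg (abs_nonneg _)) fun u => ?_
  rw [sub_apply, ha.intervalOp_update_sub hK hu ht, norm_smul, norm_endSign,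
    one_mul]
  refine (intervalIntegral.norm_integral_le_of_norm_le_const (C := B * ‖u‖) fun y _ => ?_).trans_eq
    (by ring)
  rw [norm_smul, mul_comm]
  exact mul_le_mul (norm_kernelSection_le hK y) (u.norm_coe_le_norm y) (norm_nonneg _) hK.nonneg

/-- A product rule: the moving end point contributes the section of the kernel there, by the
fundamental theorem of calculus, and the moving argument contributes the operator at its derivative.
-/
theorem EndPts.hasDerivAt_intervalOp (ha : EndPts lo hi a) (hK : BoundedKernel K B)
    (hu : UniformContinuous (Function.uncurry K)) {U : ℝ → BCF} {U' : BCF}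
    (hU : HasDerivAt U U' (a l)) :
    HasDerivAt (fun t => intervalOp lo hi hK (Function.update a l t) (U t))
      ((endSign l * U (a l) (a l)) • kernelSection hK (a l) + intervalOp lo hi hK a U') (a l) := by
  have hc : ∀ u : BCF, Continuous fun y => u y • kernelSection hK y := fun u =>
    u.continuous.smul (continuous_kernelSection hK hu)
  have h1 : HasDerivAt (fun t => ∫ y in a l..t, U (a l) y • kernelSection hK y)
      (U (a l) (a l) • kernelSection hK (a l)) (a l) :=
    intervalIntegral.integral_hasDerivAt_right ((hc _).intervalIntegrable _ _)
      ((hc _).stronglyMeasurableAtFilter _ _) (hc _).continuousAt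
  -- The mixed term is of second order: the integrand tends to zero while the segment shrinks.
  have h2 : HasDerivAt (fun t => ∫ y in a l..t, (U t - U (a l)) y • kernelSection hK y)
      0 (a l) := by
    rw [hasDerivAt_iff_isLittleO]
    simp only [intervalIntegral.integral_same, sub_zero, smul_zero]
    have h3 : Tendsto (fun t => ‖U t - U (a l)‖ * B) (𝓝 (a l)) (𝓝 0) := by
      have := (tendsto_iff_norm_sub_tendsto_zero.1 hU.continuousAt.tendsto).mul_const B
      simpa using this
    refine (Asymptotics.isBigO_of_le _ (g := fun t => ‖U t - U (a l)‖ * B * (t - a l))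
      fun t => ?_).trans_isLittleO ?_
    · have h4 := intervalIntegral.norm_integral_le_of_norm_le_const
        (f := fun y => (U t - U (a l)) y • kernelSection hK y) (C := ‖U t - U (a l)‖ * B)
        (a := a l) (b := t) fun y _ => by
          rw [norm_smul]
          exact mul_le_mul ((U t - U (a l)).norm_coe_le_norm y) (norm_kernelSection_le hK y)
            (norm_nonneg _) (norm_nonneg _)
      have h5 : 0 ≤ ‖U t - U (a l)‖ * B := mul_nonneg (norm_nonneg _) hK.nonneg
      rwa [Real.norm_eq_abs, abs_mul, abs_of_nonneg h5]
    · have := (Asymptotics.isLittleO_one_iff ℝ).2 h3 |>.mul_isBigO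
        (Asymptotics.isBigO_refl (fun t => t - a l) (𝓝 (a l)))
      simpa using this
  have h3 := ((intervalOp lo hi hK a).hasFDerivAt (x := U (a l))).restrictScalars ℝ
    |>.comp_hasDerivAt (a l) hU
  have h4 := h3.add ((h1.add h2).const_smul (endSign l))
  refine (h4.congr_of_eventuallyEq ?_).congr_deriv ?_
  · filter_upwards [ha.eventually_update l] with t ht
    have h5 := ha.intervalOp_update_sub hK hu ht (U t)
    have h6 : ∫ y in a l..t, U t y • kernelSection hK y
        = (∫ y in a l..t, U (a l) y • kernelSection hK y)
          + ∫ y in a l..t, (U t - U (a l)) y • kernelSection hK y := by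
      rw [← intervalIntegral.integral_add ((hc _).intervalIntegrable _ _)
        ((hc _).intervalIntegrable _ _)]
      refine intervalIntegral.integral_congr fun y _ => ?_
      simp only [BoundedContinuousFunction.coe_sub, Pi.sub_apply]
      rw [← add_smul]; congr 1; ring
    rw [sub_eq_iff_eq_add'] at h5
    rw [h5, h6]
    rfl
  · simp [smul_smul, add_comm]

theorem EndPts.eventually_isUnit (ha : EndPts lo hi a) (hK : BoundedKernel K B)
    (hu : UniformContinuous (Function.uncurry K)) (hunit : IsUnit (1 - intervalOp lo hi hK a))
    (l : Fin (2 * m)) :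
    ∀ᶠ t in 𝓝 (a l), IsUnit (1 - intervalOp lo hi hK (Function.update a l t)) :=
  (tendsto_const_nhds.sub (ha.tendsto_intervalOp hK hu l)).eventually
    ((Units.isOpen (R := BCF →L[ℂ] BCF)).eventually_mem hunit)

/-- The resolvent applied to `h`, and its derivative in an end point. -/
theorem EndPts.hasDerivAt_resolvent (ha : EndPts lo hi a) (hK : BoundedKernel K B)
    (hu : UniformContinuous (Function.uncurry K)) (hunit : IsUnit (1 - intervalOp lo hi hK a))
    (h : BCF) :
    HasDerivAt (fun t => Ring.inverse (1 - intervalOp lo hi hK (Function.update a l t)) h)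
      ((endSign l * Ring.inverse (1 - intervalOp lo hi hK a) h (a l)) •
        Ring.inverse (1 - intervalOp lo hi hK a) (kernelSection hK (a l))) (a l) := by
  set T := fun t => intervalOp lo hi hK (Function.update a l t) with hT
  have hTa : T (a l) = intervalOp lo hi hK a := by simp [hT]
  set u := Ring.inverse (1 - intervalOp lo hi hK a) h with hudef
  have hcont : Tendsto (fun t => Ring.inverse (1 - T t)) (𝓝 (a l))
      (𝓝 (Ring.inverse (1 - intervalOp lo hi hK a))) := by
    obtain ⟨v, hv⟩ := hunit
    rw [← hv]
    refine (NormedRing.inverse_continuousAt (R := BCF →L[ℂ] BCF) v).tendsto.comp ?_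
    rw [hv]
    exact tendsto_const_nhds.sub (ha.tendsto_intervalOp hK hu l)
  have hT' : HasDerivAt (fun t => T t u) ((endSign l * u (a l)) • kernelSection hK (a l)) (a l) := by
    have := ha.hasDerivAt_intervalOp hK hu (U := fun _ => u) (hasDerivAt_const (a l) u)
    simpa using this
  have hu1 : u - intervalOp lo hi hK a u = h := by
    have := Ring.mul_inverse_cancel _ hunit
    have h2 := DFunLike.congr_fun this h
    simpa [hudef] using h2
  rw [hasDerivAt_iff_tendsto_slope] at hT' ⊢
  have hlim := (isBoundedBilinearMap_apply (𝕜 := ℂ) (E := BCF) (F := BCF)).continuous.tendsto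
    (Ring.inverse (1 - intervalOp lo hi hK a), (endSign l * u (a l)) • kernelSection hK (a l))
    |>.comp (((hcont.mono_left nhdsWithin_le_nhds).prodMk_nhds hT'))
  simp only [] at hlim
  rw [map_smul] at hlim
  refine hlim.congr' ?_
  filter_upwards [nhdsWithin_le_nhds (ha.eventually_isUnit hK hu hunit l)] with t ht
  -- The resolvent identity. Only the derivative of `T t u` at the fixed `u` and the norm continuity
  -- of the inverse are needed, not a derivative of `T` in operator norm.
  have h1 : Ring.inverse (1 - T t) h = u + Ring.inverse (1 - T t) (T t u - T (a l) u) := by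
    have h2 : h = (1 - T t) u + (T t u - T (a l) u) := by
      rw [hTa, ← hu1]
      simp
    have h3 := Ring.inverse_mul_cancel _ ht
    have h4 := DFunLike.congr_fun h3 u
    simp only [mul_apply_eq_comp, one_apply_eq_self] at h4
    conv_lhs => rw [h2, map_add]
    rw [h4]
  have h5 : Ring.inverse (1 - T (a l)) h = u := by rw [hTa]
  simp only [slope, vsub_eq_sub]
  rw [h5, h1, add_sub_cancel_left]
  exact ((Ring.inverse (1 - T t)).restrictScalars ℝ).map_smul _ _

/-- The derivative of the diagonal value of a differentiable family of functions. -/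
theorem hasDerivAt_apply_self {U : ℝ → BCF} {U' : BCF} {t₀ : ℝ} {v : ℂ} (hU : HasDerivAt U U' t₀)
    (hv : HasDerivAt (U t₀) v t₀) : HasDerivAt (fun t => U t t) (v + U' t₀) t₀ := by
  -- The remainder is small in the supremum norm, hence also at the moving point `t`.
  have h1 : HasDerivAt (fun t => (U t - U t₀ - (t - t₀) • U') t) 0 t₀ := by
    have h2 := hasDerivAt_iff_isLittleO.1 hU
    rw [hasDerivAt_iff_isLittleO]
    simp only [sub_self, zero_smul, sub_zero, smul_zero, BoundedContinuousFunction.coe_zero,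
      Pi.zero_apply]
    exact (Asymptotics.isBigO_of_le _ fun t =>
      (U t - U t₀ - (t - t₀) • U').norm_coe_le_norm t).trans_isLittleO h2
  -- The factor `t - t₀` vanishes at `t₀`, so continuity of `U'` suffices.
  have h3 : HasDerivAt (fun t : ℝ => ((t - t₀ : ℝ) : ℂ) * U' t) (U' t₀) t₀ := by
    have h4 : HasDerivAt (fun t : ℝ => ((t - t₀ : ℝ) : ℂ)) 1 t₀ := by
      simpa using ((hasDerivAt_id t₀).sub_const t₀).ofReal_comp
    rw [hasDerivAt_iff_tendsto_slope]
    have h5 : Tendsto (fun t => U' t) (𝓝[≠] t₀) (𝓝 (U' t₀)) :=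
      U'.continuous.continuousAt.tendsto.mono_left nhdsWithin_le_nhds
    refine h5.congr' ?_
    filter_upwards [self_mem_nhdsWithin] with t ht
    have h6 : ((t - t₀ : ℝ) : ℂ) ≠ 0 := by
      exact_mod_cast sub_ne_zero.2 ht
    simp only [slope, vsub_eq_sub, sub_self, Complex.ofReal_zero, zero_mul, sub_zero,
      Complex.real_smul]
    rw [Complex.ofReal_inv, inv_mul_cancel_left₀ h6]
  refine ((hv.add h3).add h1).congr_of_eventuallyEq (Eventually.of_forall fun t => ?_) |>.congr_deriv
    (by simp)
  simp

end Operators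

end GenBessel

namespace GenBessel

open MeasureTheory Set Filter Topology

/-! ### From operators on bounded functions to the resolvent on `(0, ∞)` -/

section Bridge

variable {m : ℕ} {lo hi : ℝ} {a : Fin (2 * m) → ℝ} {l : Fin (2 * m)} {k : ℝ → ℝ → ℂ}
  {h u : ℝ → ℂ}

/-- The bounds `lo`, `hi` are auxiliary. Local statements at any `x > 0` reduce to a compact
interval that also contains `x`. -/
theorem EndPts.enlarge (ha : EndPts lo hi a) {x : ℝ} (hx : 0 < x) :
    ∃ lo' hi', EndPts lo' hi' a ∧ x ∈ Ioo lo' hi' := by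
  refine ⟨min lo (x / 2), max hi (2 * x), ⟨lt_min ha.pos (by positivity),
    (min_le_left _ _).trans_lt (ha.lt.trans_le (le_max_left _ _)), ha.mono, fun l =>
      ⟨(min_le_left _ _).trans_lt (ha.mem l).1, (ha.mem l).2.trans_le (le_max_left _ _)⟩⟩,
    (min_le_right _ _).trans_lt (by linarith), lt_of_lt_of_le (by linarith) (le_max_right _ _)⟩

/-! ### Restriction to a compact interval -/

theorem clamp_pos (h0 : 0 < lo) (hle : lo ≤ hi) (x : ℝ) : 0 < (projIcc lo hi hle x : ℝ) :=
  h0.trans_le (projIcc lo hi hle x).2.1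

theorem clamp_of_mem (hle : lo ≤ hi) {x : ℝ} (hx : x ∈ Icc lo hi) :
    (projIcc lo hi hle x : ℝ) = x := by
  rw [projIcc_of_mem hle hx]

/-- The bounded continuous function that agrees with `h` on `[lo, hi]` and is constant on the
left and on the right of it. -/
noncomputable def clampFun (h0 : 0 < lo) (hle : lo ≤ hi) (hh : ContinuousOn h (Ioi 0)) : BCF :=
  (BoundedContinuousFunction.mkOfCompact ⟨fun x : Icc lo hi => h x,
    hh.comp_continuous continuous_subtype_val fun x => h0.trans_le x.2.1⟩).compContinuous
      ⟨projIcc lo hi hle, continuous_projIcc⟩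

theorem clampFun_apply (h0 : 0 < lo) (hle : lo ≤ hi) (hh : ContinuousOn h (Ioi 0)) (x : ℝ) :
    clampFun h0 hle hh x = h (projIcc lo hi hle x) := rfl

theorem clampFun_of_mem (h0 : 0 < lo) (hle : lo ≤ hi) (hh : ContinuousOn h (Ioi 0)) {x : ℝ}
    (hx : x ∈ Icc lo hi) : clampFun h0 hle hh x = h x := by
  rw [clampFun_apply, clamp_of_mem hle hx]

/-- The kernel that agrees with `k` on the square of `[lo, hi]` and is extended by constants. -/
noncomputable def clampKernel (hle : lo ≤ hi) (k : ℝ → ℝ → ℂ) (x y : ℝ) : ℂ :=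
  k (projIcc lo hi hle x) (projIcc lo hi hle y)

theorem clampKernel_of_mem (hle : lo ≤ hi) {x y : ℝ} (hx : x ∈ Icc lo hi) (hy : y ∈ Icc lo hi) :
    clampKernel hle k x y = k x y := by
  rw [clampKernel, clamp_of_mem hle hx, clamp_of_mem hle hy]

theorem exists_boundedKernel_clampKernel (h0 : 0 < lo) (hle : lo ≤ hi)
    (hk : ContinuousOn (Function.uncurry k) (Ioi 0 ×ˢ Ioi 0)) :
    (∃ B, BoundedKernel (clampKernel hle k) B) ∧
      UniformContinuous (Function.uncurry (clampKernel hle k)) := by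
  have hc : Continuous fun p : Icc lo hi × Icc lo hi => k p.1 p.2 :=
    hk.comp_continuous (f := fun p : Icc lo hi × Icc lo hi => ((p.1 : ℝ), (p.2 : ℝ)))
      (by fun_prop) fun p => ⟨h0.trans_le p.1.2.1, h0.trans_le p.2.2.1⟩
  have hu : UniformContinuous (Function.uncurry (clampKernel hle k)) :=
    (CompactSpace.uniformContinuous_of_continuous hc).comp
      ((LipschitzWith.projIcc hle).uniformContinuous.prodMap
        (LipschitzWith.projIcc hle).uniformContinuous)
  refine ⟨?_, hu⟩
  obtain ⟨B, hB⟩ := isCompact_univ.exists_bound_of_continuousOn hc.continuousOn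
  exact ⟨B, hu.continuous, fun x y => hB (projIcc lo hi hle x, projIcc lo hi hle y) (mem_univ _)⟩

/-! ### Integrals over the intervals as functions on `(0, ∞)` -/

theorem EndPts.integrableOn (ha : EndPts lo hi a) (hu : ContinuousOn u (Ioi 0)) :
    IntegrableOn u (intervals a) :=
  (hu.mono fun _ hx => ha.pos.trans_le hx.1 : ContinuousOn u (Icc lo hi)).integrableOn_Icc.mono_set
    ha.intervals_subset

theorem continuousOn_section_right (hk : ContinuousOn (Function.uncurry k) (Ioi 0 ×ˢ Ioi 0))
    {x : ℝ} (hx : 0 < x) : ContinuousOn (fun y => k x y) (Ioi 0) :=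
  hk.comp (f := fun y => (x, y)) (by fun_prop) fun _ hy => ⟨hx, hy⟩

theorem continuousOn_section_left (hk : ContinuousOn (Function.uncurry k) (Ioi 0 ×ˢ Ioi 0))
    {y : ℝ} (hy : 0 < y) : ContinuousOn (fun x => k x y) (Ioi 0) :=
  hk.comp (f := fun x => (x, y)) (by fun_prop) fun _ hx => ⟨hx, hy⟩

theorem EndPts.continuousOn_integral (ha : EndPts lo hi a)
    (hk : ContinuousOn (Function.uncurry k) (Ioi 0 ×ˢ Ioi 0)) (hu : ContinuousOn u (Ioi 0)) :
    ContinuousOn (fun x => ∫ y in intervals a, k x y * u y) (Ioi 0) := by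
  intro x hx
  obtain ⟨lo', hi', ha', hx'⟩ := ha.enlarge hx
  obtain ⟨⟨B, hB⟩, -⟩ := exists_boundedKernel_clampKernel ha'.pos ha'.lt.le hk
  have h1 := (intervalOp lo' hi' hB a (clampFun ha'.pos ha'.lt.le hu)).continuous.continuousAt
    (x := x)
  refine (h1.congr ?_).continuousWithinAt
  filter_upwards [Ioo_mem_nhds hx'.1 hx'.2] with z hz
  rw [ha'.intervalOp_apply]
  refine setIntegral_congr_fun (measurableSet_intervals a) fun y hy => ?_
  rw [clampKernel_of_mem _ (Ioo_subset_Icc_self hz) (ha'.intervals_subset hy),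
    clampFun_of_mem _ _ _ (ha'.intervals_subset hy)]

theorem EndPts.hasDerivAt_integral (ha : EndPts lo hi a) {k₁ : ℝ → ℝ → ℂ}
    (hk : ContinuousOn (Function.uncurry k) (Ioi 0 ×ˢ Ioi 0))
    (hk₁ : ContinuousOn (Function.uncurry k₁) (Ioi 0 ×ˢ Ioi 0))
    (hd : ∀ x y, 0 < x → 0 < y → HasDerivAt (fun x => k x y) (k₁ x y) x)
    (hu : ContinuousOn u (Ioi 0)) {x : ℝ} (hx : 0 < x) :
    HasDerivAt (fun x => ∫ y in intervals a, k x y * u y)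
      (∫ y in intervals a, k₁ x y * u y) x := by
  obtain ⟨lo', hi', ha', hx'⟩ := ha.enlarge hx
  have hcomp : IsCompact (Icc lo' hi' ×ˢ Icc lo' hi') := isCompact_Icc.prod isCompact_Icc
  have hpos : ∀ z ∈ Icc lo' hi', 0 < z := fun z hz => ha'.pos.trans_le hz.1
  obtain ⟨C, hC⟩ := hcomp.exists_bound_of_continuousOn
    (hk₁.mono fun p hp => ⟨hpos _ hp.1, hpos _ hp.2⟩)
  have hint : ∀ {q : ℝ → ℝ → ℂ}, ContinuousOn (Function.uncurry q) (Ioi 0 ×ˢ Ioi 0) →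
      ∀ z, 0 < z → IntegrableOn (fun y => q z y * u y) (intervals a) := fun hq z hz =>
    ha.integrableOn ((continuousOn_section_right hq hz).mul hu)
  refine (hasDerivAt_integral_of_dominated_loc_of_deriv_le (μ := volume.restrict (intervals a))
    (F := fun z y => k z y * u y) (F' := fun z y => k₁ z y * u y) (s := Ioo lo' hi')
    (bound := fun y => C * ‖u y‖) (Ioo_mem_nhds hx'.1 hx'.2) ?_ (hint hk x hx)
    (hint hk₁ x hx).aestronglyMeasurable ?_ ((ha.integrableOn hu).norm.const_mul C) ?_).2
  · filter_upwards [Ioi_mem_nhds hx] with z hz using (hint hk z hz).aestronglyMeasurable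
  · filter_upwards [ae_restrict_mem (measurableSet_intervals a)] with y hy z hz
    rw [norm_mul]
    exact mul_le_mul_of_nonneg_right
      (hC (z, y) ⟨Ioo_subset_Icc_self hz, ha'.intervals_subset hy⟩) (norm_nonneg _)
  · filter_upwards [ae_restrict_mem (measurableSet_intervals a)] with y hy z hz
    exact (hd z y (hpos z (Ioo_subset_Icc_self hz)) (ha.intervals_pos hy)).mul_const _

/-! ### Solutions of the resolvent equation -/

/-- The kernel `k(x,y) χ_J(y)`. -/
noncomputable def cutKernel (k : ℝ → ℝ → ℂ) (a : Fin (2 * m) → ℝ) (x y : ℝ) : ℂ :=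
  k x y * (intervals a).indicator 1 y

/-- `u` is continuous and `u = h + K u` on `(0, ∞)`. -/
structure Solves (k : ℝ → ℝ → ℂ) (a : Fin (2 * m) → ℝ) (h u : ℝ → ℂ) : Prop where
  cont : ContinuousOn u (Ioi 0)
  eq : ∀ x, 0 < x → u x = h x + ∫ y in intervals a, k x y * u y

theorem EndPts.isResolventSolution_iff (ha : EndPts lo hi a)
    (hk : ContinuousOn (Function.uncurry k) (Ioi 0 ×ˢ Ioi 0)) :
    IsResolventSolution (cutKernel k a) h u ↔ Solves k a h u := by
  have h1 : ∀ x y, cutKernel k a x y * u y = (intervals a).indicator (fun y => k x y * u y) y := by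
    intro x y
    unfold cutKernel indicator
    split_ifs <;> simp
  have h2 : Ioi 0 ∩ intervals a = intervals a :=
    inter_eq_right.2 fun x hx => ha.intervals_pos hx
  have h3 : ∀ x, ∫ y in Ioi (0 : ℝ), cutKernel k a x y * u y
      = ∫ y in intervals a, k x y * u y := by
    intro x
    simp only [h1]
    rw [setIntegral_indicator (measurableSet_intervals a), h2]
  constructor
  · rintro ⟨hc, hs⟩
    refine ⟨hc, fun x hx => ?_⟩
    rw [← h3, ← (hs x hx).2]
    ring
  · rintro ⟨hc, hs⟩
    refine ⟨hc, fun x hx => ⟨?_, ?_⟩⟩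
    · simp only [h1]
      rw [IntegrableOn, integrable_indicator_iff (measurableSet_intervals a), IntegrableOn,
        Measure.restrict_restrict (measurableSet_intervals a), inter_comm, h2]
      exact ha.integrableOn ((continuousOn_section_right hk hx).mul hc)
    · rw [h3, hs x hx]
      ring

section Unit

variable {B : ℝ} (ha : EndPts lo hi a)
  (hk : ContinuousOn (Function.uncurry k) (Ioi 0 ×ˢ Ioi 0))
  (hB : BoundedKernel (clampKernel ha.lt.le k) B)

theorem EndPts.intervalOp_clampFun (hu : ContinuousOn u (Ioi 0)) (x : ℝ) :
    intervalOp lo hi hB a (clampFun ha.pos ha.lt.le hu) x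
      = ∫ y in intervals a, k (projIcc lo hi ha.lt.le x) y * u y := by
  rw [ha.intervalOp_apply]
  refine setIntegral_congr_fun (measurableSet_intervals a) fun y hy => ?_
  rw [clampFun_of_mem _ _ _ (ha.intervals_subset hy), clampKernel,
    clamp_of_mem _ (ha.intervals_subset hy)]

/-- Because `J ⊆ [lo, hi]`, the integral sees only values inside the interval. A solution on `(0,
∞)`, extended by constants from `[lo, hi]`, solves the operator equation. -/
theorem EndPts.clampFun_eq_inverse (hunit : IsUnit (1 - intervalOp lo hi hB a))
    (hh : ContinuousOn h (Ioi 0)) (hs : Solves k a h u) :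
    clampFun ha.pos ha.lt.le hs.cont
      = Ring.inverse (1 - intervalOp lo hi hB a) (clampFun ha.pos ha.lt.le hh) := by
  have h1 : clampFun ha.pos ha.lt.le hh
      = (1 - intervalOp lo hi hB a) (clampFun ha.pos ha.lt.le hs.cont) := by
    ext x
    change _ = clampFun ha.pos ha.lt.le hs.cont x - intervalOp lo hi hB a _ x
    rw [ha.intervalOp_clampFun hB, clampFun_apply, clampFun_apply,
      hs.eq _ (clamp_pos ha.pos ha.lt.le x)]
    ring
  rw [h1]
  exact (DFunLike.congr_fun (Ring.inverse_mul_cancel _ hunit) _).symm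

theorem EndPts.apply_eq_inverse (hunit : IsUnit (1 - intervalOp lo hi hB a))
    (hh : ContinuousOn h (Ioi 0)) (hs : Solves k a h u) {x : ℝ} (hx : x ∈ Icc lo hi) :
    u x = Ring.inverse (1 - intervalOp lo hi hB a) (clampFun ha.pos ha.lt.le hh) x := by
  rw [← ha.clampFun_eq_inverse hB hunit hh hs, clampFun_of_mem _ _ _ hx]

include hk in
-- The operator inverse gives a solution on `[lo, hi]` only. Its values on `J` determine the
-- right-hand side of the equation everywhere, and this right-hand side is taken as the solution.
theorem EndPts.exists_solves (hunit : IsUnit (1 - intervalOp lo hi hB a))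
    (hh : ContinuousOn h (Ioi 0)) : ∃ u, Solves k a h u := by
  set U := Ring.inverse (1 - intervalOp lo hi hB a) (clampFun ha.pos ha.lt.le hh) with hU
  have h1 : ∀ x ∈ Icc lo hi, U x = h x + ∫ y in intervals a, k x y * U y := by
    intro x hx
    have h2 := DFunLike.congr_fun (Ring.mul_inverse_cancel _ hunit) (clampFun ha.pos ha.lt.le hh)
    have h3 : U x - intervalOp lo hi hB a U x = clampFun ha.pos ha.lt.le hh x :=
      congrArg (fun f : BCF => f x) h2
    rw [clampFun_of_mem _ _ _ hx, ha.intervalOp_apply] at h3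
    have h4 : ∫ y in intervals a, clampKernel ha.lt.le k x y * U y
        = ∫ y in intervals a, k x y * U y :=
      setIntegral_congr_fun (measurableSet_intervals a) fun y hy => by
        rw [clampKernel_of_mem _ hx (ha.intervals_subset hy)]
    rw [← h3, h4, sub_add_cancel]
  refine ⟨fun x => h x + ∫ y in intervals a, k x y * U y,
    hh.add (ha.continuousOn_integral hk U.continuous.continuousOn), fun x hx => ?_⟩
  congr 1
  refine setIntegral_congr_fun (measurableSet_intervals a) fun y hy => ?_
  rw [← h1 y (ha.intervals_subset hy)]

/-- By the equation a solution is determined by its values on `J`, where it agrees with the operator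
inverse. -/
theorem EndPts.solves_unique (hunit : IsUnit (1 - intervalOp lo hi hB a))
    (hh : ContinuousOn h (Ioi 0)) {v : ℝ → ℂ} (hu : Solves k a h u) (hv : Solves k a h v) :
    EqOn u v (Ioi 0) := by
  intro x hx
  rw [hu.eq x hx, hv.eq x hx]
  congr 1
  refine setIntegral_congr_fun (measurableSet_intervals a) fun y hy => ?_
  rw [ha.apply_eq_inverse hB hunit hh hu (ha.intervals_subset hy),
    ha.apply_eq_inverse hB hunit hh hv (ha.intervals_subset hy)]

include hk in
theorem EndPts.isInvertibleOneSub (hunit : IsUnit (1 - intervalOp lo hi hB a)) :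
    IsInvertibleOneSub (cutKernel k a) := by
  intro h hh
  simp only [ha.isResolventSolution_iff hk]
  exact ⟨ha.exists_solves hk hB hunit hh, fun u v hu hv => ha.solves_unique hB hunit hh hu hv⟩

include hk in
theorem EndPts.solves_oneSubInv (hunit : IsUnit (1 - intervalOp lo hi hB a))
    (hh : ContinuousOn h (Ioi 0)) : Solves k a h (oneSubInv (cutKernel k a) h) := by
  rw [← ha.isResolventSolution_iff hk]
  refine Classical.epsilon_spec (p := IsResolventSolution (cutKernel k a) h) ?_
  simp only [ha.isResolventSolution_iff hk]
  exact ha.exists_solves hk hB hunit hh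

theorem EndPts.kernelSection_clampKernel :
    kernelSection hB (a l) = clampFun ha.pos ha.lt.le
      (continuousOn_section_left hk (ha.pos_apply l)) := by
  ext x
  change clampKernel ha.lt.le k x (a l) = k _ (a l)
  rw [clampKernel, clamp_of_mem _ (Ioo_subset_Icc_self (ha.mem l))]
  rfl

/-! ### Derivatives in the end points -/

variable (hu : UniformContinuous (Function.uncurry (clampKernel ha.lt.le k)))
  (hunit : IsUnit (1 - intervalOp lo hi hB a)) (hh : ContinuousOn h (Ioi 0))

include hk hu hunit in
theorem EndPts.eventually_oneSubInv_eq :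
    ∀ᶠ t in 𝓝 (a l), ∀ x ∈ Icc lo hi, oneSubInv (cutKernel k (Function.update a l t)) h x
      = Ring.inverse (1 - intervalOp lo hi hB (Function.update a l t))
          (clampFun ha.pos ha.lt.le hh) x := by
  filter_upwards [ha.eventually_update l, ha.eventually_isUnit hB hu hunit l] with t ht htu x hx
  exact ht.apply_eq_inverse hB htu hh (ht.solves_oneSubInv hk hB htu hh) hx

include hk hu hunit in
theorem EndPts.hasDerivAt_inverse {ρ : ℝ → ℂ} (hs : Solves k a h u)
    (hρ : Solves k a (fun x => k x (a l)) ρ) :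
    HasDerivAt (fun t => Ring.inverse (1 - intervalOp lo hi hB (Function.update a l t))
        (clampFun ha.pos ha.lt.le hh))
      ((endSign l * u (a l)) • clampFun ha.pos ha.lt.le hρ.cont) (a l) := by
  have h1 := ha.hasDerivAt_resolvent (l := l) hB hu hunit (clampFun ha.pos ha.lt.le hh)
  rwa [ha.kernelSection_clampKernel hk hB, ← ha.clampFun_eq_inverse hB hunit _ hρ,
    ← ha.apply_eq_inverse hB hunit hh hs (Ioo_subset_Icc_self (ha.mem l))] at h1

include hk hu hunit hh in
theorem EndPts.hasDerivAt_oneSubInv {ρ : ℝ → ℂ} (hs : Solves k a h u)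
    (hρ : Solves k a (fun x => k x (a l)) ρ) {x : ℝ} (hx : x ∈ Icc lo hi) :
    HasDerivAt (fun t => oneSubInv (cutKernel k (Function.update a l t)) h x)
      (endSign l * u (a l) * ρ x) (a l) := by
  have h1 := ha.hasDerivAt_inverse hk hB hu hunit hh hs hρ
  have h2 := ((BoundedContinuousFunction.evalCLM ℝ x).hasFDerivAt.comp_hasDerivAt (a l) h1)
  refine (h2.congr_of_eventuallyEq ?_).congr_deriv ?_
  · filter_upwards [ha.eventually_oneSubInv_eq hk hB hu hunit hh (l := l)] with t ht using ht x hx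
  · change endSign l * u (a l) * clampFun ha.pos ha.lt.le hρ.cont x = _
    rw [clampFun_of_mem _ _ _ hx]

include hk hu hunit hh in
theorem EndPts.hasDerivAt_oneSubInv_self {ρ : ℝ → ℂ} {u' : ℂ} (hs : Solves k a h u)
    (hρ : Solves k a (fun x => k x (a l)) ρ) (hu' : HasDerivAt u u' (a l)) :
    HasDerivAt (fun t => oneSubInv (cutKernel k (Function.update a l t)) h t)
      (u' + endSign l * u (a l) * ρ (a l)) (a l) := by
  have h1 := ha.hasDerivAt_inverse hk hB hu hunit hh hs hρ
  have hl := Ioo_subset_Icc_self (ha.mem l)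
  have h2 := hasDerivAt_apply_self (v := u') h1 (by
    rw [Function.update_eq_self]
    refine hu'.congr_of_eventuallyEq ?_
    filter_upwards [Ioo_mem_nhds (ha.mem l).1 (ha.mem l).2] with x hx
    exact (ha.apply_eq_inverse hB hunit hh hs (Ioo_subset_Icc_self hx)).symm)
  refine (h2.congr_of_eventuallyEq ?_).congr_deriv ?_
  · filter_upwards [ha.eventually_oneSubInv_eq hk hB hu hunit hh (l := l),
      Ioo_mem_nhds (ha.mem l).1 (ha.mem l).2] with t ht htl using ht t (Ioo_subset_Icc_self htl)
  · change u' + endSign l * u (a l) * clampFun ha.pos ha.lt.le hρ.cont (a l) = _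
    rw [clampFun_of_mem _ _ _ hl]

include hk hu hunit hh in
theorem EndPts.hasDerivAt_integral_oneSubInv {ρ g : ℝ → ℂ} (hs : Solves k a h u)
    (hρ : Solves k a (fun x => k x (a l)) ρ) (hg : ContinuousOn g (Ioi 0)) :
    HasDerivAt (fun t => ∫ x in intervals (Function.update a l t),
        g x * oneSubInv (cutKernel k (Function.update a l t)) h x)
      (endSign l * u (a l) * (g (a l) + ∫ x in intervals a, g x * ρ x)) (a l) := by
  have h1 := ha.hasDerivAt_inverse hk hB hu hunit hh hs hρ
  have hl := Ioo_subset_Icc_self (ha.mem l)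
  -- The integral of `g` against a function is the interval operator with kernel `g(y)`, independent
  -- of `x`, evaluated at `a_l`; the product rule for such operators then applies.
  obtain ⟨⟨C, hC⟩, hCu⟩ := exists_boundedKernel_clampKernel (k := fun _ y => g y) ha.pos ha.lt.le
    (hg.comp continuousOn_snd fun p hp => hp.2)
  have h2 := ((BoundedContinuousFunction.evalCLM ℝ (a l)).hasFDerivAt.comp_hasDerivAt (a l)
    (ha.hasDerivAt_intervalOp hC hCu h1))
  refine (h2.congr_of_eventuallyEq ?_).congr_deriv ?_
  · filter_upwards [ha.eventually_oneSubInv_eq hk hB hu hunit hh (l := l),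
      ha.eventually_update l] with t ht hat
    change _ = intervalOp lo hi hC (Function.update a l t) _ (a l)
    rw [hat.intervalOp_apply]
    refine setIntegral_congr_fun (measurableSet_intervals _) fun x hx => ?_
    rw [ht x (hat.intervals_subset hx), clampKernel_of_mem _ hl (hat.intervals_subset hx)]
  · rw [Function.update_eq_self,
      ← ha.apply_eq_inverse hB hunit hh hs hl]
    change endSign l * u (a l) * clampKernel ha.lt.le (fun _ y => g y) (a l) (a l)
      + intervalOp lo hi hC a (_ • _) (a l) = _
    rw [clampKernel_of_mem _ hl hl, map_smul]
    change _ + endSign l * u (a l) * intervalOp lo hi hC a _ (a l) = _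
    rw [ha.intervalOp_apply, mul_add]
    congr 2
    refine setIntegral_congr_fun (measurableSet_intervals _) fun x hx => ?_
    rw [clampKernel_of_mem _ hl (ha.intervals_subset hx),
      clampFun_of_mem _ _ _ (ha.intervals_subset hx)]

end Unit

/-! ### The Fredholm determinant -/

/-- The factors `χ_J(z_j)` come out of the columns of the determinant. The integrand then vanishes
unless all `z_j` lie in `J`, so the half line may be replaced by `[lo, hi]`. -/
theorem EndPts.fredholmTerm_cutKernel (ha : EndPts lo hi a) (n : ℕ) :
    fredholmTerm (volume.restrict (Ioi 0)) (cutKernel k a) n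
      = (-1) ^ n / (n.factorial : ℂ) * fredholmCoeff (volume.restrict (Icc lo hi))
          (clampKernel ha.lt.le k) ((intervals a).indicator 1) n := by
  rw [fredholmTerm, fredholmCoeff]
  congr 1
  have h1 : ∀ z : Fin n → ℝ, (Matrix.of fun i j => cutKernel k a (z i) (z j)).det
      = (∏ i, (intervals a).indicator 1 (z i)) * kernelDet k z z := by
    intro z
    rw [kernelDet, ← Matrix.det_mul_row]
    congr 1
    ext i j
    simp [cutKernel, mul_comm]
  simp only [h1]
  rw [← Measure.restrict_pi_pi, ← Measure.restrict_pi_pi,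
    setIntegral_eq_of_subset_of_forall_sdiff_eq_zero (s := univ.pi fun _ : Fin n => Icc lo hi)]
  · refine setIntegral_congr_fun (MeasurableSet.univ_pi fun _ => measurableSet_Icc) fun z hz => ?_
    simp only [kernelDet]
    congr 3
    ext i j
    rw [clampKernel_of_mem _ (hz i (mem_univ _)) (hz j (mem_univ _))]
  · exact MeasurableSet.univ_pi fun _ => measurableSet_Ioi
  · exact pi_mono fun i _ x hx => ha.pos.trans_le hx.1
  · rintro z ⟨-, hz⟩
    simp only [Set.mem_pi, mem_univ, true_implies, not_forall] at hz
    obtain ⟨i, hi'⟩ := hz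
    rw [Finset.prod_eq_zero (Finset.mem_univ i), zero_mul]
    exact indicator_of_notMem (fun h => hi' (ha.intervals_subset h)) _

theorem EndPts.fredholmDet_cutKernel (ha : EndPts lo hi a) :
    fredholmDet (volume.restrict (Ioi 0)) (cutKernel k a)
      = fredholmSum (volume.restrict (Icc lo hi)) (clampKernel ha.lt.le k)
          ((intervals a).indicator 1) := by
  simp only [fredholmDet, ha.fredholmTerm_cutKernel, fredholmSum]

theorem EndPts.summable_fredholmTerm (ha : EndPts lo hi a)
    (hk : ContinuousOn (Function.uncurry k) (Ioi 0 ×ˢ Ioi 0)) :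
    Summable (fredholmTerm (volume.restrict (Ioi 0)) (cutKernel k a)) := by
  obtain ⟨⟨B, hB⟩, -⟩ := exists_boundedKernel_clampKernel ha.pos ha.lt.le hk
  have := summable_fredholm_term (μ := volume.restrict (Icc lo hi)) hB (isWeight_indicator a)
  exact this.congr fun n => (ha.fredholmTerm_cutKernel n).symm

theorem EndPts.isUnit_intervalOp (ha : EndPts lo hi a) {B : ℝ}
    (hB : BoundedKernel (clampKernel ha.lt.le k) B)
    (hd : fredholmDet (volume.restrict (Ioi 0)) (cutKernel k a) ≠ 0) :
    IsUnit (1 - intervalOp lo hi hB a) :=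
  isUnit_one_sub_kernelOp hB (isWeight_indicator a) (by rwa [← ha.fredholmDet_cutKernel])

/-- Fredholm's first identity says that the section of the minor at `a_l` solves the resolvent
equation with the section of the kernel multiplied by the determinant. The minor is therefore the
determinant times the resolvent kernel. -/
theorem EndPts.fredholmMinor_eq (ha : EndPts lo hi a)
    (hk : ContinuousOn (Function.uncurry k) (Ioi 0 ×ˢ Ioi 0)) {B : ℝ}
    (hB : BoundedKernel (clampKernel ha.lt.le k) B)
    (hd : fredholmDet (volume.restrict (Ioi 0)) (cutKernel k a) ≠ 0) {ρ : ℝ → ℂ}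
    (hρ : Solves k a (fun x => k x (a l)) ρ) :
    fredholmMinor (volume.restrict (Icc lo hi)) (clampKernel ha.lt.le k)
        ((intervals a).indicator 1) (a l) (a l)
      = fredholmDet (volume.restrict (Ioi 0)) (cutKernel k a) * ρ (a l) := by
  have hw := isWeight_indicator a
  have hunit := ha.isUnit_intervalOp hB hd
  obtain ⟨D, hD⟩ := boundedKernel_fredholmMinor (μ := volume.restrict (Icc lo hi)) hB hw
  have hl := Ioo_subset_Icc_self (ha.mem l)
  have hc := continuousOn_section_left hk (ha.pos_apply l)
  have h1 : (1 - intervalOp lo hi hB a) (kernelSection hD (a l))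
      = fredholmDet (volume.restrict (Ioi 0)) (cutKernel k a) • clampFun ha.pos ha.lt.le hc := by
    rw [← ha.kernelSection_clampKernel hk hB]
    ext x
    change fredholmMinor _ _ _ x (a l) - ∫ y, (intervals a).indicator 1 y *
        clampKernel ha.lt.le k x y * fredholmMinor _ _ _ y (a l) ∂(volume.restrict (Icc lo hi))
      = _ * clampKernel ha.lt.le k x (a l)
    rw [fredholmMinor_eq_left hB hw, ha.fredholmDet_cutKernel]
    ring
  have h2 : kernelSection hD (a l)
      = fredholmDet (volume.restrict (Ioi 0)) (cutKernel k a) •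
        clampFun ha.pos ha.lt.le hρ.cont := by
    rw [ha.clampFun_eq_inverse hB hunit hc hρ, ← map_smul, ← h1]
    exact (DFunLike.congr_fun (Ring.inverse_mul_cancel _ hunit) _).symm
  have h3 : kernelSection hD (a l) (a l) = fredholmDet (volume.restrict (Ioi 0)) (cutKernel k a) *
      clampFun ha.pos ha.lt.le hρ.cont (a l) := congrArg (fun f : BCF => f (a l)) h2
  rwa [clampFun_of_mem _ _ _ hl] at h3

/-- The first order expansion of the Fredholm determinant in an end point. -/
theorem EndPts.norm_fredholmDet_sub_le (ha : EndPts lo hi a) {B D : ℝ}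
    (hB : BoundedKernel (clampKernel ha.lt.le k) B) (l : Fin (2 * m))
    (hD : BoundedKernel (fredholmMinor (volume.restrict (Icc lo hi)) (clampKernel ha.lt.le k)
        ((intervals a).indicator 1)) D) :
    ∃ C, ∀ᶠ t in 𝓝 (a l),
      ‖fredholmDet (volume.restrict (Ioi 0)) (cutKernel k (Function.update a l t))
        - fredholmDet (volume.restrict (Ioi 0)) (cutKernel k a)
        + endSign l * ∫ x in a l..t, fredholmMinor (volume.restrict (Icc lo hi))
          (clampKernel ha.lt.le k) ((intervals a).indicator 1) x x‖ ≤ C * |t - a l| ^ 2 := by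
  obtain ⟨C, hC'⟩ := norm_fredholmSum_sub_le (volume.restrict (Icc lo hi)) hB
  have hC := fun v => hC' ((intervals a).indicator 1) v (isWeight_indicator a)
  clear hC'
  simp only [ha.fredholmDet_cutKernel]
  generalize fredholmMinor (volume.restrict (Icc lo hi)) (clampKernel ha.lt.le k)
    ((intervals a).indicator 1) = R at *
  have hdiag : Continuous fun x => R x x := hD.cont.comp (continuous_id.prodMk continuous_id)
  have hint : ∀ b : Fin (2 * m) → ℝ, Integrable (fun x =>
      (intervals b).indicator (1 : ℝ → ℂ) x * R x x) (volume.restrict (Icc lo hi)) := by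
    intro b
    refine Integrable.of_bound ((isWeight_indicator b).meas.mul
      hdiag.measurable).aestronglyMeasurable D (ae_of_all _ fun x => ?_)
    rw [norm_mul]
    exact (mul_le_of_le_one_left (norm_nonneg _) ((isWeight_indicator b).bound x)).trans
      (hD.bound _ _)
  refine ⟨|C|, ?_⟩
  filter_upwards [ha.eventually_update l] with t ht
  obtain ⟨v, hv⟩ : ∃ v : ℝ → ℂ, ∀ x, v x =
    (intervals (Function.update a l t)).indicator (1 : ℝ → ℂ) x
      - (intervals a).indicator (1 : ℝ → ℂ) x := ⟨_, fun _ => rfl⟩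
  have hvle : ∀ x, ‖v x‖ ≤ (uIcc (a l) t).indicator (1 : ℝ → ℝ) x := fun x => by
    rw [hv]; exact indicator_intervals_update_sub_le a l t x
  have hvw : IsWeight v := by
    refine ⟨?_, fun x => (hvle x).trans (by unfold indicator; split_ifs <;> simp)⟩
    rw [funext hv]
    exact (isWeight_indicator _).meas.sub (isWeight_indicator _).meas
  have hsum : (fun x => (intervals a).indicator (1 : ℝ → ℂ) x + v x)
      = (intervals (Function.update a l t)).indicator 1 := by
    ext x; simp [hv]
  have h1 := hC v hvw (by rw [hsum]; exact isWeight_indicator _)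
  have h2 : ∫ x, v x * R x x ∂(volume.restrict (Icc lo hi))
      = endSign l * ∫ x in a l..t, R x x := by
    rw [← ha.integral_intervals_update_sub ht hdiag.continuousOn.integrableOn_Icc,
      ← ha.integral_weight, ← ht.integral_weight, ← integral_sub (hint _) (hint _)]
    exact integral_congr_ae (ae_of_all _ fun x => by simp only [hv]; ring)
  have h3 : ∫ x, ‖v x‖ ∂(volume.restrict (Icc lo hi)) ≤ |t - a l| := by
    have h4 : ∫ x, ‖v x‖ ∂(volume.restrict (Icc lo hi))
        ≤ ∫ x, (uIcc (a l) t).indicator (1 : ℝ → ℝ) x ∂(volume.restrict (Icc lo hi)) := by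
      refine integral_mono_of_nonneg (ae_of_all _ fun x => norm_nonneg _) ?_
        (ae_of_all _ hvle)
      exact (integrable_const (1 : ℝ)).indicator measurableSet_uIcc
    refine h4.trans ?_
    rw [integral_indicator_one measurableSet_uIcc, measureReal_restrict_apply measurableSet_uIcc]
    refine (measureReal_mono inter_subset_left (by simp)).trans ?_
    simp [Measure.real]
  rw [hsum, h2] at h1
  rw [ht.fredholmDet_cutKernel]
  refine h1.trans ((mul_le_mul_of_nonneg_right (le_abs_self C) (sq_nonneg _)).trans ?_)
  exact mul_le_mul_of_nonneg_left (pow_le_pow_left₀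
    (integral_nonneg fun x => norm_nonneg _) h3 2) (abs_nonneg _)

/-- The derivative of the Fredholm determinant in an end point. -/
theorem EndPts.hasDerivAt_fredholmDet (ha : EndPts lo hi a)
    (hk : ContinuousOn (Function.uncurry k) (Ioi 0 ×ˢ Ioi 0))
    (hd : fredholmDet (volume.restrict (Ioi 0)) (cutKernel k a) ≠ 0) {ρ : ℝ → ℂ}
    (hρ : Solves k a (fun x => k x (a l)) ρ) :
    HasDerivAt (fun t => fredholmDet (volume.restrict (Ioi 0))
        (cutKernel k (Function.update a l t)))
      (-endSign l * ρ (a l) * fredholmDet (volume.restrict (Ioi 0)) (cutKernel k a)) (a l) := by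
  obtain ⟨⟨B, hB⟩, -⟩ := exists_boundedKernel_clampKernel ha.pos ha.lt.le hk
  obtain ⟨D, hD⟩ := boundedKernel_fredholmMinor (μ := volume.restrict (Icc lo hi)) hB
    (isWeight_indicator a)
  obtain ⟨C, hmain⟩ := ha.norm_fredholmDet_sub_le hB l hD
  have hval := ha.fredholmMinor_eq hk hB hd hρ
  set d := fredholmDet (volume.restrict (Ioi 0)) (cutKernel k a) with hdd
  generalize fredholmMinor (volume.restrict (Icc lo hi)) (clampKernel ha.lt.le k)
        ((intervals a).indicator 1) = R at *
  have hdiag : Continuous fun x => R x x := hD.cont.comp (continuous_id.prodMk continuous_id)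
  have h1 : HasDerivAt (fun t => endSign l * ∫ x in a l..t, R x x)
      (endSign l * R (a l) (a l)) (a l) :=
    (intervalIntegral.integral_hasDerivAt_right (hdiag.intervalIntegrable _ _)
      (hdiag.stronglyMeasurableAtFilter _ _) hdiag.continuousAt).const_mul _
  have h2 : HasDerivAt (fun t => fredholmDet (volume.restrict (Ioi 0))
      (cutKernel k (Function.update a l t)) - d + endSign l * ∫ x in a l..t, R x x) 0 (a l) := by
    rw [hasDerivAt_iff_isLittleO]
    simp only [intervalIntegral.integral_same, Function.update_eq_self, ← hdd, sub_self, mul_zero,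
      add_zero, sub_zero, smul_zero]
    refine (Asymptotics.IsBigO.of_bound C (g := fun t => |t - a l| ^ 2) ?_).trans_isLittleO ?_
    · filter_upwards [hmain] with t ht
      rwa [Real.norm_of_nonneg (by positivity : 0 ≤ |t - a l| ^ 2)]
    · have h3 : Tendsto (fun t => t - a l) (𝓝 (a l)) (𝓝 0) := by
        have : Continuous fun t => t - a l := by fun_prop
        simpa using this.tendsto (a l)
      have h4 := ((Asymptotics.isLittleO_one_iff ℝ).2 h3).mul_isBigO
        (Asymptotics.isBigO_refl (fun t => t - a l) (𝓝 (a l)))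
      simpa [sq] using h4
  have h3 := (h2.sub h1).add_const d
  refine (h3.congr_of_eventuallyEq (Eventually.of_forall fun t => ?_)).congr_deriv ?_
  · simp
  · rw [hval]; ring

end Bridge

end GenBessel

namespace GenBessel

open MeasureTheory Set Filter Topology

/-! ### Duality and commutators for the resolvent of an integrable kernel -/

section Resolvent

variable {m : ℕ} {lo hi : ℝ} {a : Fin (2 * m) → ℝ} {l : Fin (2 * m)} {k : ℝ → ℝ → ℂ}
  {h u g v : ℝ → ℂ}

/-! ### Linear combinations of solutions -/

theorem Solves.congr {h' : ℝ → ℂ} (hs : Solves k a h u) (hh : EqOn h h' (Ioi 0)) :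
    Solves k a h' u :=
  ⟨hs.cont, fun x hx => by rw [hs.eq x hx, hh hx]⟩

theorem Solves.const_mul (c : ℂ) (hs : Solves k a h u) :
    Solves k a (fun x => c * h x) (fun x => c * u x) := by
  refine ⟨continuousOn_const.mul hs.cont, fun x hx => ?_⟩
  rw [hs.eq x hx, mul_add, ← integral_const_mul]
  congr 2
  ext y
  ring

theorem EndPts.integrableOn_mul (ha : EndPts lo hi a)
    (hk : ContinuousOn (Function.uncurry k) (Ioi 0 ×ˢ Ioi 0)) (hu : ContinuousOn u (Ioi 0))
    {x : ℝ} (hx : 0 < x) : IntegrableOn (fun y => k x y * u y) (intervals a) :=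
  ha.integrableOn ((continuousOn_section_right hk hx).mul hu)

theorem EndPts.solves_add (ha : EndPts lo hi a)
    (hk : ContinuousOn (Function.uncurry k) (Ioi 0 ×ˢ Ioi 0)) (hs : Solves k a h u)
    (hs' : Solves k a g v) : Solves k a (fun x => h x + g x) (fun x => u x + v x) := by
  refine ⟨hs.cont.add hs'.cont, fun x hx => ?_⟩
  simp only [mul_add]
  rw [integral_add (ha.integrableOn_mul hk hs.cont hx) (ha.integrableOn_mul hk hs'.cont hx),
    hs.eq x hx, hs'.eq x hx]
  ring

theorem EndPts.solves_sum (ha : EndPts lo hi a)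
    (hk : ContinuousOn (Function.uncurry k) (Ioi 0 ×ˢ Ioi 0)) {ι : Type*} [Fintype ι]
    {H U : ι → ℝ → ℂ} (hs : ∀ i, Solves k a (H i) (U i)) (c : ι → ℂ) :
    Solves k a (fun x => ∑ i, c i * H i x) (fun x => ∑ i, c i * U i x) := by
  refine ⟨continuousOn_finsetSum _ fun i _ => continuousOn_const.mul (hs i).cont, fun x hx => ?_⟩
  have hterm : ∀ y, k x y * ∑ i, c i * U i y = ∑ i, c i * (k x y * U i y) := fun y => by
    rw [Finset.mul_sum]; exact Finset.sum_congr rfl fun i _ => by ring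
  simp only [hterm]
  rw [integral_finsetSum _ fun i _ => (ha.integrableOn_mul hk (hs i).cont hx).const_mul _,
    ← Finset.sum_add_distrib]
  refine Finset.sum_congr rfl fun i _ => ?_
  rw [integral_const_mul, (hs i).eq x hx]
  ring

/-! ### Duality -/

/-- `∫_J g u = ∫_J v h` if `u` is the solution for `k` and `h`, and `v` for the transposed kernel
and `g`. -/
theorem EndPts.integral_mul_comm (ha : EndPts lo hi a)
    (hk : ContinuousOn (Function.uncurry k) (Ioi 0 ×ˢ Ioi 0)) (hs : Solves k a h u)
    (hs' : Solves (fun x y => k y x) a g v) :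
    ∫ x in intervals a, g x * u x = ∫ x in intervals a, v x * h x := by
  have hpos : ∀ z ∈ Icc lo hi, 0 < z := fun z hz => ha.pos.trans_le hz.1
  have hI1 := ha.continuousOn_integral hk hs.cont
  have hI2 := ha.continuousOn_integral (continuousOn_uncurry_flip hk) hs'.cont
  -- Both sides equal the integral of `v u` minus the double integral of `v k u`; only the order of
  -- integration differs.
  have h1 : ∫ x in intervals a, g x * u x = (∫ x in intervals a, v x * u x)
      - ∫ x in intervals a, (∫ y in intervals a, k y x * v y) * u x := by
    refine Eq.trans ?_ (integral_sub (ha.integrableOn (hs'.cont.mul hs.cont))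
      (ha.integrableOn (hI2.mul hs.cont)))
    refine setIntegral_congr_fun (measurableSet_intervals a) fun x hx => ?_
    rw [hs'.eq x (ha.intervals_pos hx)]
    ring
  have h2 : ∫ x in intervals a, v x * h x = (∫ x in intervals a, v x * u x)
      - ∫ y in intervals a, v y * (∫ x in intervals a, k y x * u x) := by
    refine Eq.trans ?_ (integral_sub (ha.integrableOn (hs'.cont.mul hs.cont))
      (ha.integrableOn (hs'.cont.mul hI1)))
    refine setIntegral_congr_fun (measurableSet_intervals a) fun x hx => ?_
    rw [hs.eq x (ha.intervals_pos hx)]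
    ring
  rw [h1, h2]
  congr 1
  simp only [← integral_const_mul, ← integral_mul_const]
  rw [integral_integral_swap]
  · refine integral_congr_ae (ae_of_all _ fun y => integral_congr_ae (ae_of_all _ fun x => ?_))
    simp only
    ring
  · rw [Measure.prod_restrict]
    refine IntegrableOn.mono_set (t := Icc lo hi ×ˢ Icc lo hi) ?_
      (prod_mono ha.intervals_subset ha.intervals_subset)
    refine ContinuousOn.integrableOn_compact (isCompact_Icc.prod isCompact_Icc) ?_
    refine ContinuousOn.mul (ContinuousOn.mul ?_ ?_) ?_
    · exact hk.comp continuous_swap.continuousOn fun p hp => ⟨hpos _ hp.2, hpos _ hp.1⟩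
    · exact hs'.cont.comp continuousOn_snd fun p hp => hpos _ hp.2
    · exact hs.cont.comp continuousOn_fst fun p hp => hpos _ hp.1

/-- `g(a_l) + ∫_J g ρ_l = v(a_l)`, where `ρ_l` is the resolvent kernel at `a_l`. -/
theorem EndPts.add_integral_section (ha : EndPts lo hi a)
    (hk : ContinuousOn (Function.uncurry k) (Ioi 0 ×ˢ Ioi 0)) {ρ : ℝ → ℂ}
    (hρ : Solves k a (fun x => k x (a l)) ρ) (hs' : Solves (fun x y => k y x) a g v) :
    g (a l) + ∫ x in intervals a, g x * ρ x = v (a l) := by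
  rw [ha.integral_mul_comm hk hρ hs', hs'.eq _ (ha.pos_apply l)]
  simp only [mul_comm]

/-! ### Integrable kernels -/

variable {ι : Type*} [Fintype ι] {A B : ι → ℝ → ℂ} {α β : ℝ → ℂ} {k₁ k₂ : ℝ → ℝ → ℂ}

/-- The commutator of the operator with multiplication by `x` has the finite rank kernel `(x - y)
k(x, y) = ∑ A_j(x) B_j(y)`. This is the source of the sum over `j`. -/
theorem EndPts.solves_id_mul (ha : EndPts lo hi a) (hker : IntegrableKernel A B α β k k₁ k₂)
    (hs : Solves k a h u) :
    Solves k a (fun x => x * h x + ∑ j, (∫ y in intervals a, B j y * u y) * A j x)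
      (fun x => x * u x) := by
  refine ⟨Complex.continuous_ofReal.continuousOn.mul hs.cont, fun x hx => ?_⟩
  have h1 : ∑ j, (∫ y in intervals a, B j y * u y) * A j x
      = ∫ y in intervals a, ((x : ℂ) - y) * k x y * u y := by
    have h2 : ∀ y, 0 < y → ((x : ℂ) - y) * k x y * u y = ∑ j, B j y * u y * A j x := by
      intro y hy
      rw [← hker.sum_eq x y hx hy, Finset.sum_mul]
      exact Finset.sum_congr rfl fun j _ => by ring
    rw [setIntegral_congr_fun (measurableSet_intervals a) fun y hy =>
      h2 y (ha.intervals_pos hy), integral_finsetSum]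
    · simp only [integral_mul_const]
    · exact fun j _ => (ha.integrableOn ((hker.contB j).mul hs.cont)).mul_const _
  have hc : ContinuousOn (fun y : ℝ => (y : ℂ)) (Ioi 0) := Complex.continuous_ofReal.continuousOn
  have hkx := continuousOn_section_right hker.cont hx
  rw [h1, hs.eq x hx, mul_add, ← integral_const_mul, add_assoc, ← integral_add]
  · congr 2
    ext y
    ring
  · exact ha.integrableOn (((continuousOn_const.sub hc).mul hkx).mul hs.cont)
  · exact ha.integrableOn (hkx.mul (hc.mul hs.cont))

/-- The Euler derivative of a solution. -/
theorem EndPts.exists_hasDerivAt (ha : EndPts lo hi a) (hker : IntegrableKernel A B α β k k₁ k₂)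
    {h' : ℝ → ℂ} (hs : Solves k a h u) (hh : ∀ x, 0 < x → HasDerivAt h (h' x / x) x)
    (hh' : ContinuousOn h' (Ioi 0)) :
    ∃ u' : ℝ → ℂ, (∀ x, 0 < x → HasDerivAt u (u' x / x) x) ∧
      Solves k a (fun x => h' x + (∫ y in intervals a, β y * u y) * α x
        + ∑ l, -(endSign l * a l * u (a l)) * k x (a l)) u' := by
  have hc : ContinuousOn (fun y : ℝ => (y : ℂ)) (Ioi 0) := Complex.continuous_ofReal.continuousOn
  set u' : ℝ → ℂ := fun x => h' x + x * ∫ y in intervals a, k₁ x y * u y with hu'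
  have hcont : ContinuousOn u' (Ioi 0) :=
    hh'.add (hc.mul (ha.continuousOn_integral hker.cont₁ hs.cont))
  have hder : ∀ x, 0 < x → HasDerivAt u (u' x / x) x := by
    intro x hx
    have hx0 : (x : ℂ) ≠ 0 := by exact_mod_cast hx.ne'
    have h1 := (hh x hx).add (ha.hasDerivAt_integral hker.cont hker.cont₁ hker.deriv₁ hs.cont hx)
    refine (h1.congr_of_eventuallyEq ?_).congr_deriv ?_
    · filter_upwards [Ioi_mem_nhds hx] with y hy using hs.eq y hy
    · simp only [hu']
      field_simp
  refine ⟨u', hder, hcont, fun x hx => ?_⟩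
  have hkx := continuousOn_section_right hker.cont hx
  have hk1x := continuousOn_section_right hker.cont₁ hx
  have hk2x := continuousOn_section_right hker.cont₂ hx
  -- integration by parts
  have hG : ∀ y : ℝ, 0 < y → HasDerivAt (fun y : ℝ => y * k x y * u y)
      ((k x y + y * k₂ x y) * u y + k x y * u' y) y := by
    intro y hy
    have hy0 : (y : ℂ) ≠ 0 := by exact_mod_cast hy.ne'
    have h1 := (((hasDerivAt_id y).ofReal_comp.mul (hker.deriv₂ x y hx hy)).mul (hder y hy))
    refine h1.congr_deriv ?_
    simp only [id, Complex.ofReal_one, Pi.mul_apply]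
    field_simp
  have hparts := ha.integral_intervals_deriv hG
    (((hkx.add (hc.mul hk2x)).mul hs.cont).add (hkx.mul hcont))
  have hsplit : ∫ y in intervals a, ((k x y + y * k₂ x y) * u y + k x y * u' y)
      = (∫ y in intervals a, (k x y + y * k₂ x y) * u y) + ∫ y in intervals a, k x y * u' y :=
    integral_add (ha.integrableOn ((hkx.add (hc.mul hk2x)).mul hs.cont))
      (ha.integrableOn (hkx.mul hcont))
  -- The rank one identity trades `x k₁` for `α β` minus the `y`-derivative of `y k`, which
  -- integration by parts moves onto `u` with boundary terms at the `a_l`.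
  have hEuler : x * ∫ y in intervals a, k₁ x y * u y
      = (∫ y in intervals a, β y * u y) * α x
        - ∫ y in intervals a, (k x y + y * k₂ x y) * u y := by
    have h1 : IntegrableOn (fun y => β y * u y * α x) (intervals a) :=
      (ha.integrableOn (hker.contβ.mul hs.cont)).mul_const _
    have h2 : IntegrableOn (fun y => (k x y + y * k₂ x y) * u y) (intervals a) :=
      ha.integrableOn ((hkx.add (hc.mul hk2x)).mul hs.cont)
    rw [← integral_const_mul, ← integral_mul_const, ← integral_sub h1 h2]
    refine setIntegral_congr_fun (measurableSet_intervals a) fun y hy => ?_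
    linear_combination u y * hker.euler_eq x y hx (ha.intervals_pos hy)
  have hsum : ∑ l, -(endSign l * a l * u (a l)) * k x (a l)
      = -∑ l, endSign l * (a l * k x (a l) * u (a l)) := by
    rw [← Finset.sum_neg_distrib]
    exact Finset.sum_congr rfl fun l _ => by ring
  simp only [hu'] at hparts hsplit ⊢
  rw [hEuler, hsum, ← hparts, hsplit]
  ring

/-- `(x - a_l) ρ_l(x) = ∑_j Q_j(x) P_j(a_l)`. -/
theorem EndPts.sub_mul_section (ha : EndPts lo hi a) (hker : IntegrableKernel A B α β k k₁ k₂)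
    (huniq : ∀ h u v, ContinuousOn h (Ioi 0) → Solves k a h u → Solves k a h v →
      EqOn u v (Ioi 0))
    {Q P : ι → ℝ → ℂ} (hQ : ∀ j, Solves k a (A j) (Q j))
    (hP : ∀ j, Solves (fun x y => k y x) a (B j) (P j)) {ρ : ℝ → ℂ}
    (hρ : Solves k a (fun x => k x (a l)) ρ) {x : ℝ} (hx : 0 < x) :
    ((x : ℂ) - a l) * ρ x = ∑ j, P j (a l) * Q j x := by
  have hk := hker.cont
  -- By the commutator rule `(x - a_l) ρ_l` solves the equation with a combination of the `A_j` on
  -- the right. Duality recognizes the coefficients as `P_j(a_l)`, and uniqueness concludes.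
  have h1 := ha.solves_add hk (ha.solves_id_mul hker hρ) (hρ.const_mul (-(a l : ℂ)))
  have h2 := ha.solves_sum hk hQ fun j => P j (a l)
  have h3 : EqOn (fun x : ℝ => x * k x (a l) + ∑ j, (∫ y in intervals a, B j y * ρ y) * A j x
      + -(a l : ℂ) * k x (a l)) (fun x => ∑ j, P j (a l) * A j x) (Ioi 0) := by
    intro x hx
    have h4 : ∀ j, P j (a l) * A j x
        = A j x * B j (a l) + (∫ y in intervals a, B j y * ρ y) * A j x := fun j => by
      rw [← ha.add_integral_section hk hρ (hP j)]
      ring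
    simp only [h4, Finset.sum_add_distrib]
    rw [hker.sum_eq x (a l) hx (ha.pos_apply l)]
    ring
  have h5 := huniq _ _ _ (continuousOn_finsetSum _ fun j _ => continuousOn_const.mul (hker.contA j))
    (h1.congr h3) h2 hx
  rw [← h5]
  ring

theorem EndPts.sum_mul_eq_zero (ha : EndPts lo hi a) (hker : IntegrableKernel A B α β k k₁ k₂)
    (huniq : ∀ h u v, ContinuousOn h (Ioi 0) → Solves k a h u → Solves k a h v →
      EqOn u v (Ioi 0))
    {Q P : ι → ℝ → ℂ} (hQ : ∀ j, Solves k a (A j) (Q j))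
    (hP : ∀ j, Solves (fun x y => k y x) a (B j) (P j)) {ρ : ℝ → ℂ}
    (hρ : Solves k a (fun x => k x (a l)) ρ) : ∑ j, P j (a l) * Q j (a l) = 0 := by
  rw [← ha.sub_mul_section hker huniq hQ hP hρ (ha.pos_apply l), sub_self, zero_mul]

/-- The diagonal values of the resolvent kernel. -/
theorem EndPts.section_self (ha : EndPts lo hi a) (hker : IntegrableKernel A B α β k k₁ k₂)
    (huniq : ∀ h u v, ContinuousOn h (Ioi 0) → Solves k a h u → Solves k a h v →
      EqOn u v (Ioi 0))
    {Q P Q' : ι → ℝ → ℂ} (hQ : ∀ j, Solves k a (A j) (Q j))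
    (hP : ∀ j, Solves (fun x y => k y x) a (B j) (P j)) {ρ : ℝ → ℂ}
    (hρ : Solves k a (fun x => k x (a l)) ρ)
    (hQ' : ∀ j, HasDerivAt (Q j) (Q' j (a l)) (a l)) :
    ρ (a l) = ∑ j, P j (a l) * Q' j (a l) := by
  have hpos := ha.pos_apply l
  have h1 : HasDerivAt (fun x => ∑ j, P j (a l) * Q j x) (∑ j, P j (a l) * Q' j (a l)) (a l) :=
    HasDerivAt.fun_sum fun j _ => (hQ' j).const_mul _
  -- Since the sum vanishes at `a_l`, its difference quotient there is exactly `ρ(x)`.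
  have h2 : HasDerivAt (fun x => ∑ j, P j (a l) * Q j x) (ρ (a l)) (a l) := by
    rw [hasDerivAt_iff_tendsto_slope]
    have h3 : Tendsto ρ (𝓝[≠] (a l)) (𝓝 (ρ (a l))) :=
      (hρ.cont.continuousAt (Ioi_mem_nhds hpos)).tendsto.mono_left nhdsWithin_le_nhds
    refine h3.congr' ?_
    filter_upwards [self_mem_nhdsWithin, nhdsWithin_le_nhds (Ioi_mem_nhds hpos)] with x hx hx0
    have h4 : ((x - a l : ℝ) : ℂ) ≠ 0 := by exact_mod_cast sub_ne_zero.2 hx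
    rw [slope, vsub_eq_sub, ← ha.sub_mul_section hker huniq hQ hP hρ hx0,
      ha.sum_mul_eq_zero hker huniq hQ hP hρ, sub_zero, Complex.real_smul, Complex.ofReal_inv,
      ← Complex.ofReal_sub, inv_mul_cancel_left₀ h4]
  exact h2.unique h1

end Resolvent

end GenBessel

namespace GenBessel

open MeasureTheory Set Filter Topology

/-! ### The linear systems for the resolvent solutions of the Bessel kernel -/

section BesselSystem

variable {m M : ℕ} {lo hi : ℝ} {a : Fin (2 * m) → ℝ} {l : Fin (2 * m)} {ν : Fin M → ℕ}

/-- Vieta's formulas. As `ν_0 = 0` contributes a factor `X`, the constants in `ξ_j` are the `α_i`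
shifted by one index, with `0` for `j = 0`. -/
theorem coeff_prod_nuFull (ν : Fin M → ℕ) (j : ℕ) (hj : j ≤ M + 1) :
    (-1) ^ (M + 1 - j) * (Finset.univ.val.map (nuFull ν)).esymm (M + 1 - j)
      = (Polynomial.X * ∏ l : Fin M, (Polynomial.X - Polynomial.C (ν l : ℂ))).coeff j := by
  have hcard : (Finset.univ.val.map (nuFull ν)).card = M + 1 := by simp
  have h1 := Multiset.prod_X_sub_C_coeff (Finset.univ.val.map (nuFull ν)) (k := j)
    (by rw [hcard]; exact hj)
  rw [hcard, Multiset.map_map] at h1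
  rw [← h1]
  congr 1
  change ∏ i : Fin (M + 1), (Polynomial.X - Polynomial.C (nuFull ν i)) = _
  rw [Fin.prod_univ_succ]
  simp [nuFull]

theorem xi_const_zero (ν : Fin M → ℕ) :
    (-1) ^ (M + 1 - ((0 : Fin (M + 1)) : ℕ)) *
      (Finset.univ.val.map (nuFull ν)).esymm (M + 1 - ((0 : Fin (M + 1)) : ℕ)) = 0 := by
  rw [coeff_prod_nuFull _ _ (by simp)]
  simp

theorem xi_const_succ (ν : Fin M → ℕ) (j : Fin M) :
    (-1) ^ (M + 1 - (j.succ : ℕ)) *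
      (Finset.univ.val.map (nuFull ν)).esymm (M + 1 - (j.succ : ℕ)) = alphaCoeff ν j := by
  rw [coeff_prod_nuFull _ _ j.succ.is_lt.le, Fin.val_succ, Polynomial.coeff_X_mul, alphaCoeff]

/-- The solutions of the resolvent equations for the generalized Bessel kernel `k`: `Q_j` and `P_j`
belong to `φ_j` and `ψ_j`, and `ρ_l` and `σ_l` to the sections of the kernel at `a_l`. -/
structure BesselSystem (ν : Fin M → ℕ) (a : Fin (2 * m) → ℝ) (Q P : Fin (M + 1) → ℝ → ℂ)
    (ρ σ : Fin (2 * m) → ℝ → ℂ) : Prop where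
  Q : ∀ j, Solves (besselKernel ν) a (phi ν j) (Q j)
  P : ∀ j, Solves (fun x y => besselKernel ν y x) a (psi ν j) (P j)
  ρ : ∀ l, Solves (besselKernel ν) a (fun x => besselKernel ν x (a l)) (ρ l)
  σ : ∀ l, Solves (fun x y => besselKernel ν y x) a (fun x => besselKernel ν (a l) x) (σ l)
  uniq : ∀ h u v, ContinuousOn h (Ioi 0) → Solves (besselKernel ν) a h u →
    Solves (besselKernel ν) a h v → EqOn u v (Ioi 0)
  uniq' : ∀ h u v, ContinuousOn h (Ioi 0) → Solves (fun x y => besselKernel ν y x) a h u →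
    Solves (fun x y => besselKernel ν y x) a h v → EqOn u v (Ioi 0)

/-- The variables `ξ_j` in terms of the solutions `P_j`. -/
noncomputable def xiVal (ν : Fin M → ℕ) (a : Fin (2 * m) → ℝ) (P : Fin (M + 1) → ℝ → ℂ)
    (j : Fin (M + 1)) : ℂ :=
  (-1) ^ M * (∫ x in intervals a, phi ν 0 x * P j x)
    + (-1) ^ (M + 1 - j.val) * (Finset.univ.val.map (nuFull ν)).esymm (M + 1 - j.val)

/-- The variables `η_j` in terms of the solutions `P_j`. -/
noncomputable def etaVal (ν : Fin M → ℕ) (a : Fin (2 * m) → ℝ) (P : Fin (M + 1) → ℝ → ℂ)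
    (j : Fin (M + 1)) : ℂ :=
  (-1) ^ M * ∫ x in intervals a, phi ν j x * P (Fin.last M) x

variable {Q P : Fin (M + 1) → ℝ → ℂ} {ρ σ : Fin (2 * m) → ℝ → ℂ}

/-- The equation for `Q_j` produces the integral of `ψ_M Q_j`, while `η_j` is defined by that of
`φ_j P_M`. Duality makes the same `η_j` serve both systems. -/
theorem BesselSystem.etaVal_eq (hS : BesselSystem ν a Q P ρ σ) (ha : EndPts lo hi a) (hM : 1 ≤ M)
    (j : Fin (M + 1)) :
    etaVal ν a P j = (-1) ^ M * ∫ x in intervals a, psi ν (Fin.last M) x * Q j x := by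
  obtain ⟨k₁, k₂, hker⟩ := integrableKernel_besselKernel ν hM
  rw [etaVal, ha.integral_mul_comm hker.cont (hS.Q j) (hS.P (Fin.last M))]
  simp only [mul_comm]

theorem BesselSystem.integral_psi_mul (hS : BesselSystem ν a Q P ρ σ) (ha : EndPts lo hi a)
    (hM : 1 ≤ M) (j i : Fin (M + 1)) :
    ∫ x in intervals a, psi ν j x * Q i x = ∫ x in intervals a, phi ν i x * P j x := by
  obtain ⟨k₁, k₂, hker⟩ := integrableKernel_besselKernel ν hM
  rw [ha.integral_mul_comm hker.cont (hS.Q i) (hS.P j)]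
  simp only [mul_comm]

/-- The solution for the Euler derivative of `h`, up to the contributions of the end points. -/
theorem BesselSystem.hasDerivAt_Q (hS : BesselSystem ν a Q P ρ σ) (ha : EndPts lo hi a)
    (hM : 1 ≤ M) (j : Fin (M + 1)) {h' v : ℝ → ℂ}
    (hh : ∀ x, 0 < x → HasDerivAt (phi ν j) (h' x / x) x) (hh' : ContinuousOn h' (Ioi 0))
    (hv : Solves (besselKernel ν) a h' v) {x : ℝ} (hx : 0 < x) :
    HasDerivAt (Q j) ((v x - etaVal ν a P j * Q 0 x
      - ∑ l, endSign l * a l * Q j (a l) * ρ l x) / x) x := by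
  obtain ⟨k₁, k₂, hker⟩ := integrableKernel_besselKernel ν hM
  obtain ⟨u', hu', hs⟩ := ha.exists_hasDerivAt hker (hS.Q j) hh hh'
  refine (hu' x hx).congr_deriv ?_
  congr 1
  have h1 := ha.solves_add hker.cont (ha.solves_add hker.cont hv
    ((hS.Q 0).const_mul (-etaVal ν a P j)))
    (ha.solves_sum hker.cont hS.ρ fun l => -(endSign l * a l * Q j (a l)))
  have h2 := hS.uniq _ _ _ ?_ hs (h1.congr fun y _ => ?_) hx
  · rw [h2]
    simp only [neg_mul, Finset.sum_neg_distrib]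
    ring
  · refine (hh'.add (continuousOn_const.mul hker.contα)).add (continuousOn_finsetSum _ fun l _ =>
      continuousOn_const.mul (continuousOn_section_left hker.cont (ha.pos_apply l)))
  · simp only
    rw [hS.etaVal_eq ha hM]
    ring

/-- The transposed form. The roles of `φ_0` and `ψ_M` in the rank one term are exchanged, so the
coefficient is the integral part of `ξ_j` instead of `η_j`. -/
theorem BesselSystem.hasDerivAt_P (hS : BesselSystem ν a Q P ρ σ) (ha : EndPts lo hi a)
    (hM : 1 ≤ M) (j : Fin (M + 1)) {h' v : ℝ → ℂ}
    (hh : ∀ x, 0 < x → HasDerivAt (psi ν j) (h' x / x) x) (hh' : ContinuousOn h' (Ioi 0))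
    (hv : Solves (fun x y => besselKernel ν y x) a h' v) {x : ℝ} (hx : 0 < x) :
    HasDerivAt (P j) ((v x - (-1) ^ M * (∫ x in intervals a, phi ν 0 x * P j x) * P (Fin.last M) x
      - ∑ l, endSign l * a l * P j (a l) * σ l x) / x) x := by
  obtain ⟨k₁, k₂, hker'⟩ := integrableKernel_besselKernel ν hM
  have hker := hker'.flip
  obtain ⟨u', hu', hs⟩ := ha.exists_hasDerivAt hker (hS.P j) hh hh'
  refine (hu' x hx).congr_deriv ?_
  congr 1
  have h1 := ha.solves_add hker.cont (ha.solves_add hker.cont hv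
    ((hS.P (Fin.last M)).const_mul (-((-1) ^ M * ∫ x in intervals a, phi ν 0 x * P j x))))
    (ha.solves_sum hker.cont hS.σ fun l => -(endSign l * a l * P j (a l)))
  have h2 := hS.uniq' _ _ _ ?_ hs (h1.congr fun y _ => ?_) hx
  · rw [h2]
    simp only [neg_mul, Finset.sum_neg_distrib]
    ring
  · refine (hh'.add (continuousOn_const.mul hker.contα)).add (continuousOn_finsetSum _ fun l _ =>
      continuousOn_const.mul (continuousOn_section_left hker.cont (ha.pos_apply l)))
  · simp only [mul_assoc]
    rw [integral_const_mul]
    ring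

theorem BesselSystem.hasDerivAt_Q_castSucc (hS : BesselSystem ν a Q P ρ σ)
    (ha : EndPts lo hi a) (hM : 1 ≤ M) (j : Fin M) {x : ℝ} (hx : 0 < x) :
    HasDerivAt (Q j.castSucc) ((-Q j.succ x - etaVal ν a P j.castSucc * Q 0 x
      - ∑ l, endSign l * a l * Q j.castSucc (a l) * ρ l x) / x) x := by
  refine hS.hasDerivAt_Q ha hM j.castSucc (h' := fun x => -phi ν j.succ x)
    (v := fun x => -Q j.succ x) (fun x hx => hasDerivAt_phi_castSucc ν j hx)
    (continuousOn_phi ν _).neg ?_ hx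
  simpa using (hS.Q j.succ).const_mul (-1)

/-- The Euler derivative of `φ_M` contains `x φ_0`. Commuting `x` with the resolvent adds multiples
of all `φ_j`, with integrals equal by duality to those in `ξ_j`, and the constants of `ξ_j` account
for the terms `α_i φ_{i+1}`. This is why `ξ_j` carries symmetric polynomials. -/
theorem BesselSystem.hasDerivAt_Q_last (hS : BesselSystem ν a Q P ρ σ)
    (ha : EndPts lo hi a) (hM : 1 ≤ M) {x : ℝ} (hx : 0 < x) :
    HasDerivAt (Q (Fin.last M)) (((-1) ^ (M + 1) * x * Q 0 x + ∑ j, xiVal ν a P j * Q j x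
      - etaVal ν a P (Fin.last M) * Q 0 x
      - ∑ l, endSign l * a l * Q (Fin.last M) (a l) * ρ l x) / x) x := by
  obtain ⟨k₁, k₂, hker⟩ := integrableKernel_besselKernel ν hM
  refine hS.hasDerivAt_Q ha hM (Fin.last M)
    (v := fun x => (-1) ^ (M + 1) * x * Q 0 x + ∑ j, xiVal ν a P j * Q j x)
    (fun x hx => hasDerivAt_phi_last ν hx) ?_ ?_ hx
  · exact ((continuousOn_const.mul Complex.continuous_ofReal.continuousOn).mul
      (continuousOn_phi ν 0)).add (continuousOn_finsetSum _ fun i _ =>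
        continuousOn_const.mul (continuousOn_phi ν _))
  · have h1 := ha.solves_add hker.cont
      ((ha.solves_id_mul hker (hS.Q 0)).const_mul ((-1) ^ (M + 1)))
      (ha.solves_sum hker.cont hS.Q (xiVal ν a P))
    have h2 : (fun x : ℝ => (-1) ^ (M + 1) * (x * Q 0 x) + ∑ j, xiVal ν a P j * Q j x)
        = fun x : ℝ => (-1) ^ (M + 1) * x * Q 0 x + ∑ j, xiVal ν a P j * Q j x := by
      ext x; ring
    rw [h2] at h1
    refine h1.congr fun y _ => ?_
    simp only [hS.integral_psi_mul ha hM, xiVal, add_mul, Finset.sum_add_distrib]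
    rw [Fin.sum_univ_succ (fun j : Fin (M + 1) => (-1) ^ (M + 1 - j.val) *
      (Finset.univ.val.map (nuFull ν)).esymm (M + 1 - j.val) * phi ν j y), xi_const_zero]
    simp only [xi_const_succ]
    have h3 : ∑ j, (-1) ^ M * (∫ x in intervals a, phi ν 0 x * P j x) * phi ν j y
        = (-1) ^ M * ∑ j, (∫ x in intervals a, phi ν 0 x * P j x) * phi ν j y := by
      rw [Finset.mul_sum]; exact Finset.sum_congr rfl fun j _ => by ring
    rw [h3, pow_succ]
    ring

theorem BesselSystem.hasDerivAt_P_succ (hS : BesselSystem ν a Q P ρ σ)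
    (ha : EndPts lo hi a) (hM : 1 ≤ M) (j : Fin M) {x : ℝ} (hx : 0 < x) :
    HasDerivAt (P j.succ) ((P j.castSucc x - xiVal ν a P j.succ * P (Fin.last M) x
      - ∑ l, endSign l * a l * P j.succ (a l) * σ l x) / x) x := by
  obtain ⟨k₁, k₂, hker⟩ := integrableKernel_besselKernel ν hM
  refine (hS.hasDerivAt_P ha hM j.succ
    (v := fun x => P j.castSucc x + -alphaCoeff ν j * P (Fin.last M) x)
    (fun x hx => hasDerivAt_psi_succ ν j hx) ?_ ?_ hx).congr_deriv ?_
  · exact (continuousOn_psi ν _).sub (continuousOn_const.mul (continuousOn_psi ν _))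
  · refine (ha.solves_add hker.flip.cont (hS.P j.castSucc)
      ((hS.P (Fin.last M)).const_mul (-alphaCoeff ν j))).congr fun y _ => ?_
    simp only
    ring
  · rw [xiVal, xi_const_succ]
    ring

/-- Here the Euler derivative of `ψ_0` is `(-1)^M x ψ_M`, and the commutator with `x` supplies the
sum of `η_j P_j`. No constant appears because that of `ξ_0` is zero. -/
theorem BesselSystem.hasDerivAt_P_zero (hS : BesselSystem ν a Q P ρ σ)
    (ha : EndPts lo hi a) (hM : 1 ≤ M) {x : ℝ} (hx : 0 < x) :
    HasDerivAt (P 0) (((-1) ^ M * x * P (Fin.last M) x + ∑ j, etaVal ν a P j * P j x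
      - xiVal ν a P 0 * P (Fin.last M) x
      - ∑ l, endSign l * a l * P 0 (a l) * σ l x) / x) x := by
  obtain ⟨k₁, k₂, hker'⟩ := integrableKernel_besselKernel ν hM
  have hker := hker'.flip
  refine (hS.hasDerivAt_P ha hM 0
    (v := fun x => (-1) ^ M * x * P (Fin.last M) x + ∑ j, etaVal ν a P j * P j x)
    (fun x hx => hasDerivAt_psi_zero ν hx) ?_ ?_ hx).congr_deriv ?_
  · exact (continuousOn_const.mul Complex.continuous_ofReal.continuousOn).mul
      (continuousOn_psi ν _)
  · have h1 := ha.solves_add hker.cont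
      ((ha.solves_id_mul hker (hS.P (Fin.last M))).const_mul ((-1) ^ M))
      (ha.solves_sum hker.cont hS.P (etaVal ν a P))
    have h2 : (fun x : ℝ => (-1) ^ M * (x * P (Fin.last M) x) + ∑ j, etaVal ν a P j * P j x)
        = fun x : ℝ => (-1) ^ M * x * P (Fin.last M) x + ∑ j, etaVal ν a P j * P j x := by
      ext x; ring
    rw [h2] at h1
    refine h1.congr fun y _ => ?_
    simp only [etaVal, neg_mul, integral_neg, Finset.sum_neg_distrib]
    have h3 : ∑ j, (-1) ^ M * (∫ x in intervals a, phi ν j x * P (Fin.last M) x) * psi ν j y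
        = (-1) ^ M * ∑ j, (∫ x in intervals a, phi ν j x * P (Fin.last M) x) * psi ν j y := by
      rw [Finset.mul_sum]; exact Finset.sum_congr rfl fun j _ => by ring
    rw [h3]
    ring
  · rw [xiVal, xi_const_zero, add_zero]

theorem BesselSystem.sub_mul_rho (hS : BesselSystem ν a Q P ρ σ) (ha : EndPts lo hi a)
    (hM : 1 ≤ M) {x : ℝ} (hx : 0 < x) :
    ((x : ℂ) - a l) * ρ l x = ∑ j, P j (a l) * Q j x := by
  obtain ⟨k₁, k₂, hker⟩ := integrableKernel_besselKernel ν hM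
  exact ha.sub_mul_section hker hS.uniq hS.Q hS.P (hS.ρ l) hx

theorem BesselSystem.sub_mul_sigma (hS : BesselSystem ν a Q P ρ σ) (ha : EndPts lo hi a)
    (hM : 1 ≤ M) {x : ℝ} (hx : 0 < x) :
    ((x : ℂ) - a l) * σ l x = -∑ j, Q j (a l) * P j x := by
  obtain ⟨k₁, k₂, hker⟩ := integrableKernel_besselKernel ν hM
  have h1 : ∀ j, Solves (besselKernel ν) a (fun x => -phi ν j x) (fun x => -Q j x) := fun j => by
    simpa using (hS.Q j).const_mul (-1)
  have := ha.sub_mul_section hker.flip hS.uniq' hS.P h1 (hS.σ l) hx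
  rw [this, ← Finset.sum_neg_distrib]
  exact Finset.sum_congr rfl fun j _ => by ring

end BesselSystem

end GenBessel

namespace GenBessel

open MeasureTheory Set Filter Topology

section Dynamics

variable {m M : ℕ} {lo hi : ℝ} {a : Fin (2 * m) → ℝ} {k l : Fin (2 * m)} {ν : Fin M → ℕ}

/-! ### The solutions as functions of the end points -/

/-- `Q_j = (1 - K_M)⁻¹ φ_j`. -/
noncomputable def solQ (ν : Fin M → ℕ) (a : Fin (2 * m) → ℝ) (j : Fin (M + 1)) : ℝ → ℂ :=
  oneSubInv (cutKernel (besselKernel ν) a) (phi ν j)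

/-- `P_j = (1 - K_M')⁻¹ ψ_j`. -/
noncomputable def solP (ν : Fin M → ℕ) (a : Fin (2 * m) → ℝ) (j : Fin (M + 1)) : ℝ → ℂ :=
  oneSubInv (cutKernel (fun x y => besselKernel ν y x) a) (psi ν j)

/-- The resolvent kernel of `K_M` at `a_l`. -/
noncomputable def solRho (ν : Fin M → ℕ) (a : Fin (2 * m) → ℝ) (l : Fin (2 * m)) : ℝ → ℂ :=
  oneSubInv (cutKernel (besselKernel ν) a) fun x => besselKernel ν x (a l)

/-- The resolvent kernel of `K_M'` at `a_l`. -/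
noncomputable def solSigma (ν : Fin M → ℕ) (a : Fin (2 * m) → ℝ) (l : Fin (2 * m)) : ℝ → ℂ :=
  oneSubInv (cutKernel (fun x y => besselKernel ν y x) a) fun x => besselKernel ν (a l) x

theorem continuousOn_besselKernel (ν : Fin M → ℕ) (hM : 1 ≤ M) :
    ContinuousOn (Function.uncurry (besselKernel ν)) (Ioi 0 ×ˢ Ioi 0) := by
  obtain ⟨k₁, k₂, hker⟩ := integrableKernel_besselKernel ν hM
  exact hker.cont

/-- Transposition does not change the determinants in the series, so one nonvanishing condition
serves `K_M` and `K_M'`. -/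
theorem EndPts.fredholmDet_flip (ha : EndPts lo hi a) (q : ℝ → ℝ → ℂ) :
    fredholmDet (volume.restrict (Ioi 0)) (cutKernel (fun x y => q y x) a)
      = fredholmDet (volume.restrict (Ioi 0)) (cutKernel q a) := by
  rw [ha.fredholmDet_cutKernel, ha.fredholmDet_cutKernel, ← fredholmSum_swap]
  rfl

theorem EndPts.flip_ne_zero (ha : EndPts lo hi a) (hd : detK ν a ≠ 0) :
    fredholmDet (volume.restrict (Ioi 0)) (cutKernel (fun x y => besselKernel ν y x) a) ≠ 0 := by
  rw [ha.fredholmDet_flip]; exact hd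

theorem EndPts.isInvertibleOneSub_cutKernel (ha : EndPts lo hi a) {q : ℝ → ℝ → ℂ}
    (hq : ContinuousOn (Function.uncurry q) (Ioi 0 ×ˢ Ioi 0))
    (hd : fredholmDet (volume.restrict (Ioi 0)) (cutKernel q a) ≠ 0) :
    IsInvertibleOneSub (cutKernel q a) := by
  obtain ⟨⟨B, hB⟩, -⟩ := exists_boundedKernel_clampKernel ha.pos ha.lt.le hq
  exact ha.isInvertibleOneSub hq hB (ha.isUnit_intervalOp hB hd)

theorem EndPts.solves_oneSubInv_cutKernel (ha : EndPts lo hi a) {q : ℝ → ℝ → ℂ}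
    (hq : ContinuousOn (Function.uncurry q) (Ioi 0 ×ˢ Ioi 0))
    (hd : fredholmDet (volume.restrict (Ioi 0)) (cutKernel q a) ≠ 0) {h : ℝ → ℂ}
    (hh : ContinuousOn h (Ioi 0)) : Solves q a h (oneSubInv (cutKernel q a) h) := by
  obtain ⟨⟨B, hB⟩, -⟩ := exists_boundedKernel_clampKernel ha.pos ha.lt.le hq
  exact ha.solves_oneSubInv hq hB (ha.isUnit_intervalOp hB hd) hh

theorem EndPts.eqOn_of_solves (ha : EndPts lo hi a) {q : ℝ → ℝ → ℂ}
    (hq : ContinuousOn (Function.uncurry q) (Ioi 0 ×ˢ Ioi 0))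
    (hd : fredholmDet (volume.restrict (Ioi 0)) (cutKernel q a) ≠ 0) (h u v : ℝ → ℂ)
    (hh : ContinuousOn h (Ioi 0)) (hu : Solves q a h u) (hv : Solves q a h v) :
    EqOn u v (Ioi 0) := by
  obtain ⟨⟨B, hB⟩, -⟩ := exists_boundedKernel_clampKernel ha.pos ha.lt.le hq
  exact ha.solves_unique hB (ha.isUnit_intervalOp hB hd) hh hu hv

theorem EndPts.besselSystem (ha : EndPts lo hi a) (hM : 1 ≤ M) (hd : detK ν a ≠ 0) :
    BesselSystem ν a (solQ ν a) (solP ν a) (solRho ν a) (solSigma ν a) where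
  Q := fun j => ha.solves_oneSubInv_cutKernel (continuousOn_besselKernel ν hM) hd
    (continuousOn_phi ν j)
  P := fun j => ha.solves_oneSubInv_cutKernel
    (continuousOn_uncurry_flip (continuousOn_besselKernel ν hM)) (ha.flip_ne_zero hd)
    (continuousOn_psi ν j)
  ρ := fun l => ha.solves_oneSubInv_cutKernel (continuousOn_besselKernel ν hM) hd
    (continuousOn_section_left (continuousOn_besselKernel ν hM) (ha.pos_apply l))
  σ := fun l => ha.solves_oneSubInv_cutKernel
    (continuousOn_uncurry_flip (continuousOn_besselKernel ν hM)) (ha.flip_ne_zero hd)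
    (continuousOn_section_right (continuousOn_besselKernel ν hM) (ha.pos_apply l))
  uniq := ha.eqOn_of_solves (continuousOn_besselKernel ν hM) hd
  uniq' := ha.eqOn_of_solves (continuousOn_uncurry_flip (continuousOn_besselKernel ν hM))
    (ha.flip_ne_zero hd)

/-! ### Derivatives of the dynamical variables -/

theorem hasDerivAt_phase_x_off (ha : EndPts lo hi a) (hM : 1 ≤ M) (hd : detK ν a ≠ 0)
    (hkl : k ≠ l) (j : Fin (M + 1)) :
    HasDerivAt (fun t => (besselPhase ν (Function.update a k t)).x l j)
      (prefactor l * (endSign k * solQ ν a j (a k) * solRho ν a k (a l))) (a k) := by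
  have hS := ha.besselSystem hM hd
  have hq := continuousOn_besselKernel ν hM
  obtain ⟨⟨B, hB⟩, hu⟩ := exists_boundedKernel_clampKernel ha.pos ha.lt.le hq
  have h := (ha.hasDerivAt_oneSubInv hq hB hu (ha.isUnit_intervalOp hB hd) (continuousOn_phi ν j)
    (hS.Q j) (hS.ρ k) (Ioo_subset_Icc_self (ha.mem l))).const_mul (prefactor l)
  refine h.congr_of_eventuallyEq (Eventually.of_forall fun t => ?_)
  simp only [besselPhase, Function.update_of_ne hkl.symm]
  rfl

theorem hasDerivAt_phase_y_off (ha : EndPts lo hi a) (hM : 1 ≤ M) (hd : detK ν a ≠ 0)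
    (hkl : k ≠ l) (j : Fin (M + 1)) :
    HasDerivAt (fun t => (besselPhase ν (Function.update a k t)).y l j)
      (prefactor l * (endSign k * solP ν a j (a k) * solSigma ν a k (a l))) (a k) := by
  have hS := ha.besselSystem hM hd
  have hq := continuousOn_uncurry_flip (continuousOn_besselKernel ν hM)
  obtain ⟨⟨B, hB⟩, hu⟩ := exists_boundedKernel_clampKernel ha.pos ha.lt.le hq
  have h := (ha.hasDerivAt_oneSubInv hq hB hu (ha.isUnit_intervalOp hB (ha.flip_ne_zero hd))
    (continuousOn_psi ν j) (hS.P j) (hS.σ k) (Ioo_subset_Icc_self (ha.mem l))).const_mul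
    (prefactor l)
  refine h.congr_of_eventuallyEq (Eventually.of_forall fun t => ?_)
  simp only [besselPhase, Function.update_of_ne hkl.symm]
  rfl

theorem hasDerivAt_phase_x_self (ha : EndPts lo hi a) (hM : 1 ≤ M) (hd : detK ν a ≠ 0)
    (l : Fin (2 * m)) (j : Fin (M + 1)) {q : ℂ} (hq' : HasDerivAt (solQ ν a j) q (a l)) :
    HasDerivAt (fun t => (besselPhase ν (Function.update a l t)).x l j)
      (prefactor l * (q + endSign l * solQ ν a j (a l) * solRho ν a l (a l))) (a l) := by
  have hS := ha.besselSystem hM hd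
  have hq := continuousOn_besselKernel ν hM
  obtain ⟨⟨B, hB⟩, hu⟩ := exists_boundedKernel_clampKernel ha.pos ha.lt.le hq
  have h := (ha.hasDerivAt_oneSubInv_self hq hB hu (ha.isUnit_intervalOp hB hd)
    (continuousOn_phi ν j) (hS.Q j) (hS.ρ l) hq').const_mul (prefactor l)
  refine h.congr_of_eventuallyEq (Eventually.of_forall fun t => ?_)
  simp only [besselPhase, Function.update_self]
  rfl

theorem hasDerivAt_phase_y_self (ha : EndPts lo hi a) (hM : 1 ≤ M) (hd : detK ν a ≠ 0)
    (l : Fin (2 * m)) (j : Fin (M + 1)) {q : ℂ} (hq' : HasDerivAt (solP ν a j) q (a l)) :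
    HasDerivAt (fun t => (besselPhase ν (Function.update a l t)).y l j)
      (prefactor l * (q + endSign l * solP ν a j (a l) * solSigma ν a l (a l))) (a l) := by
  have hS := ha.besselSystem hM hd
  have hq := continuousOn_uncurry_flip (continuousOn_besselKernel ν hM)
  obtain ⟨⟨B, hB⟩, hu⟩ := exists_boundedKernel_clampKernel ha.pos ha.lt.le hq
  have h := (ha.hasDerivAt_oneSubInv_self hq hB hu (ha.isUnit_intervalOp hB (ha.flip_ne_zero hd))
    (continuousOn_psi ν j) (hS.P j) (hS.σ l) hq').const_mul (prefactor l)
  refine h.congr_of_eventuallyEq (Eventually.of_forall fun t => ?_)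
  simp only [besselPhase, Function.update_self]
  rfl

/-- The moving end point and the moving solution together give the factor `φ_i(a_l) + ∫_J φ_i σ_l`,
which duality contracts to `Q_i(a_l)`. -/
theorem hasDerivAt_integral_phi_mul_solP (ha : EndPts lo hi a) (hM : 1 ≤ M) (hd : detK ν a ≠ 0)
    (l : Fin (2 * m)) (i j : Fin (M + 1)) :
    HasDerivAt (fun t => ∫ x in intervals (Function.update a l t),
        phi ν i x * solP ν (Function.update a l t) j x)
      (endSign l * solP ν a j (a l) * solQ ν a i (a l)) (a l) := by
  have hS := ha.besselSystem hM hd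
  have hq := continuousOn_uncurry_flip (continuousOn_besselKernel ν hM)
  obtain ⟨⟨B, hB⟩, hu⟩ := exists_boundedKernel_clampKernel ha.pos ha.lt.le hq
  have h := ha.hasDerivAt_integral_oneSubInv hq hB hu (ha.isUnit_intervalOp hB (ha.flip_ne_zero hd))
    (continuousOn_psi ν j) (hS.P j) (hS.σ l) (continuousOn_phi ν i)
  rwa [ha.add_integral_section hq (hS.σ l) (hS.Q i)] at h

theorem hasDerivAt_phase_xi (ha : EndPts lo hi a) (hM : 1 ≤ M) (hd : detK ν a ≠ 0)
    (l : Fin (2 * m)) (j : Fin (M + 1)) :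
    HasDerivAt (fun t => (besselPhase ν (Function.update a l t)).ξ j)
      ((-1) ^ M * (endSign l * solP ν a j (a l) * solQ ν a 0 (a l))) (a l) :=
  ((hasDerivAt_integral_phi_mul_solP ha hM hd l 0 j).const_mul _).add_const _

theorem hasDerivAt_phase_eta (ha : EndPts lo hi a) (hM : 1 ≤ M) (hd : detK ν a ≠ 0)
    (l : Fin (2 * m)) (j : Fin (M + 1)) :
    HasDerivAt (fun t => (besselPhase ν (Function.update a l t)).η j)
      ((-1) ^ M * (endSign l * solP ν a (Fin.last M) (a l) * solQ ν a j (a l))) (a l) :=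
  (hasDerivAt_integral_phi_mul_solP ha hM hd l j (Fin.last M)).const_mul _

/-! ### The dynamical equations -/

theorem endSign_eq (l : Fin (2 * m)) : endSign l = -(prefactor l * prefactor l) := by
  rw [prefactor_mul_self, neg_neg]

theorem EndPts.sub_ne_zero (ha : EndPts lo hi a) (hkl : k ≠ l) : (a k : ℂ) - a l ≠ 0 :=
  _root_.sub_ne_zero.2 (by exact_mod_cast ha.mono.injective.ne hkl)

/-- The formula for `(x - a_k) ρ_k(x)` at `x = a_l`. Since `c_k² = -endSign k`, the prefactors
absorb the sign that distinguishes left from right end points. -/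
theorem solRho_eq (ha : EndPts lo hi a) (hM : 1 ≤ M) (hd : detK ν a ≠ 0) (hkl : k ≠ l) :
    endSign k * solRho ν a k (a l) = -(prefactor k / ((a l : ℂ) - a k)) *
      ∑ i, solQ ν a i (a l) * (prefactor k * solP ν a i (a k)) := by
  have h1 := (ha.besselSystem hM hd).sub_mul_rho ha hM (l := k) (ha.pos_apply l)
  have h2 := ha.sub_ne_zero hkl.symm
  have h3 : ∑ i, solQ ν a i (a l) * (prefactor k * solP ν a i (a k))
      = prefactor k * (((a l : ℂ) - a k) * solRho ν a k (a l)) := by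
    rw [h1, Finset.mul_sum]
    exact Finset.sum_congr rfl fun i _ => by ring
  rw [h3, endSign_eq]
  field_simp

theorem solSigma_eq (ha : EndPts lo hi a) (hM : 1 ≤ M) (hd : detK ν a ≠ 0) (hkl : k ≠ l) :
    endSign k * solSigma ν a k (a l) = -(prefactor k / ((a k : ℂ) - a l)) *
      ∑ i, prefactor k * solQ ν a i (a k) * solP ν a i (a l) := by
  have h1 := (ha.besselSystem hM hd).sub_mul_sigma ha hM (l := k) (ha.pos_apply l)
  have h2 := ha.sub_ne_zero hkl
  have h3 : ∑ i, prefactor k * solQ ν a i (a k) * solP ν a i (a l)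
      = prefactor k * (((a k : ℂ) - a l) * solSigma ν a k (a l)) := by
    rw [← neg_sub, neg_mul, h1, neg_neg, Finset.mul_sum]
    exact Finset.sum_congr rfl fun i _ => by ring
  rw [h3, endSign_eq]
  field_simp

/-- The contribution of the own end point to a diagonal derivative cancels. -/
theorem mul_diag_deriv (l : Fin (2 * m)) (hl : (a l : ℂ) ≠ 0) (N : ℂ) {z R T : Fin (2 * m) → ℂ}
    (hT : ∀ k, k ≠ l → prefactor l * (endSign k * a k * z k * R k) = -T k) :
    a l * (prefactor l * ((N - ∑ k, endSign k * a k * z k * R k) / a l + endSign l * z l * R l))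
      = prefactor l * N + ∑ k ∈ Finset.univ.erase l, T k := by
  have h1 : ∑ k ∈ Finset.univ.erase l, T k
      = -(prefactor l * ∑ k ∈ Finset.univ.erase l, endSign k * a k * z k * R k) := by
    rw [Finset.mul_sum, ← Finset.sum_neg_distrib]
    exact Finset.sum_congr rfl fun k hk => by rw [hT k (Finset.ne_of_mem_erase hk), neg_neg]
  rw [h1, ← Finset.add_sum_erase Finset.univ _ (Finset.mem_univ l)]
  field_simp
  ring

theorem mul_diag_x (ha : EndPts lo hi a) (hM : 1 ≤ M) (hd : detK ν a ≠ 0) (l : Fin (2 * m))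
    (j : Fin (M + 1)) (N : ℂ) :
    a l * (prefactor l * ((N - ∑ k, endSign k * a k * solQ ν a j (a k) * solRho ν a k (a l)) / a l
        + endSign l * solQ ν a j (a l) * solRho ν a l (a l)))
      = prefactor l * N + ∑ k ∈ Finset.univ.erase l, (besselPhase ν a).x k j *
          ((a k : ℂ) / ((a l : ℂ) - a k)) *
          ∑ i, (besselPhase ν a).x l i * (besselPhase ν a).y k i := by
  have hl : (a l : ℂ) ≠ 0 := by exact_mod_cast (ha.pos_apply l).ne'
  refine mul_diag_deriv l hl N fun k hkl => ?_
  have h1 := solRho_eq ha hM hd hkl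
  have h2 : ∑ i, (besselPhase ν a).x l i * (besselPhase ν a).y k i
      = prefactor l * ∑ i, solQ ν a i (a l) * (prefactor k * solP ν a i (a k)) := by
    rw [Finset.mul_sum]
    exact Finset.sum_congr rfl fun i _ => mul_assoc _ _ _
  have h3 : (besselPhase ν a).x k j = prefactor k * solQ ν a j (a k) := rfl
  rw [h2, h3]
  linear_combination prefactor l * a k * solQ ν a j (a k) * h1

theorem mul_diag_y (ha : EndPts lo hi a) (hM : 1 ≤ M) (hd : detK ν a ≠ 0) (l : Fin (2 * m))
    (j : Fin (M + 1)) (N : ℂ) :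
    a l * (prefactor l * ((N - ∑ k, endSign k * a k * solP ν a j (a k) * solSigma ν a k (a l)) / a l
        + endSign l * solP ν a j (a l) * solSigma ν a l (a l)))
      = prefactor l * N + ∑ k ∈ Finset.univ.erase l, (besselPhase ν a).y k j *
          ((a k : ℂ) / ((a k : ℂ) - a l)) *
          ∑ i, (besselPhase ν a).x k i * (besselPhase ν a).y l i := by
  have hl : (a l : ℂ) ≠ 0 := by exact_mod_cast (ha.pos_apply l).ne'
  refine mul_diag_deriv l hl N fun k hkl => ?_
  have h1 := solSigma_eq ha hM hd hkl
  have h2 : ∑ i, (besselPhase ν a).x k i * (besselPhase ν a).y l i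
      = prefactor l * ∑ i, prefactor k * solQ ν a i (a k) * solP ν a i (a l) := by
    rw [Finset.mul_sum]
    exact Finset.sum_congr rfl fun i _ => mul_left_comm _ _ _
  have h3 : (besselPhase ν a).y k j = prefactor k * solP ν a j (a k) := rfl
  rw [h2, h3]
  linear_combination prefactor l * a k * solP ν a j (a k) * h1

theorem differentiableAt_solQ (ha : EndPts lo hi a) (hM : 1 ≤ M) (hd : detK ν a ≠ 0)
    (j : Fin (M + 1)) {x : ℝ} (hx : 0 < x) : DifferentiableAt ℝ (solQ ν a j) x := by
  have hS := ha.besselSystem hM hd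
  induction j using Fin.lastCases with
  | last => exact (hS.hasDerivAt_Q_last ha hM hx).differentiableAt
  | cast j => exact (hS.hasDerivAt_Q_castSucc ha hM j hx).differentiableAt

theorem differentiableAt_solP (ha : EndPts lo hi a) (hM : 1 ≤ M) (hd : detK ν a ≠ 0)
    (j : Fin (M + 1)) {x : ℝ} (hx : 0 < x) : DifferentiableAt ℝ (solP ν a j) x := by
  have hS := ha.besselSystem hM hd
  induction j using Fin.cases with
  | zero => exact (hS.hasDerivAt_P_zero ha hM hx).differentiableAt
  | succ j => exact (hS.hasDerivAt_P_succ ha hM j hx).differentiableAt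

theorem hasPartials_besselPhase (ha : EndPts lo hi a) (hM : 1 ≤ M) (hd : detK ν a ≠ 0) :
    HasPartials (besselPhase ν) a where
  x := fun l k j => by
    rcases eq_or_ne l k with rfl | hlk
    · exact (hasDerivAt_phase_x_self ha hM hd l j
        (differentiableAt_solQ ha hM hd j (ha.pos_apply l)).hasDerivAt).differentiableAt
    · exact (hasDerivAt_phase_x_off ha hM hd hlk j).differentiableAt
  y := fun l k j => by
    rcases eq_or_ne l k with rfl | hlk
    · exact (hasDerivAt_phase_y_self ha hM hd l j
        (differentiableAt_solP ha hM hd j (ha.pos_apply l)).hasDerivAt).differentiableAt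
    · exact (hasDerivAt_phase_y_off ha hM hd hlk j).differentiableAt
  ξ := fun l j => (hasDerivAt_phase_xi ha hM hd l j).differentiableAt
  η := fun l j => (hasDerivAt_phase_eta ha hM hd l j).differentiableAt

theorem dynamicalEquations_besselPhase (ha : EndPts lo hi a) (hM : 1 ≤ M) (hd : detK ν a ≠ 0) :
    DynamicalEquations (besselPhase ν) a := by
  have hS := ha.besselSystem hM hd
  have hx : ∀ l j, (besselPhase ν a).x l j = prefactor l * solQ ν a j (a l) := fun _ _ => rfl
  have hy : ∀ l j, (besselPhase ν a).y l j = prefactor l * solP ν a j (a l) := fun _ _ => rfl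
  have hξ : ∀ j, (besselPhase ν a).ξ j = xiVal ν a (solP ν a) j := fun _ => rfl
  have hη : ∀ j, (besselPhase ν a).η j = etaVal ν a (solP ν a) j := fun _ => rfl
  refine ⟨hasPartials_besselPhase ha hM hd, ?_, ?_, ?_, ?_, ?_, ?_, ?_, ?_⟩
  · intro k l hkl j
    rw [partialA, (hasDerivAt_phase_x_off ha hM hd hkl j).deriv]
    have h1 := solRho_eq ha hM hd hkl
    have h2 : ∑ i, (besselPhase ν a).x l i * (besselPhase ν a).y k i
        = prefactor l * ∑ i, solQ ν a i (a l) * (prefactor k * solP ν a i (a k)) := by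
      rw [Finset.mul_sum]
      exact Finset.sum_congr rfl fun i _ => mul_assoc _ _ _
    rw [h2, hx]
    linear_combination prefactor l * solQ ν a j (a k) * h1
  · intro k l hkl j
    rw [partialA, (hasDerivAt_phase_y_off ha hM hd hkl j).deriv]
    have h1 := solSigma_eq ha hM hd hkl
    have h2 : ∑ i, (besselPhase ν a).x k i * (besselPhase ν a).y l i
        = prefactor l * ∑ i, prefactor k * solQ ν a i (a k) * solP ν a i (a l) := by
      rw [Finset.mul_sum]
      exact Finset.sum_congr rfl fun i _ => mul_left_comm _ _ _
    rw [h2, hy]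
    linear_combination prefactor l * solP ν a j (a k) * h1
  · intro l j
    rw [partialA, (hasDerivAt_phase_x_self ha hM hd l _
      (hS.hasDerivAt_Q_castSucc ha hM j (ha.pos_apply l))).deriv, mul_diag_x ha hM hd]
    simp only [hx, hη]
    ring
  · intro l
    rw [partialA, (hasDerivAt_phase_x_self ha hM hd l _
      (hS.hasDerivAt_Q_last ha hM (ha.pos_apply l))).deriv, mul_diag_x ha hM hd]
    have h1 : ∑ i, (besselPhase ν a).ξ i * (besselPhase ν a).x l i
        = prefactor l * ∑ j, xiVal ν a (solP ν a) j * solQ ν a j (a l) := by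
      rw [Finset.mul_sum]
      exact Finset.sum_congr rfl fun i _ => mul_left_comm _ _ _
    rw [h1, hx l 0, hη]
    ring
  · intro l j
    rw [partialA, (hasDerivAt_phase_y_self ha hM hd l _
      (hS.hasDerivAt_P_succ ha hM j (ha.pos_apply l))).deriv, mul_diag_y ha hM hd]
    simp only [hy, hξ]
    ring
  · intro l
    rw [partialA, (hasDerivAt_phase_y_self ha hM hd l _
      (hS.hasDerivAt_P_zero ha hM (ha.pos_apply l))).deriv, mul_diag_y ha hM hd]
    have h1 : ∑ i, (besselPhase ν a).η i * (besselPhase ν a).y l i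
        = prefactor l * ∑ j, etaVal ν a (solP ν a) j * solP ν a j (a l) := by
      rw [Finset.mul_sum]
      exact Finset.sum_congr rfl fun i _ => mul_left_comm _ _ _
    rw [h1, hy l (Fin.last M), hξ]
    ring
  · intro l j
    rw [partialA, (hasDerivAt_phase_xi ha hM hd l j).deriv, hx, hy, endSign_eq, pow_succ]
    ring
  · intro l j
    rw [partialA, (hasDerivAt_phase_eta ha hM hd l j).deriv, hx, hy, endSign_eq, pow_succ]
    ring

/-! ### The logarithmic derivative of the determinant -/

theorem hasDerivAt_detK (ha : EndPts lo hi a) (hM : 1 ≤ M) (hd : detK ν a ≠ 0)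
    (l : Fin (2 * m)) : HasDerivAt (fun t => detK ν (Function.update a l t))
      (-endSign l * solRho ν a l (a l) * detK ν a) (a l) :=
  ha.hasDerivAt_fredholmDet (continuousOn_besselKernel ν hM) hd ((ha.besselSystem hM hd).ρ l)

/-- The diagonal value is `∑ P_j(a_l) Q_j'(a_l)`, and the derivatives are known from the linear
system for the `Q_j`. Collecting terms gives `H_l` before normalization by the prefactors. -/
theorem solRho_self (ha : EndPts lo hi a) (hM : 1 ≤ M) (hd : detK ν a ≠ 0) (l : Fin (2 * m)) :
    a l * solRho ν a l (a l) =
      -(∑ j, etaVal ν a (solP ν a) j * solP ν a j (a l)) * solQ ν a 0 (a l)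
      + (-1) ^ (M + 1) * a l * solQ ν a 0 (a l) * solP ν a (Fin.last M) (a l)
      - ∑ j : Fin M, solQ ν a j.succ (a l) * solP ν a j.castSucc (a l)
      + solP ν a (Fin.last M) (a l) * ∑ j, xiVal ν a (solP ν a) j * solQ ν a j (a l)
      - ∑ k ∈ Finset.univ.erase l, endSign k * a k * solRho ν a k (a l) *
          ∑ j, solP ν a j (a l) * solQ ν a j (a k) := by
  have hS := ha.besselSystem hM hd
  obtain ⟨k₁, k₂, hker⟩ := integrableKernel_besselKernel ν hM
  have hpos := ha.pos_apply l
  have hl : (a l : ℂ) ≠ 0 := by exact_mod_cast hpos.ne'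
  have h1 := ha.section_self hker hS.uniq hS.Q hS.P (hS.ρ l) (Q' := fun j => deriv (solQ ν a j))
    fun j => (differentiableAt_solQ ha hM hd j hpos).hasDerivAt
  have h0 := ha.sum_mul_eq_zero hker hS.uniq hS.Q hS.P (hS.ρ l)
  have h2 : ∑ k ∈ Finset.univ.erase l, endSign k * a k * solRho ν a k (a l) *
        ∑ j, solP ν a j (a l) * solQ ν a j (a k)
      = ∑ j, solP ν a j (a l) * ∑ k, endSign k * a k * solQ ν a j (a k) * solRho ν a k (a l) := by
    -- The term `k = l` may be included, as `∑ P_j Q_j` vanishes at `a_l`.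
    rw [Finset.sum_erase _ (by rw [h0, mul_zero])]
    simp only [Finset.mul_sum]
    rw [Finset.sum_comm]
    exact Finset.sum_congr rfl fun j _ => Finset.sum_congr rfl fun k _ => by ring
  rw [h1, h2, Fin.sum_univ_castSucc (fun j => solP ν a j (a l) * deriv (solQ ν a j) (a l)),
    Fin.sum_univ_castSucc (fun j => solP ν a j (a l) *
      ∑ k, endSign k * a k * solQ ν a j (a k) * solRho ν a k (a l)),
    Fin.sum_univ_castSucc (fun j => etaVal ν a (solP ν a) j * solP ν a j (a l)),
    (hS.hasDerivAt_Q_last ha hM hpos).deriv]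
  have h3 : ∀ j : Fin M, solP ν a j.castSucc (a l) * deriv (solQ ν a j.castSucc) (a l)
      = (-(solQ ν a j.succ (a l) * solP ν a j.castSucc (a l))
        - etaVal ν a (solP ν a) j.castSucc * solP ν a j.castSucc (a l) * solQ ν a 0 (a l)
        - solP ν a j.castSucc (a l) * ∑ k, endSign k * a k * solQ ν a j.castSucc (a k) *
            solRho ν a k (a l)) / a l := fun j => by
    rw [(hS.hasDerivAt_Q_castSucc ha hM j hpos).deriv]
    ring
  simp only [h3]
  rw [← Finset.sum_div, Finset.sum_sub_distrib, Finset.sum_sub_distrib, Finset.sum_neg_distrib,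
    ← Finset.sum_mul]
  field_simp
  ring

/-- The logarithmic derivative is `-endSign l = c_l²` times `ρ_l(a_l)`. Each term of `H_l` contains
exactly one `x^{(l)}` and one `y^{(l)}`, hence the same factor `c_l²`. -/
theorem logDetHamiltonian_eq (ha : EndPts lo hi a) (hM : 1 ≤ M) (hd : detK ν a ≠ 0)
    (l : Fin (2 * m)) : logDetHamiltonian ν a l = hamiltonian a l (besselPhase ν a) := by
  have h1 : logDetHamiltonian ν a l
      = prefactor l * prefactor l * (a l * solRho ν a l (a l)) := by
    rw [logDetHamiltonian, logDeriv_apply, (hasDerivAt_detK ha hM hd l).deriv,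
      Function.update_eq_self, endSign_eq]
    field_simp
  have hx : ∀ l j, (besselPhase ν a).x l j = prefactor l * solQ ν a j (a l) := fun _ _ => rfl
  have hy : ∀ l j, (besselPhase ν a).y l j = prefactor l * solP ν a j (a l) := fun _ _ => rfl
  have hξ : ∀ j, (besselPhase ν a).ξ j = xiVal ν a (solP ν a) j := fun _ => rfl
  have hη : ∀ j, (besselPhase ν a).η j = etaVal ν a (solP ν a) j := fun _ => rfl
  have e1 : ∑ j, etaVal ν a (solP ν a) j * (prefactor l * solP ν a j (a l))
      = prefactor l * ∑ j, etaVal ν a (solP ν a) j * solP ν a j (a l) := by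
    rw [Finset.mul_sum]; exact Finset.sum_congr rfl fun j _ => mul_left_comm _ _ _
  have e2 : ∑ j : Fin M, prefactor l * solQ ν a j.succ (a l) *
        (prefactor l * solP ν a j.castSucc (a l))
      = prefactor l * prefactor l *
        ∑ j : Fin M, solQ ν a j.succ (a l) * solP ν a j.castSucc (a l) := by
    rw [Finset.mul_sum]; exact Finset.sum_congr rfl fun j _ => by ring
  have e3 : ∑ j, xiVal ν a (solP ν a) j * (prefactor l * solQ ν a j (a l))
      = prefactor l * ∑ j, xiVal ν a (solP ν a) j * solQ ν a j (a l) := by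
    rw [Finset.mul_sum]; exact Finset.sum_congr rfl fun j _ => mul_left_comm _ _ _
  have e4 : ∑ k ∈ Finset.univ.erase l, ((a k : ℂ) / ((a l : ℂ) - a k)) *
        ∑ i, ∑ j, prefactor k * solQ ν a i (a k) * (prefactor l * solQ ν a j (a l)) *
          (prefactor l * solP ν a i (a l)) * (prefactor k * solP ν a j (a k))
      = -(prefactor l * prefactor l *
        ∑ k ∈ Finset.univ.erase l, endSign k * a k * solRho ν a k (a l) *
          ∑ j, solP ν a j (a l) * solQ ν a j (a k)) := by
    rw [Finset.mul_sum, ← Finset.sum_neg_distrib]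
    refine Finset.sum_congr rfl fun k hk => ?_
    have h2 := solRho_eq ha hM hd (Finset.ne_of_mem_erase hk)
    have h3 : ∑ i, ∑ j, prefactor k * solQ ν a i (a k) * (prefactor l * solQ ν a j (a l)) *
          (prefactor l * solP ν a i (a l)) * (prefactor k * solP ν a j (a k))
        = prefactor l * prefactor l * prefactor k * ((∑ j, solP ν a j (a l) * solQ ν a j (a k)) *
          ∑ i, solQ ν a i (a l) * (prefactor k * solP ν a i (a k))) := by
      rw [Finset.sum_mul_sum]
      simp only [Finset.mul_sum]
      exact Finset.sum_congr rfl fun i _ => Finset.sum_congr rfl fun j _ => by ring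
    rw [h3]
    linear_combination prefactor l * prefactor l * a k *
      (∑ j, solP ν a j (a l) * solQ ν a j (a k)) * h2
  rw [h1, solRho_self ha hM hd l, hamiltonian]
  simp only [hx, hy, hξ, hη]
  rw [e1, e2, e3, e4]
  ring

end Dynamics

end GenBessel

/-! ### The proposition -/

theorem proposition3p4 (M m : ℕ) (hM : 1 ≤ M) (ν : Fin M → ℕ) :
    -- the dynamical equations are the Hamiltonian equations, for all functions of the end points
    (∀ (P : (Fin (2 * m) → ℝ) → GenBessel.Phase m M) (a : Fin (2 * m) → ℝ),
      (∀ l, 0 < a l) → StrictMono a →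
        (GenBessel.DynamicalEquations P a ↔
          GenBessel.HamiltonEquations GenBessel.hamiltonian P a)) ∧
    -- the quantities of the kernel
    ∀ a : Fin (2 * m) → ℝ, (∀ l, 0 < a l) → StrictMono a → GenBessel.detK ν a ≠ 0 →
      Summable (GenBessel.fredholmTerm (MeasureTheory.volume.restrict (Set.Ioi 0))
        (GenBessel.kernelK ν a)) ∧
      GenBessel.IsInvertibleOneSub (GenBessel.kernelK ν a) ∧
      GenBessel.IsInvertibleOneSub (GenBessel.kernelK' ν a) ∧
      (∀ l, GenBessel.HasPartial (GenBessel.detK ν) l a) ∧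
      GenBessel.HamiltonEquations GenBessel.hamiltonian (GenBessel.besselPhase ν) a ∧
      ∀ l, GenBessel.logDetHamiltonian ν a l =
        GenBessel.hamiltonian a l (GenBessel.besselPhase ν a) := by
  refine ⟨fun P a ha hmono => GenBessel.dynamicalEquations_iff_hamiltonEquations a P ha hmono,
    fun a hpos hmono hd => ?_⟩
  -- An auxiliary compact interval around the end points; it also exists for `m = 0`, and the
  -- conclusions do not involve it.
  obtain ⟨lo, hi, ha⟩ := GenBessel.exists_endPts hpos hmono
  have hk := GenBessel.continuousOn_besselKernel ν hM
  exact ⟨ha.summable_fredholmTerm hk, ha.isInvertibleOneSub_cutKernel hk hd,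
    ha.isInvertibleOneSub_cutKernel (GenBessel.continuousOn_uncurry_flip hk) (ha.flip_ne_zero hd),
    fun l => (GenBessel.hasDerivAt_detK ha hM hd l).differentiableAt,
    (GenBessel.dynamicalEquations_iff_hamiltonEquations a _ hpos hmono).1
      (GenBessel.dynamicalEquations_besselPhase ha hM hd),
    fun l => GenBessel.logDetHamiltonian_eq ha hM hd l⟩
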